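/- Let $K\ge 0$, let $g$ be a probability density on $\mathbb R$ and let $r_{\rm stat}\in[0,1]$. Put $\kappa=Kr_{\rm stat}$ and consider the partially locked state $$f_{\rm stat}(\theta,\omega)=\begin{cases}\delta_{\arcsin(\omega/\kappa)}(\theta)\,g(\omega)&\text{if }|\omega|\le\kappa,\\[2pt] \dfrac{\sqrt{\omega^2-\kappa^2}}{2\pi|\omega-\kappa\sin\theta|}\,g(\omega)&\text{if }|\omega|>\kappa,\end{cases}$$ on $\mathbb T\times\mathbb R$, which is assumed to satisfy the self-consistency equation $r_{\rm stat}=\int_{\mathbb R}\int_{\mathbb T}e^{i\theta}f_{\rm stat}(\theta,\omega)\,d\theta\,d\omega$. Let $\hat f_\ell(\xi)=\int\!\int e^{-i\ell\theta-i\xi\omega}f_{\rm stat}(\theta,\omega)\,d\theta\,d\omega$ and $\hat g(\xi)=\int e^{-i\xi\omega}g(\omega)\,d\omega$. With $p_b(\xi)=(1+\xi)^b$ and weak derivatives $\partial_\xi$ on $(0,\infty)$, define in $[0,\infty]$ (the norms are $\infty$ if a weak derivative does not exist) $$\|u\|_{\phi,k}^2=\sum_{\ell\ge1}\int_0^\infty\big(|u_\ell|^2+|\partial_\xi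 u_\ell|^2\big)\,|\phi|^2\,\ell^{2k}\,d\xi,\qquad \|\hat g\|_\phi^2=\int_0^\infty\big(|\hat g|^2+|\partial_\xi\hat g|^2\big)|\phi|^2\,d\xi .$$ For $\ell\ge1$ let $$(r_r)_\ell=\tfrac{K\ell}{2}\big(\hat f_{\ell-1}-\hat f_{\ell+1}\big),\qquad (r_i)_\ell=\tfrac{K\ell i}{2}\big(\hat f_{\ell-1}+\hat f_{\ell+1}\big),\qquad (D\hat R\hat f)_\ell=i\ell\hat f_\ell .$$ Let $e^{tL_1}$ be the evolution, by weak solutions that are weakly continuous and locally bounded in time with values in the space of the norm $\|\cdot\|_{p_0,-1/2}$, of $(L_1u)_\ell=\ell\partial_\xi u_\ell+\frac{\kappa\ell}{2}(u_{\ell-1}-u_{\ell+1})$ on $\ell\ge1$, $\xi\ge0$, with $u_0\equiv0$. Let $$k_{Lc}(t)=-\begin{pmatrix}\operatorname{Re}(e^{tL_1}r_r)_1(0)&\operatorname{Re}(e^{tL_1}r_i)_1(0)\\ \operatorname{Im}(e^{tL_1}r_r)_1(0)&\operatorname{Im}(e^{tL_1}r_i)_1(0)\end{pmatrix}$$ and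 let $r_{Lc}$ be its locally integrable resolvent, $r_{Lc}+k_{Lc}\star r_{Lc}=r_{Lc}+r_{Lc}\star k_{Lc}=k_{Lc}$ on $(0,\infty)$, where $(A\star B)(t)=\int_0^tA(t-s)B(s)\,ds$. Whenever $r_{Lc}=\begin{pmatrix}0&0\\ c_r&c_i\end{pmatrix}+r_{Lcs}$ with constants $c_r,c_i\in\mathbb R$ and $r_{Lcs}\in L^1(\mathbb R^+)$, put $$\alpha(u)=\int_0^\infty\big(c_r\operatorname{Re}(e^{tL_1}u)_1(0)+c_i\operatorname{Im}(e^{tL_1}u)_1(0)\big)\,dt,\qquad r_\Theta=\frac{D\hat R\hat f}{\alpha(D\hat R\hat f)} .$$ **Proposition.** Let $b\ge0$, $k\in\{0,\frac12,1,\frac32,\dots\}$ and $\kappa\ge0$. There is a constant $C_{\rm stat}>0$, depending only on $k$, $b$ and $\kappa$, such that for all $K$, $r_{\rm stat}$ and $g$ as above with $Kr_{\rm stat}=\kappa$ $$\|\hat f\|_{p_b,k}\le C_{\rm stat}\,\|\hat g\|_{p_{b+k+1}},\qquad \|r_r\|_{p_b,k}\le K\,C_{\rm stat}\,\|\hat g\|_{p_{b+k+2}},\qquad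 \|r_i\|_{p_b,k}\le K\,C_{\rm stat}\,\|\hat g\|_{p_{b+k+2}},$$ and, if moreover $r_{\rm stat}>0$ and $\alpha$ is defined as above with $t\mapsto(e^{tL_1}D\hat R\hat f)_1(0)$ integrable on $(0,\infty)$, then $\alpha(D\hat R\hat f)\ne0$ and $$\|r_\Theta\|_{p_b,k}\le \frac{C_{\rm stat}}{r_{\rm stat}}\,\|\hat g\|_{p_{b+k+2}} .$$ In particular the bounds of $r_r,r_i,r_\Theta$ hold with a constant that depends only on $k$, $b$, $K$ and $r_{\rm stat}$. -/

import Mathlib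

open MeasureTheory Set
open scoped ENNReal

noncomputable section

namespace Kuramoto

/-! ### Weighted Sobolev norms on the half line -/

/-- Smooth real test functions with compact support in the open half line `(0, ∞)`. -/
def IsTest (φ : ℝ → ℝ) : Prop :=
  ContDiff ℝ ((⊤ : ℕ∞) : WithTop ℕ∞) φ ∧ HasCompactSupport φ ∧ tsupport φ ⊆ Ioi 0

/-- `w` is a weak derivative of `v` on `(0, ∞)`. -/
def IsWeakDeriv (v w : ℝ → ℂ) : Prop :=
  LocallyIntegrableOn v (Ioi 0) ∧ LocallyIntegrableOn w (Ioi 0) ∧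
    ∀ φ : ℝ → ℝ, IsTest φ →
      ∫ ξ in Ioi (0 : ℝ), v ξ * ((deriv φ ξ : ℝ) : ℂ)
        = -∫ ξ in Ioi (0 : ℝ), w ξ * ((φ ξ : ℝ) : ℂ)

/-- The weight `p_b(ξ) = (1 + ξ)^b`. -/
def p (b : ℝ) (ξ : ℝ) : ℝ := (1 + ξ) ^ b

/-- `∫₀^∞ (|v|² + |∂_ξ v|²) |φ|² dξ` with the weak derivative `∂_ξ v`. The weak derivative is unique
almost everywhere, so the infimum is over a single value; it is `∞` if there is no weak
derivative. -/
def sobolevSq (φ : ℝ → ℝ) (v : ℝ → ℂ) : ℝ≥0∞ :=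
  ⨅ (w : ℝ → ℂ) (_ : IsWeakDeriv v w),
    ∫⁻ ξ in Ioi (0 : ℝ), ENNReal.ofReal ((‖v ξ‖ ^ 2 + ‖w ξ‖ ^ 2) * φ ξ ^ 2)

/-- The norm `‖v‖_φ` of a function on the half line (used for the velocity profile). -/
def profileNorm (φ : ℝ → ℝ) (v : ℝ → ℂ) : ℝ≥0∞ :=
  sobolevSq φ v ^ (1 / 2 : ℝ)

/-- The norm `‖u‖_{φ,k}`, given by
`‖u‖²_{φ,k} = ∑_{ℓ ≥ 1} ∫₀^∞ (|u_ℓ|² + |∂_ξ u_ℓ|²) |φ|² ℓ^{2k} dξ`; only the modes `ℓ ≥ 1` and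
the frequencies `ξ > 0` enter. -/
def modeNorm (φ : ℝ → ℝ) (k : ℝ) (u : ℕ → ℝ → ℂ) : ℝ≥0∞ :=
  (∑' ℓ : ℕ, ENNReal.ofReal (((ℓ + 1 : ℕ) : ℝ) ^ (2 * k)) * sobolevSq φ (u (ℓ + 1))) ^ (1 / 2 : ℝ)

/-! ### The partially locked stationary state, with `κ = K r_stat` -/

/-- The conditional distribution of the phase `θ ∈ (-π, π]` given the velocity `ω`:
`f_stat(θ, ω) dθ = phaseMeasure κ ω (dθ) g(ω)`. -/
def phaseMeasure (κ ω : ℝ) : Measure ℝ :=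
  open Classical in
  if |ω| ≤ κ then Measure.dirac (Real.arcsin (ω / κ))
  else (volume.restrict (Ioc (-Real.pi) Real.pi)).withDensity
    fun θ => ENNReal.ofReal
      (Real.sqrt (ω ^ 2 - κ ^ 2) / (2 * Real.pi * |ω - κ * Real.sin θ|))

/-- `ĝ(ξ) = ∫ e^{-iξω} g(ω) dω`. -/
def gHat (g : ℝ → ℝ) (ξ : ℝ) : ℂ :=
  ∫ ω : ℝ, Complex.exp (-Complex.I * ξ * ω) * (g ω : ℂ)

/-- `(f̂_stat)_ℓ(ξ) = ∫ ∫ e^{-iℓθ - iξω} f_stat(θ, ω) dθ dω`, for `ℓ ≥ 0`. -/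
def fHat (κ : ℝ) (g : ℝ → ℝ) (ℓ : ℕ) (ξ : ℝ) : ℂ :=
  ∫ ω : ℝ, (∫ θ, Complex.exp (-Complex.I * ℓ * θ - Complex.I * ξ * ω) ∂(phaseMeasure κ ω))
    * (g ω : ℂ)

/-- `g` is a probability density, and the state `f_stat` with velocity distribution `g` and
coupling `K` satisfies the self-consistency equation with order parameter `r ∈ [0, 1]`. -/
structure IsStationaryState (K r : ℝ) (g : ℝ → ℝ) : Prop where
  K_nonneg : 0 ≤ K
  r_nonneg : 0 ≤ r
  r_le_one : r ≤ 1
  g_nonneg : ∀ ω, 0 ≤ g ω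
  g_integrable : Integrable g
  g_mass : ∫ ω : ℝ, g ω = 1
  self_consistent :
    (r : ℂ) = ∫ ω : ℝ, (∫ θ, Complex.exp (Complex.I * (θ : ℂ)) ∂(phaseMeasure (K * r) ω)) * (g ω : ℂ)

/-- `(r_r)_ℓ = (Kℓ/2) ((f̂_stat)_{ℓ-1} - (f̂_stat)_{ℓ+1})`. -/
def rR (K r : ℝ) (g : ℝ → ℝ) (ℓ : ℕ) (ξ : ℝ) : ℂ :=
  (K : ℂ) * ℓ / 2 * (fHat (K * r) g (ℓ - 1) ξ - fHat (K * r) g (ℓ + 1) ξ)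

/-- `(r_i)_ℓ = (Kℓi/2) ((f̂_stat)_{ℓ-1} + (f̂_stat)_{ℓ+1})`. -/
def rI (K r : ℝ) (g : ℝ → ℝ) (ℓ : ℕ) (ξ : ℝ) : ℂ :=
  (K : ℂ) * ℓ * Complex.I / 2 * (fHat (K * r) g (ℓ - 1) ξ + fHat (K * r) g (ℓ + 1) ξ)

/-- The rotation mode `(D R̂ f̂_stat)_ℓ = i ℓ (f̂_stat)_ℓ`. -/
def rotMode (κ : ℝ) (g : ℝ → ℝ) (ℓ : ℕ) (ξ : ℝ) : ℂ :=
  Complex.I * ℓ * fHat κ g ℓ ξ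

/-! ### The evolution `e^{tL₁}` -/

/-- `u_{ℓ-1}` with the convention `u_0 = 0`. -/
def lower (u : ℕ → ℝ → ℂ) (ℓ : ℕ) (ξ : ℝ) : ℂ :=
  if ℓ ≤ 1 then 0 else u (ℓ - 1) ξ

/-- `w(t) = e^{tL₁} v`: the weak solution of `∂_t w = L₁ w`, `w(0) = v`, where
`(L₁ u)_ℓ = ℓ ∂_ξ u_ℓ + (κℓ/2) (u_{ℓ-1} - u_{ℓ+1})` on `ℓ ≥ 1`, `ξ ≥ 0` with `u_0 = 0`.
It is locally bounded in time with values in the space `X` of the norm `‖·‖_{p_0,-1/2}`, which is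
the largest of the spaces of the norms `‖·‖_{p_b,-1/2}`, `b ≥ 0`. For such `w`, the
joint continuity of all the modes is the same as the weak continuity of `t ↦ w(t) ∈ X`. -/
structure IsEvolution (κ : ℝ) (v : ℕ → ℝ → ℂ) (w : ℝ → ℕ → ℝ → ℂ) : Prop where
  continuous_modes : ∀ ℓ, 1 ≤ ℓ →
    ContinuousOn (fun q : ℝ × ℝ => w q.1 ℓ q.2) (Ici 0 ×ˢ Ici 0)
  bounded : ∀ T : ℝ, ∃ M : ℝ, ∀ t ∈ Icc 0 T, modeNorm (p 0) (-1 / 2) (w t) ≤ ENNReal.ofReal M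
  initial : ∀ ℓ, 1 ≤ ℓ → ∀ ξ, 0 ≤ ξ → w 0 ℓ ξ = v ℓ ξ
  weak_eq : ∀ ℓ, 1 ≤ ℓ → ∀ φ : ℝ → ℝ, IsTest φ → ∀ t, 0 ≤ t →
    ∫ ξ in Ioi (0 : ℝ), w t ℓ ξ * ((φ ξ : ℝ) : ℂ)
      = (∫ ξ in Ioi (0 : ℝ), v ℓ ξ * ((φ ξ : ℝ) : ℂ))
        + ∫ s in (0 : ℝ)..t, ∫ ξ in Ioi (0 : ℝ),
            (-(ℓ : ℂ) * w s ℓ ξ * ((deriv φ ξ : ℝ) : ℂ)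
              + (κ : ℂ) * ℓ / 2 * (lower (w s) ℓ ξ - w s (ℓ + 1) ξ) * ((φ ξ : ℝ) : ℂ))

/-! ### The linearised Volterra equation and the functional `α` -/

/-- The convolution kernel `k_{Lc}(t)`, where `wr t = e^{tL₁} r_r` and `wi t = e^{tL₁} r_i`. -/
def kLc (wr wi : ℝ → ℕ → ℝ → ℂ) (t : ℝ) : Matrix (Fin 2) (Fin 2) ℝ :=
  -!![(wr t 1 0).re, (wi t 1 0).re; (wr t 1 0).im, (wi t 1 0).im]

/-- Entries of `(A ⋆ B)(t) = ∫₀^t A(t-s) B(s) ds`. -/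
def conv (A B : ℝ → Matrix (Fin 2) (Fin 2) ℝ) (t : ℝ) : Matrix (Fin 2) (Fin 2) ℝ :=
  fun i j => ∫ s in (0 : ℝ)..t, (A (t - s) * B s) i j

/-- `R` is the locally integrable resolvent of the kernel `A`:
`R + A ⋆ R = R + R ⋆ A = A` almost everywhere on `(0, ∞)`. -/
def IsResolvent (A R : ℝ → Matrix (Fin 2) (Fin 2) ℝ) : Prop :=
  (∀ i j, LocallyIntegrableOn (fun t => R t i j) (Ici 0)) ∧
    ∀ᵐ t ∂(volume.restrict (Ioi (0 : ℝ))), R t + conv A R t = A t ∧ R t + conv R A t = A t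

/-- `K_Θ = (0, 1)ᵀ ⊗ (c_r, c_i)`. -/
def KTheta (cr ci : ℝ) : Matrix (Fin 2) (Fin 2) ℝ := !![0, 0; cr, ci]

/-- `c_r, c_i` are the coefficients `c_{Θ,r}, c_{Θ,i}` of the stationary state: the resolvent of
`k_{Lc}` is `K_Θ + r_{Lcs}` with `K_Θ = (0, 1)ᵀ ⊗ (c_r, c_i)` and `r_{Lcs} ∈ L¹(ℝ⁺)`. -/
def IsRotationCoeff (K r : ℝ) (g : ℝ → ℝ) (cr ci : ℝ) : Prop :=
  ∃ wr wi : ℝ → ℕ → ℝ → ℂ, IsEvolution (K * r) (rR K r g) wr ∧ IsEvolution (K * r) (rI K r g) wi ∧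
    ∃ R : ℝ → Matrix (Fin 2) (Fin 2) ℝ, IsResolvent (kLc wr wi) R ∧
      ∀ i j, IntegrableOn (fun t => R t i j - KTheta cr ci i j) (Ioi 0)

/-- `a = α(u) = ∫₀^∞ (c_r Re (e^{tL₁} u)_1(0) + c_i Im (e^{tL₁} u)_1(0)) dt`, an absolutely
convergent integral. -/
def IsAlpha (κ cr ci : ℝ) (u : ℕ → ℝ → ℂ) (a : ℝ) : Prop :=
  ∃ w : ℝ → ℕ → ℝ → ℂ, IsEvolution κ u w ∧ IntegrableOn (fun t => w t 1 0) (Ioi 0) ∧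
    a = ∫ t in Ioi (0 : ℝ), (cr * (w t 1 0).re + ci * (w t 1 0).im)

/-- `r_Θ = D R̂ f̂_stat / a`, where `a = α(D R̂ f̂_stat)`. -/
def rTheta (κ : ℝ) (g : ℝ → ℝ) (a : ℝ) (ℓ : ℕ) (ξ : ℝ) : ℂ :=
  rotMode κ g ℓ ξ / (a : ℂ)

end Kuramoto

end

/-! The conditional moments m_ℓ(ω) = ∫ e^{-iℓθ} f_stat(dθ | ω) inherit a three-term recursion from
stationarity: the flux (ω - κ sin θ) f is constant in θ, so -iω m_ℓ = (κ/2)(m_{ℓ+1} - m_{ℓ-1}) for ℓ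
≥ 1 (`moment_rec`). After the Fourier transform in ω this reads ∂_ξ f̂_ℓ = (κ/2)(f̂_{ℓ+1} -
f̂_{ℓ-1}), driven by f̂_0 = ĝ.

Energy bounds. In d/dξ ∑ ℓ^n |f̂_ℓ|² the coupling telescopes (`flux_ge`), up to the source κ |f̂_1|
|ĝ| and a loss of the same type with ℓ^{n-1}. Integrating from ξ to ∞ bounds the energy of order n
by (κ ∫_ξ^∞ |ĝ|)² plus a multiple of the tail integral of the energy of order n-1; the iteration is
`tailBound`. Hardy-type inequalities charge two powers of 1+ξ for the squared tail and one for each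
further tail, so a weight 2b on the left becomes 2b + n + 2 on |ĝ|²
(`exists_lintegral_wt_tailBound_le`). With n = 2k this is the weight of p_{b+k+1}. The sequences
r_r, r_i and the rotation mode carry a factor ℓ, which raises n by 2 and gives p_{b+k+2}.

Damping. Neither the sum over ℓ nor the limit ξ → ∞ is controlled a priori. Hence m_ℓ is replaced by
β^ℓ, where β solves κβ² + 2(ε + iω)β - κ = 0 in the unit disc. These powers satisfy the recursion
with damping ε, |β| ≤ q < 1 uniformly in ω, and β^ℓ → m_ℓ as ε → 0 unless |ω| = κ
(`tendsto_dampedRoot_pow`). The energy bound does not depend on ε and passes to the limit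
(`modeEnergy_fHat_le_tailBound`).

Rotation mode. The estimate of r_Θ needs α(D R̂ f̂) = -r_stat (`alpha_rotMode`). The derivative
formula for f̂ gives L₁ D R̂ f̂ = -r r_i, so e^{tL₁} D R̂ f̂ = D R̂ f̂ - r ∫₀^t e^{sL₁} r_i ds
(`evolution_rotMode`), by a uniqueness theorem for weak solutions that follows from testing with
translates and iterating along characteristics. At ℓ = 1, ξ = 0 the left side is z(t) = ir + r ∫₀^t
h, where h is the second column of k_{Lc} read as a complex number. Integrating the resolvent
equation in time turns it into R_{1·} ⋆ z = Im z - r. Splitting off the constant part of R leaves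
∫₀^T (c_r Re z + c_i Im z) + r as an integrable function of T that has a limit, which must be 0. -/

noncomputable section

namespace Kuramoto

open Filter Topology

/-! ### The conditional phase distribution and its moments -/

/-- The drifting phase density. -/
def driftDensity (κ ω θ : ℝ) : ℝ :=
  Real.sqrt (ω ^ 2 - κ ^ 2) / (2 * Real.pi * |ω - κ * Real.sin θ|)

lemma driftDensity_nonneg (κ ω θ : ℝ) : 0 ≤ driftDensity κ ω θ := by
  unfold driftDensity; positivity

lemma abs_mul_sin_lt {κ ω : ℝ} (hκ : 0 ≤ κ) (h : κ < |ω|) (θ : ℝ) :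
    ω - κ * Real.sin θ ≠ 0 := by
  intro h0
  have h1 : |ω| = κ * |Real.sin θ| := by
    rw [sub_eq_zero.mp h0, abs_mul, abs_of_nonneg hκ]
  have := Real.abs_sin_le_one θ
  nlinarith [abs_nonneg (Real.sin θ)]

lemma continuous_driftDensity {κ ω : ℝ} (hκ : 0 ≤ κ) (h : κ < |ω|) :
    Continuous (driftDensity κ ω) := by
  unfold driftDensity
  refine Continuous.div (by fun_prop) (by fun_prop) fun θ => ?_
  have := abs_pos.mpr (abs_mul_sin_lt hκ h θ)
  positivity

/-- Since d is a root, numerator and denominator of the Poisson kernel at iκ/d share the factor 2/d.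
This identifies the drifting density, up to 2π, with a Poisson kernel. -/
lemma poissonKernel_eq_of_root {κ ω d : ℝ} (hd : d ≠ 0) (hq : d ^ 2 + κ ^ 2 = 2 * ω * d) (θ : ℝ) :
    poissonKernel 0 (Complex.I * ((κ / d : ℝ) : ℂ)) (circleMap 0 1 θ)
      = (d - ω) / (ω - κ * Real.sin θ) := by
  have h1 : ‖circleMap 0 1 θ‖ = 1 := by simp
  have h2 : ‖Complex.I * ((κ / d : ℝ) : ℂ)‖ ^ 2 = κ ^ 2 / d ^ 2 := by
    rw [norm_mul, Complex.norm_I, one_mul, Complex.norm_real, Real.norm_eq_abs, sq_abs, div_pow]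
  have h3 : ‖circleMap 0 1 θ - Complex.I * ((κ / d : ℝ) : ℂ)‖ ^ 2
      = 1 + κ ^ 2 / d ^ 2 - 2 * (κ / d) * Real.sin θ := by
    rw [← Complex.normSq_eq_norm_sq, Complex.normSq_apply, circleMap_zero, Complex.exp_mul_I]
    simp [Complex.cos_ofReal_re, Complex.sin_ofReal_re]
    have := Real.sin_sq_add_cos_sq θ
    ring_nf
    rw [← Real.sin_sq_add_cos_sq θ]
    ring
  rw [poissonKernel_def]
  simp only [sub_zero]
  rw [h1, h2, h3]
  have e1 : 1 + κ ^ 2 / d ^ 2 - 2 * (κ / d) * Real.sin θ = (2 / d) * (ω - κ * Real.sin θ) := by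
    field_simp; linarith
  have e2 : 1 ^ 2 - κ ^ 2 / d ^ 2 = (2 / d) * (d - ω) := by
    field_simp; linarith
  rw [e1, e2, mul_div_mul_left _ _ (by positivity)]

/-- The Poisson kernel has circle average 1, by the Poisson formula for the constant function 1. -/
lemma integral_driftDensity {κ ω : ℝ} (hκ : 0 ≤ κ) (h : κ < |ω|) :
    ∫ θ in Ioc (-Real.pi) Real.pi, driftDensity κ ω θ = 1 := by
  have hs0 : 0 < ω ^ 2 - κ ^ 2 := by
    rw [← sq_abs ω]; nlinarith
  set σ := Real.sqrt (ω ^ 2 - κ ^ 2) with hσ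
  have hσ0 : 0 < σ := Real.sqrt_pos.mpr hs0
  have hσ2 : σ ^ 2 = ω ^ 2 - κ ^ 2 := Real.sq_sqrt hs0.le
  obtain ⟨d, hd, hd1, hq, hdens⟩ : ∃ d : ℝ, d ≠ 0 ∧ |κ / d| < 1 ∧ d ^ 2 + κ ^ 2 = 2 * ω * d ∧
      ∀ θ, (d - ω) / (ω - κ * Real.sin θ) = 2 * Real.pi * driftDensity κ ω θ := by
    have key : ∀ θ, 2 * Real.pi * driftDensity κ ω θ = σ / |ω - κ * Real.sin θ| := by
      intro θ
      unfold driftDensity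
      have := Real.pi_pos
      rw [← hσ]
      have h3 := abs_pos.mpr (abs_mul_sin_lt hκ h θ)
      field_simp
    have hsin := fun θ => Real.abs_sin_le_one θ
    rcases le_or_gt 0 ω with hω | hω
    · rw [abs_of_nonneg hω] at h
      -- Of the roots ω ± σ the one of larger modulus is chosen, so that iκ/d lies inside the disc;
      -- its sign follows that of ω.
      refine ⟨ω + σ, by positivity, ?_, by nlinarith, fun θ => ?_⟩
      · rw [abs_of_nonneg (by positivity), div_lt_one (by positivity)]; linarith
      · have : 0 < ω - κ * Real.sin θ := by nlinarith [abs_le.mp (hsin θ)]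
        rw [key, abs_of_pos this]; ring
    · rw [abs_of_neg hω] at h
      have hneg : ω - σ < 0 := by linarith
      refine ⟨ω - σ, hneg.ne, ?_, by nlinarith, fun θ => ?_⟩
      · rw [abs_div, abs_of_nonneg hκ, abs_of_neg hneg, div_lt_one (by linarith)]; linarith
      · have : ω - κ * Real.sin θ < 0 := by nlinarith [abs_le.mp (hsin θ)]
        rw [key, abs_of_neg this, div_neg, ← neg_div]; ring
  have hf : DiffContOnCl ℂ (fun _ : ℂ => (1 : ℂ)) (Metric.ball 0 1) := diffContOnCl_const
  have hw : Complex.I * ((κ / d : ℝ) : ℂ) ∈ Metric.ball (0 : ℂ) 1 := by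
    rw [mem_ball_zero_iff, norm_mul, Complex.norm_I, one_mul, Complex.norm_real]
    exact hd1
  have hP := DiffContOnCl.circleAverage_re_herglotzRieszKernel_smul hf hw
  rw [← poissonKernel_eq_re_herglotzRieszKernel,
      Real.circleAverage_eq_integral_add (-Real.pi)] at hP
  simp only [Pi.smul_apply', poissonKernel_eq_of_root hd hq, hdens] at hP
  rw [intervalIntegral.integral_comp_add_right
    (fun θ => (2 * Real.pi * driftDensity κ ω θ) • (1 : ℂ))] at hP
  rw [intervalIntegral.integral_smul_const, intervalIntegral.integral_const_mul] at hP
  have hpi := Real.pi_pos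
  rw [← intervalIntegral.integral_of_le (by linarith)]
  rw [show (0 : ℝ) + -Real.pi = -Real.pi by ring,
    show 2 * Real.pi + -Real.pi = Real.pi by ring] at hP
  rw [smul_smul, ← mul_assoc, inv_mul_cancel₀ (by positivity), one_mul] at hP
  have := congrArg Complex.re hP
  simpa using this

lemma phaseMeasure_of_le {κ ω : ℝ} (h : |ω| ≤ κ) :
    phaseMeasure κ ω = Measure.dirac (Real.arcsin (ω / κ)) := by
  unfold phaseMeasure; exact if_pos h

lemma phaseMeasure_of_lt {κ ω : ℝ} (h : κ < |ω|) :
    phaseMeasure κ ω = (volume.restrict (Ioc (-Real.pi) Real.pi)).withDensity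
      fun θ => ENNReal.ofReal (driftDensity κ ω θ) := by
  unfold phaseMeasure; exact if_neg (not_le.mpr h)

lemma isProbabilityMeasure_phaseMeasure {κ : ℝ} (hκ : 0 ≤ κ) (ω : ℝ) :
    IsProbabilityMeasure (phaseMeasure κ ω) := by
  rcases le_or_gt |ω| κ with h | h
  · rw [phaseMeasure_of_le h]; infer_instance
  · rw [phaseMeasure_of_lt h]
    constructor
    rw [withDensity_apply _ MeasurableSet.univ, Measure.restrict_univ,
      ← ofReal_integral_eq_lintegral_ofReal, integral_driftDensity hκ h, ENNReal.ofReal_one]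
    · exact ((continuous_driftDensity hκ h).integrableOn_Ioc)
    · exact ae_of_all _ fun θ => driftDensity_nonneg κ ω θ

/-- The phase moment `∫ e^{-iℓθ} f_stat(dθ | ω)`. -/
def moment (κ : ℝ) (ℓ : ℕ) (ω : ℝ) : ℂ :=
  ∫ θ, Complex.exp (-Complex.I * ℓ * θ) ∂(phaseMeasure κ ω)

lemma norm_exp_phase (ℓ θ : ℝ) : ‖Complex.exp (-Complex.I * ℓ * θ)‖ = 1 := by
  rw [Complex.norm_exp]; simp

lemma norm_moment_le_one {κ : ℝ} (hκ : 0 ≤ κ) (ℓ : ℕ) (ω : ℝ) : ‖moment κ ℓ ω‖ ≤ 1 := by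
  have := isProbabilityMeasure_phaseMeasure hκ ω
  refine (norm_integral_le_of_norm_le_const (C := 1) (ae_of_all _ fun θ => ?_)).trans (by simp)
  exact_mod_cast (norm_exp_phase ℓ θ).le

lemma moment_zero {κ : ℝ} (hκ : 0 ≤ κ) (ω : ℝ) : moment κ 0 ω = 1 := by
  have := isProbabilityMeasure_phaseMeasure hκ ω
  simp [moment]

lemma fHat_eq (κ : ℝ) (g : ℝ → ℝ) (ℓ : ℕ) (ξ : ℝ) :
    fHat κ g ℓ ξ = ∫ ω : ℝ, moment κ ℓ ω * Complex.exp (-Complex.I * ξ * ω) * (g ω : ℂ) := by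
  unfold fHat moment
  congr 1; ext ω
  congr 1
  rw [← integral_mul_const]
  refine integral_congr_ae (ae_of_all _ fun θ => ?_)
  simp only [← Complex.exp_add]
  congr 1; ring

lemma moment_of_locked {κ ω : ℝ} (h : |ω| ≤ κ) (ℓ : ℕ) :
    moment κ ℓ ω
      = ((Real.cos (Real.arcsin (ω / κ)) : ℂ) - Complex.I * (Real.sin (Real.arcsin (ω / κ)) : ℂ))
          ^ ℓ := by
  rw [moment, phaseMeasure_of_le h, integral_dirac, mul_assoc, mul_comm, mul_assoc,
    Complex.exp_nat_mul]
  congr 1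
  generalize Real.arcsin (ω / κ) = θ
  rw [show (θ : ℂ) * -Complex.I = ((-θ : ℝ) : ℂ) * Complex.I by push_cast; ring, Complex.exp_mul_I]
  push_cast
  rw [Complex.cos_neg, Complex.sin_neg]
  ring

lemma sin_arcsin_locked {κ ω : ℝ} (h : |ω| ≤ κ) :
    κ * Real.sin (Real.arcsin (ω / κ)) = ω := by
  rcases (abs_nonneg ω |>.trans h).eq_or_lt with h0 | h0
  · subst h0; simp at h; simp [h]
  · have := abs_le.mp h
    rw [Real.sin_arcsin, mul_div_cancel₀ _ h0.ne']
    · rw [le_div_iff₀ h0]; linarith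
    · rw [div_le_iff₀ h0]; linarith

/-- For a locked ω the moments are powers of z = e^{-iθ} with κ sin θ = ω, and the recursion is the
quadratic κz² + 2iωz - κ = 0 times a power of z. For a drifting ω the flux (ω - κ sin θ) f is
constant in θ, hence orthogonal to e^{-i(ℓ+1)θ}; expanding sin θ gives the neighbouring moments. -/
lemma moment_rec {κ : ℝ} (hκ : 0 ≤ κ) (ℓ : ℕ) (ω : ℝ) :
    -Complex.I * ω * moment κ (ℓ + 1) ω
      = (κ : ℂ) / 2 * (moment κ (ℓ + 2) ω - moment κ ℓ ω) := by
  rcases le_or_gt |ω| κ with h | h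
  · rw [moment_of_locked h, moment_of_locked h, moment_of_locked h]
    have h1 := sin_arcsin_locked h
    set θ := Real.arcsin (ω / κ)
    have h2 : (ω : ℂ) = κ * (Real.sin θ : ℂ) := by exact_mod_cast h1.symm
    have h3 : (Real.cos θ : ℂ) ^ 2 = 1 - (Real.sin θ : ℂ) ^ 2 := by
      rw [eq_sub_iff_add_eq]; exact_mod_cast Real.cos_sq_add_sin_sq θ
    rw [h2, pow_succ, pow_add]
    have key : (-Complex.I * (κ * (Real.sin θ : ℂ)))
        * ((Real.cos θ : ℂ) - Complex.I * (Real.sin θ : ℂ))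
        = κ / 2 * (((Real.cos θ : ℂ) - Complex.I * (Real.sin θ : ℂ)) ^ 2 - 1) := by
      linear_combination (κ / 2 * (Real.sin θ : ℂ) ^ 2) * Complex.I_sq - κ / 2 * h3
    linear_combination ((Real.cos θ : ℂ) - Complex.I * (Real.sin θ : ℂ)) ^ ℓ * key
  · have hdc := continuous_driftDensity hκ h
    have hm : ∀ j : ℕ, moment κ j ω
        = ∫ θ in (-Real.pi)..Real.pi, (driftDensity κ ω θ : ℂ)
            * Complex.exp (-Complex.I * j * θ) := by
      intro j
      have hpi := Real.pi_pos
      rw [moment, phaseMeasure_of_lt h, integral_withDensity_eq_integral_toReal_smul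
        (by fun_prop) (ae_of_all _ fun _ => ENNReal.ofReal_lt_top),
        intervalIntegral.integral_of_le (by linarith)]
      congr 1; ext θ
      rw [ENNReal.toReal_ofReal (driftDensity_nonneg κ ω θ), Complex.real_smul]
    -- The absolute value in the density drops out because ω - κ sin θ keeps the sign of ω.
    have hconst : ∃ c : ℝ, ∀ θ, (ω - κ * Real.sin θ) * driftDensity κ ω θ = c := by
      have hsin := fun θ => Real.abs_sin_le_one θ
      rcases le_or_gt 0 ω with hω | hω
      · rw [abs_of_nonneg hω] at h
        refine ⟨Real.sqrt (ω ^ 2 - κ ^ 2) / (2 * Real.pi), fun θ => ?_⟩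
        have : 0 < ω - κ * Real.sin θ := by nlinarith [abs_le.mp (hsin θ)]
        unfold driftDensity
        rw [abs_of_pos this]
        field_simp
      · rw [abs_of_neg hω] at h
        refine ⟨-(Real.sqrt (ω ^ 2 - κ ^ 2) / (2 * Real.pi)), fun θ => ?_⟩
        have : ω - κ * Real.sin θ < 0 := by nlinarith [abs_le.mp (hsin θ)]
        unfold driftDensity
        rw [abs_of_neg this, mul_neg, div_neg]
        have := this.ne
        field_simp
    obtain ⟨c, hc⟩ := hconst
    have hzero : ∫ θ in (-Real.pi)..Real.pi,
        (c : ℂ) * Complex.exp (-Complex.I * ((ℓ + 1 : ℕ) : ℂ) * θ) = 0 := by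
      rw [intervalIntegral.integral_const_mul, integral_exp_mul_complex
        (by simp; exact_mod_cast Nat.succ_ne_zero ℓ)]
      have : Complex.exp (-Complex.I * ((ℓ + 1 : ℕ) : ℂ) * (Real.pi : ℂ))
          = Complex.exp (-Complex.I * ((ℓ + 1 : ℕ) : ℂ) * ((-Real.pi : ℝ) : ℂ)) := by
        rw [Complex.exp_eq_exp_iff_exists_int]
        refine ⟨-(ℓ + 1), ?_⟩
        push_cast; ring
      rw [this]; simp
    have hci : ∀ j : ℕ, IntervalIntegrable (fun θ : ℝ => (driftDensity κ ω θ : ℂ)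
        * Complex.exp (-Complex.I * j * θ)) volume (-Real.pi) Real.pi := fun j =>
      Continuous.intervalIntegrable (by fun_prop) _ _
    have hsplit : ∫ θ in (-Real.pi)..Real.pi,
        (c : ℂ) * Complex.exp (-Complex.I * ((ℓ + 1 : ℕ) : ℂ) * θ)
        = ω * moment κ (ℓ + 1) ω
          - κ / (2 * Complex.I) * (moment κ ℓ ω - moment κ (ℓ + 2) ω) := by
      rw [hm, hm, hm, ← intervalIntegral.integral_sub (hci _) (hci _),
        ← intervalIntegral.integral_const_mul, ← intervalIntegral.integral_const_mul,
        ← intervalIntegral.integral_sub ((hci _).const_mul _)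
          (((hci _).sub (hci _)).const_mul _)]
      congr 1; ext θ
      have h1 : (c : ℂ) = (ω - κ * Complex.sin θ) * driftDensity κ ω θ := by
        rw [← hc θ]; push_cast; ring
      have e0 : Complex.exp (-Complex.I * (ℓ : ℂ) * θ)
          = Complex.exp (-Complex.I * ((ℓ + 1 : ℕ) : ℂ) * θ) * Complex.exp (θ * Complex.I) := by
        rw [← Complex.exp_add]; congr 1; push_cast; ring
      have e2 : Complex.exp (-Complex.I * ((ℓ + 2 : ℕ) : ℂ) * θ)
          = Complex.exp (-Complex.I * ((ℓ + 1 : ℕ) : ℂ) * θ) * Complex.exp (-θ * Complex.I) := by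
        rw [← Complex.exp_add]; congr 1; push_cast; ring
      rw [h1, e0, e2, Complex.sin]
      generalize Complex.exp (-Complex.I * ((ℓ + 1 : ℕ) : ℂ) * θ) = E
      generalize Complex.exp (θ * Complex.I) = P
      generalize Complex.exp (-θ * Complex.I) = Q
      field_simp
      linear_combination (κ * E * driftDensity κ ω θ * (P - Q)) * Complex.I_sq
    rw [hzero] at hsplit
    have h2 : (ω : ℂ) * moment κ (ℓ + 1) ω
        = κ / (2 * Complex.I) * (moment κ ℓ ω - moment κ (ℓ + 2) ω) :=
      (sub_eq_zero.mp hsplit.symm)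
    rw [mul_assoc, h2]
    field_simp
    ring

/-! ### The damped root -/

/-- A square root of `s ^ 2 + κ ^ 2`. -/
def rawRoot (κ : ℝ) (s : ℂ) : ℂ := (s ^ 2 + κ ^ 2) ^ (1 / 2 : ℂ)

lemma rawRoot_sq (κ : ℝ) (s : ℂ) : rawRoot κ s ^ 2 = s ^ 2 + κ ^ 2 := by
  unfold rawRoot
  rw [← Complex.cpow_nat_mul]; norm_num

/-- The square root of `s ^ 2 + κ ^ 2` in the closed half plane around `s`. -/
def halfPlaneRoot (κ : ℝ) (s : ℂ) : ℂ :=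
  if 0 ≤ (s * (starRingEnd ℂ) (rawRoot κ s)).re then rawRoot κ s else -rawRoot κ s

lemma halfPlaneRoot_sq (κ : ℝ) (s : ℂ) : halfPlaneRoot κ s ^ 2 = s ^ 2 + κ ^ 2 := by
  unfold halfPlaneRoot
  split_ifs <;> simp [rawRoot_sq]

lemma re_mul_conj_halfPlaneRoot (κ : ℝ) (s : ℂ) :
    0 ≤ (s * (starRingEnd ℂ) (halfPlaneRoot κ s)).re := by
  unfold halfPlaneRoot
  split_ifs with h
  · exact h
  · rw [map_neg, mul_neg, Complex.neg_re]; linarith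

/-- The root `β` of `κ β² + 2 (ε + iω) β - κ = 0` in the unit disc. -/
def dampedRoot (κ ε ω : ℝ) : ℂ :=
  κ / ((ε + Complex.I * ω) + halfPlaneRoot κ (ε + Complex.I * ω))

lemma measurable_dampedRoot (κ ε : ℝ) : Measurable (dampedRoot κ ε) := by
  have h1 : Measurable fun ω : ℝ => ((ε : ℂ) + Complex.I * ω) := by fun_prop
  have h2 : Measurable (rawRoot κ) := by unfold rawRoot; fun_prop
  have h3 : Measurable (halfPlaneRoot κ) := by
    unfold halfPlaneRoot
    refine Measurable.ite (measurableSet_le measurable_const ?_) h2 h2.neg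
    exact Complex.measurable_re.comp (measurable_id.mul
      (Complex.continuous_conj.measurable.comp h2))
  unfold dampedRoot
  exact measurable_const.div (h1.add (h3.comp h1))

/-- The angle between s and its chosen root is at most a right angle. The first bound keeps the
denominator of the damped root away from zero, the second makes the damped root the smaller of the
two roots. -/
lemma sq_norm_add_halfPlaneRoot (κ : ℝ) (s : ℂ) :
    ‖s‖ ^ 2 ≤ ‖s + halfPlaneRoot κ s‖ ^ 2 ∧
      ‖s - halfPlaneRoot κ s‖ ^ 2 ≤ ‖s + halfPlaneRoot κ s‖ ^ 2 := by
  have h := re_mul_conj_halfPlaneRoot κ s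
  simp only [← Complex.normSq_eq_norm_sq]
  rw [Complex.normSq_add, Complex.normSq_sub]
  have := Complex.normSq_nonneg (halfPlaneRoot κ s)
  constructor <;> linarith

section
variable {κ ε ω : ℝ}

lemma dampedRoot_denom_ne_zero (hε : 0 < ε) :
    ((ε : ℂ) + Complex.I * ω) + halfPlaneRoot κ (ε + Complex.I * ω) ≠ 0 := by
  intro h
  have h1 := (sq_norm_add_halfPlaneRoot κ (ε + Complex.I * ω)).1
  rw [h, norm_zero] at h1
  have h2 : ((ε : ℂ) + Complex.I * ω) = 0 := by
    have : ‖(ε : ℂ) + Complex.I * ω‖ ^ 2 = 0 := le_antisymm (by simpa using h1) (by positivity)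
    simpa using this
  have := congrArg Complex.re h2
  simp at this
  linarith

lemma dampedRoot_eq (hε : 0 < ε) :
    (κ : ℂ) * dampedRoot κ ε ω ^ 2 + 2 * (ε + Complex.I * ω) * dampedRoot κ ε ω - κ = 0 := by
  have h := dampedRoot_denom_ne_zero (κ := κ) (ω := ω) hε
  have h2 := halfPlaneRoot_sq κ (ε + Complex.I * ω)
  unfold dampedRoot
  set s : ℂ := ε + Complex.I * ω
  set σ := halfPlaneRoot κ s
  field_simp
  linear_combination (-(κ : ℂ)) * h2

/-- With σ² = s² + κ² one has (s+σ)(s-σ) = -κ², so the longer factor s+σ has length at least κ. -/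
lemma norm_dampedRoot_le_one (hκ : 0 ≤ κ) (hε : 0 < ε) : ‖dampedRoot κ ε ω‖ ≤ 1 := by
  have h := dampedRoot_denom_ne_zero (κ := κ) (ω := ω) hε
  have h2 := halfPlaneRoot_sq κ (ε + Complex.I * ω)
  have h3 := (sq_norm_add_halfPlaneRoot κ (ε + Complex.I * ω)).2
  unfold dampedRoot
  set s : ℂ := ε + Complex.I * ω
  set σ := halfPlaneRoot κ s
  have h4 : ‖s + σ‖ * ‖s - σ‖ = κ ^ 2 := by
    rw [← norm_mul, show (s + σ) * (s - σ) = -((κ ^ 2 : ℝ) : ℂ) by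
      push_cast; linear_combination (-1 : ℂ) * h2, norm_neg, Complex.norm_real, Real.norm_eq_abs,
      abs_of_nonneg (by positivity)]
  have h5 : ‖s - σ‖ ≤ ‖s + σ‖ := (sq_le_sq₀ (norm_nonneg _) (norm_nonneg _)).mp h3
  rw [norm_div, Complex.norm_real, Real.norm_eq_abs, abs_of_nonneg hκ,
    div_le_one (norm_pos_iff.mpr h)]
  refine (sq_le_sq₀ hκ (norm_nonneg _)).mp ?_
  rw [← h4, sq]
  gcongr

/-- Real part of the quadratic equation multiplied by the conjugate of β; the term with ω is purely
imaginary and disappears. The identity measures the distance of β from the unit circle. -/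
lemma dampedRoot_re_identity (hε : 0 < ε) :
    κ * (dampedRoot κ ε ω).re * (1 - ‖dampedRoot κ ε ω‖ ^ 2) = 2 * ε * ‖dampedRoot κ ε ω‖ ^ 2 := by
  have h := dampedRoot_eq (κ := κ) (ω := ω) hε
  set β := dampedRoot κ ε ω
  have h1 := congrArg (fun z => (z * (starRingEnd ℂ) β).re) h
  simp [sq] at h1
  rw [← Complex.normSq_eq_norm_sq, Complex.normSq_apply]
  nlinarith

/-- The bound is uniform in ω because ω is absent from `dampedRoot_re_identity`. If x = |β| > 1/2,
then Re β ≤ x gives ε ≤ 2εx ≤ κ(1 - x²), whence x² ≤ 1 - ε/κ. -/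
lemma exists_dampedRoot_bound (hκ : 0 ≤ κ) (hε : 0 < ε) :
    ∃ q : ℝ, 0 ≤ q ∧ q < 1 ∧ ∀ ω, ‖dampedRoot κ ε ω‖ ≤ q := by
  rcases hκ.eq_or_lt with h0 | h0
  · refine ⟨0, le_rfl, one_pos, fun ω => ?_⟩
    subst h0; simp [dampedRoot]
  · refine ⟨max (1 / 2) (Real.sqrt (1 - ε / κ)), by positivity, ?_, fun ω => ?_⟩
    · refine max_lt (by norm_num) ?_
      rw [Real.sqrt_lt' one_pos]
      have : 0 < ε / κ := by positivity
      linarith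
    · by_contra! hc
      obtain ⟨h1, h2⟩ := max_lt_iff.mp hc
      have hid := dampedRoot_re_identity (κ := κ) (ω := ω) hε
      have hle := norm_dampedRoot_le_one (ω := ω) hκ hε
      have hre := (Complex.abs_re_le_norm (dampedRoot κ ε ω))
      have hre' := (le_abs_self _).trans hre
      set x := ‖dampedRoot κ ε ω‖
      have h3 : 2 * ε * x ≤ κ * (1 - x ^ 2) := by
        have : 2 * ε * x ^ 2 ≤ κ * x * (1 - x ^ 2) := by
          rw [← hid]
          gcongr
          nlinarith
        nlinarith
      have h4 : x ^ 2 ≤ 1 - ε / κ := by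
        rw [le_sub_iff_add_le, ← le_sub_iff_add_le', div_le_iff₀ h0]
        nlinarith
      exact absurd (Real.le_sqrt_of_sq_le h4) (not_le.mpr h2)

lemma re_dampedRoot_nonneg (hκ : 0 ≤ κ) (hε : 0 < ε) : 0 ≤ (dampedRoot κ ε ω).re := by
  rcases hκ.eq_or_lt with h0 | h0
  · subst h0; simp [dampedRoot]
  · obtain ⟨q, hq0, hq1, hq⟩ := exists_dampedRoot_bound hκ hε
    have hid := dampedRoot_re_identity (κ := κ) (ω := ω) hε
    have hx := hq ω
    have hx0 := norm_nonneg (dampedRoot κ ε ω)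
    set x := ‖dampedRoot κ ε ω‖
    by_contra! hneg
    have : 0 < 1 - x ^ 2 := by nlinarith
    have h2 : κ * (dampedRoot κ ε ω).re * (1 - x ^ 2) < 0 :=
      mul_neg_of_neg_of_pos (mul_neg_of_pos_of_neg h0 hneg) this
    have h3 : 0 ≤ 2 * ε * x ^ 2 := by positivity
    linarith

lemma dampedRoot_rec (hε : 0 < ε) (ℓ : ℕ) :
    (-Complex.I * ω - ε) * dampedRoot κ ε ω ^ (ℓ + 1)
      = (κ : ℂ) / 2 * (dampedRoot κ ε ω ^ (ℓ + 2) - dampedRoot κ ε ω ^ ℓ) := by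
  have h := dampedRoot_eq (κ := κ) (ω := ω) hε
  rw [pow_succ, pow_add]
  linear_combination (-(dampedRoot κ ε ω ^ ℓ) / 2) * h

/-- The differences satisfy the undamped recursion with source ε β^{ℓ+1} and vanish at ℓ = 0. Their
supremum S over ℓ is finite, and |ω| S ≤ κ S + ε closes since |ω| > κ. No formula for the drifting
moments is needed. -/
lemma norm_dampedRoot_pow_sub_moment_le (hκ : 0 ≤ κ) (hε : 0 < ε) (h : κ < |ω|) (ℓ : ℕ) :
    ‖dampedRoot κ ε ω ^ ℓ - moment κ ℓ ω‖ ≤ ε / (|ω| - κ) := by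
  have hβ := norm_dampedRoot_le_one (ω := ω) hκ hε
  have hβp : ∀ j, ‖dampedRoot κ ε ω ^ j‖ ≤ 1 := fun j => by
    rw [norm_pow]; exact pow_le_one₀ (norm_nonneg _) hβ
  set d : ℕ → ℝ := fun j => ‖dampedRoot κ ε ω ^ j - moment κ j ω‖ with hd
  have hbd : ∀ j, d j ≤ 2 := fun j =>
    (norm_sub_le _ _).trans (by linarith [hβp j, norm_moment_le_one hκ j ω])
  have hbdd : BddAbove (range d) := ⟨2, by rintro _ ⟨j, rfl⟩; exact hbd j⟩
  set S := ⨆ j, d j with hS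
  have hle : ∀ j, d j ≤ S := fun j => le_ciSup hbdd j
  have hS0 : 0 ≤ S := (norm_nonneg _).trans (hle 0)
  have hstep : ∀ j, d j * |ω| ≤ κ * S + ε := by
    intro j
    cases j with
    | zero => simp [hd, moment_zero hκ]; positivity
    | succ j =>
      have e : (-Complex.I * ω) * (dampedRoot κ ε ω ^ (j + 1) - moment κ (j + 1) ω)
          = (κ : ℂ) / 2 * ((dampedRoot κ ε ω ^ (j + 2) - moment κ (j + 2) ω)
            - (dampedRoot κ ε ω ^ j - moment κ j ω)) + ε * dampedRoot κ ε ω ^ (j + 1) := by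
        linear_combination (dampedRoot_rec (κ := κ) (ω := ω) hε j) - moment_rec hκ j ω
      have e2 := congrArg norm e
      rw [norm_mul, norm_mul, norm_neg, Complex.norm_I, one_mul, Complex.norm_real,
        Real.norm_eq_abs, mul_comm] at e2
      rw [hd]; simp only
      rw [e2]
      refine (norm_add_le _ _).trans (add_le_add ?_ ?_)
      · rw [norm_mul, norm_div, Complex.norm_real, Real.norm_eq_abs, abs_of_nonneg hκ]
        have := (norm_sub_le (dampedRoot κ ε ω ^ (j + 2) - moment κ (j + 2) ω)
          (dampedRoot κ ε ω ^ j - moment κ j ω)).trans (add_le_add (hle (j + 2)) (hle j))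
        calc κ / ‖(2 : ℂ)‖ * _ ≤ κ / ‖(2 : ℂ)‖ * (S + S) := by gcongr
          _ = κ * S := by simp; ring
      · rw [norm_mul, Complex.norm_real, Real.norm_eq_abs, abs_of_pos hε]
        nlinarith [hβp (j + 1)]
  have hω : 0 < |ω| := hκ.trans_lt h
  have hSle : S ≤ (κ * S + ε) / |ω| := ciSup_le fun j => by
    rw [le_div_iff₀ hω]; exact hstep j
  rw [le_div_iff₀ hω] at hSle
  refine (hle ℓ).trans ?_
  rw [le_div_iff₀ (by linarith)]
  nlinarith

/-- The undamped quadratic has the roots e^{-iθ} and -e^{iθ}, so the damped equation reads κ(β -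
e^{-iθ})(β + e^{iθ}) = -2εβ. As Re β ≥ 0, the second factor has modulus at least cos θ. -/
lemma norm_dampedRoot_sub_locked_le (hκ : 0 ≤ κ) (hε : 0 < ε) (h : |ω| ≤ κ) :
    ‖dampedRoot κ ε ω - moment κ 1 ω‖ * (κ * Real.cos (Real.arcsin (ω / κ))) ≤ 2 * ε := by
  rw [moment_of_locked h, pow_one]
  have h1 := sin_arcsin_locked h
  have hc := Real.cos_arcsin_nonneg (ω / κ)
  set θ := Real.arcsin (ω / κ)
  have h2 : (ω : ℂ) = κ * (Real.sin θ : ℂ) := by exact_mod_cast h1.symm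
  have h3 : (Real.cos θ : ℂ) ^ 2 = 1 - (Real.sin θ : ℂ) ^ 2 := by
    rw [eq_sub_iff_add_eq]; exact_mod_cast Real.cos_sq_add_sin_sq θ
  have hβ := dampedRoot_eq (κ := κ) (ω := ω) hε
  have hre := re_dampedRoot_nonneg (ω := ω) hκ hε
  have hle := norm_dampedRoot_le_one (ω := ω) hκ hε
  set β := dampedRoot κ ε ω
  have e : (β - ((Real.cos θ : ℂ) - Complex.I * (Real.sin θ : ℂ)))
      * (κ * (β + ((Real.cos θ : ℂ) + Complex.I * (Real.sin θ : ℂ)))) = -(2 * ε * β) := by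
    rw [h2] at hβ
    linear_combination hβ - κ * h3 + κ * (Real.sin θ : ℂ) ^ 2 * Complex.I_sq
  have e2 := congrArg norm e
  rw [norm_mul, norm_mul, norm_neg, Complex.norm_real, Real.norm_eq_abs, abs_of_nonneg hκ] at e2
  have h5 : Real.cos θ ≤ ‖β + ((Real.cos θ : ℂ) + Complex.I * (Real.sin θ : ℂ))‖ := by
    refine le_trans ?_ (Complex.re_le_norm _)
    simp [Complex.cos_ofReal_re, Complex.sin_ofReal_im]
    linarith
  calc _ ≤ _ := by gcongr
    _ = ‖2 * (ε : ℂ) * β‖ := e2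
    _ = 2 * ε * ‖β‖ := by simp [abs_of_pos hε]
    _ ≤ 2 * ε := by nlinarith

end

/-- Both rates degenerate at |ω| = κ, where cos θ = 0 or |ω| - κ = 0; these two frequencies form a
null set. -/
lemma tendsto_dampedRoot_pow {κ ω : ℝ} (hκ : 0 ≤ κ) (h : |ω| ≠ κ) (ℓ : ℕ) :
    Tendsto (fun ε => dampedRoot κ ε ω ^ ℓ) (𝓝[>] 0) (𝓝 (moment κ ℓ ω)) := by
  rcases lt_or_gt_of_ne h with h | h
  · have h0 : 0 < κ := (abs_nonneg _).trans_lt h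
    have hm : moment κ ℓ ω = moment κ 1 ω ^ ℓ := by
      rw [moment_of_locked h.le, moment_of_locked h.le, pow_one]
    rw [hm]
    refine Tendsto.pow ?_ ℓ
    rw [tendsto_iff_norm_sub_tendsto_zero]
    have hc : 0 < κ * Real.cos (Real.arcsin (ω / κ)) := by
      refine mul_pos h0 (Real.cos_pos_of_mem_Ioo ⟨?_, ?_⟩)
      · rw [Real.neg_pi_div_two_lt_arcsin, lt_div_iff₀ h0]; linarith [(abs_lt.mp h).1]
      · rw [Real.arcsin_lt_pi_div_two, div_lt_iff₀ h0]; linarith [(abs_lt.mp h).2]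
    refine squeeze_zero' (Eventually.of_forall fun _ => norm_nonneg _)
      (g := fun ε => 2 * ε / (κ * Real.cos (Real.arcsin (ω / κ)))) ?_ ?_
    · filter_upwards [self_mem_nhdsWithin] with ε hε
      rw [le_div_iff₀ hc]
      exact norm_dampedRoot_sub_locked_le hκ hε h.le
    · have : Continuous fun ε : ℝ => 2 * ε / (κ * Real.cos (Real.arcsin (ω / κ))) := by fun_prop
      simpa using (this.tendsto 0).mono_left nhdsWithin_le_nhds
  · rw [tendsto_iff_norm_sub_tendsto_zero]
    refine squeeze_zero' (Eventually.of_forall fun _ => norm_nonneg _)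
      (g := fun ε => ε / (|ω| - κ)) ?_ ?_
    · filter_upwards [self_mem_nhdsWithin] with ε hε
      exact norm_dampedRoot_pow_sub_moment_le hκ hε h ℓ
    · have : Continuous fun ε : ℝ => ε / (|ω| - κ) := by fun_prop
      simpa using (this.tendsto 0).mono_left nhdsWithin_le_nhds

lemma ae_abs_ne (κ : ℝ) : ∀ᵐ ω : ℝ, |ω| ≠ κ := by
  have h1 : ∀ᵐ ω : ℝ, ω ≠ κ := by simp [ae_iff, measure_singleton]
  have h2 : ∀ᵐ ω : ℝ, ω ≠ -κ := by simp [ae_iff, measure_singleton]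
  filter_upwards [h1, h2] with ω h1 h2 h
  rcases eq_or_eq_neg_of_abs_eq h with h | h
  · exact h1 h
  · exact h2 h

/-- Measurability in ω comes from the explicit powers of the damped root, of which the moment is the
limit almost everywhere. -/
lemma aestronglyMeasurable_moment {κ : ℝ} (hκ : 0 ≤ κ) (ℓ : ℕ) :
    AEStronglyMeasurable (moment κ ℓ) volume := by
  refine aestronglyMeasurable_of_tendsto_ae (𝓝[>] (0 : ℝ))
    (f := fun ε ω => dampedRoot κ ε ω ^ ℓ) (fun ε => ?_) ?_
  · exact ((measurable_dampedRoot κ ε).pow_const ℓ).aestronglyMeasurable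
  · filter_upwards [ae_abs_ne κ] with ω h
    exact tendsto_dampedRoot_pow hκ h ℓ

/-! ### Fourier modes of a moment sequence -/

/-- Bounded solutions of the moment recursion with damping `ε`. -/
structure IsMomentSeq (κ ε : ℝ) (m : ℕ → ℝ → ℂ) : Prop where
  aestronglyMeasurable : ∀ ℓ, AEStronglyMeasurable (m ℓ) volume
  norm_le_one : ∀ ℓ ω, ‖m ℓ ω‖ ≤ 1
  zero : ∀ ω, m 0 ω = 1
  recursion : ∀ (ℓ : ℕ) (ω : ℝ), (-Complex.I * ω - ε) * m (ℓ + 1) ω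
    = (κ : ℂ) / 2 * (m (ℓ + 2) ω - m ℓ ω)

lemma isMomentSeq_moment {κ : ℝ} (hκ : 0 ≤ κ) : IsMomentSeq κ 0 (moment κ) where
  aestronglyMeasurable := aestronglyMeasurable_moment hκ
  norm_le_one := norm_moment_le_one hκ
  zero := moment_zero hκ
  recursion ℓ ω := by simpa using moment_rec hκ ℓ ω

lemma isMomentSeq_dampedRoot {κ ε : ℝ} (hκ : 0 ≤ κ) (hε : 0 < ε) :
    IsMomentSeq κ ε (fun ℓ ω => dampedRoot κ ε ω ^ ℓ) where
  aestronglyMeasurable ℓ := ((measurable_dampedRoot κ ε).pow_const ℓ).aestronglyMeasurable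
  norm_le_one ℓ ω := by
    rw [norm_pow]; exact pow_le_one₀ (norm_nonneg _) (norm_dampedRoot_le_one hκ hε)
  zero _ := pow_zero _
  recursion ℓ ω := dampedRoot_rec hε ℓ

/-- `∫ m_ℓ(ω) e^{-iξω} g(ω) dω`. -/
def modeFn (m : ℕ → ℝ → ℂ) (g : ℝ → ℝ) (ℓ : ℕ) (ξ : ℝ) : ℂ :=
  ∫ ω : ℝ, m ℓ ω * Complex.exp (-Complex.I * ξ * ω) * (g ω : ℂ)

lemma fHat_eq_modeFn (κ : ℝ) (g : ℝ → ℝ) : fHat κ g = modeFn (moment κ) g := by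
  ext ℓ ξ; exact fHat_eq κ g ℓ ξ

lemma norm_exp_freq (ξ ω : ℝ) : ‖Complex.exp (-Complex.I * ξ * ω)‖ = 1 := by
  rw [Complex.norm_exp]; simp

section modes
variable {κ ε : ℝ} {m : ℕ → ℝ → ℂ} {g : ℝ → ℝ}

lemma IsMomentSeq.modeFn_zero (hm : IsMomentSeq κ ε m) : modeFn m g 0 = gHat g := by
  ext ξ; simp [modeFn, gHat, hm.zero]

lemma IsMomentSeq.aestronglyMeasurable_integrand (hm : IsMomentSeq κ ε m) (hg : Integrable g)
    (ℓ : ℕ) (ξ : ℝ) : AEStronglyMeasurable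
      (fun ω : ℝ => m ℓ ω * Complex.exp (-Complex.I * ξ * ω) * (g ω : ℂ)) volume := by
  refine AEStronglyMeasurable.mul (AEStronglyMeasurable.mul (hm.aestronglyMeasurable ℓ) ?_) ?_
  · exact (Continuous.aestronglyMeasurable (by fun_prop))
  · exact Complex.continuous_ofReal.comp_aestronglyMeasurable hg.aestronglyMeasurable

lemma norm_integrand_le (hm : IsMomentSeq κ ε m) (ℓ : ℕ) (ξ ω : ℝ) :
    ‖m ℓ ω * Complex.exp (-Complex.I * ξ * ω) * (g ω : ℂ)‖ ≤ ‖g ω‖ := by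
  rw [norm_mul, norm_mul, norm_exp_freq, mul_one, Complex.norm_real]
  exact mul_le_of_le_one_left (norm_nonneg _) (hm.norm_le_one ℓ ω)

lemma IsMomentSeq.integrable_integrand (hm : IsMomentSeq κ ε m) (hg : Integrable g)
    (ℓ : ℕ) (ξ : ℝ) : Integrable
      (fun ω : ℝ => m ℓ ω * Complex.exp (-Complex.I * ξ * ω) * (g ω : ℂ)) volume :=
  hg.norm.mono' (hm.aestronglyMeasurable_integrand hg ℓ ξ)
    (ae_of_all _ fun ω => norm_integrand_le hm ℓ ξ ω)

lemma IsMomentSeq.continuous_modeFn (hm : IsMomentSeq κ ε m) (hg : Integrable g) (ℓ : ℕ) :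
    Continuous (modeFn m g ℓ) := by
  refine continuous_of_dominated (fun ξ => hm.aestronglyMeasurable_integrand hg ℓ ξ)
    (fun ξ => ae_of_all _ fun ω => norm_integrand_le hm ℓ ξ ω) hg.norm
    (ae_of_all _ fun ω => by fun_prop)

/-- Differentiation under the integral produces -iω, which the recursion trades for bounded
combinations of the neighbours. A multiple of g then dominates, and no first moment of g is
required. Mode 0 is excluded: ĝ need not be differentiable. -/
lemma IsMomentSeq.hasDerivAt_modeFn (hm : IsMomentSeq κ ε m) (hg : Integrable g) (ℓ : ℕ) (ξ : ℝ) :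
    HasDerivAt (modeFn m g (ℓ + 1)) (ε * modeFn m g (ℓ + 1) ξ
      + (κ : ℂ) / 2 * (modeFn m g (ℓ + 2) ξ - modeFn m g ℓ ξ)) ξ := by
  have hrec : ∀ ω : ℝ, -Complex.I * ω * m (ℓ + 1) ω
      = ε * m (ℓ + 1) ω + (κ : ℂ) / 2 * (m (ℓ + 2) ω - m ℓ ω) := fun ω => by
    rw [← hm.recursion ℓ ω]; ring
  have hi := fun j => hm.integrable_integrand hg j ξ
  have key := hasDerivAt_integral_of_dominated_loc_of_deriv_le (μ := volume)
    (F := fun (ξ : ℝ) (ω : ℝ) => m (ℓ + 1) ω * Complex.exp (-Complex.I * ξ * ω) * (g ω : ℂ))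
    (F' := fun (ξ : ℝ) (ω : ℝ) =>
      (-Complex.I * ω * m (ℓ + 1) ω) * Complex.exp (-Complex.I * ξ * ω) * (g ω : ℂ))
    (x₀ := ξ) (s := univ) (bound := fun ω => (|ε| + |κ| / 2 * 2) * ‖g ω‖) univ_mem
    (Eventually.of_forall fun ξ => hm.aestronglyMeasurable_integrand hg _ ξ) (hi _) ?_ ?_
    (hg.norm.const_mul _) ?_
  · refine key.2.congr_deriv ?_
    unfold modeFn
    have hsub : Integrable (fun ω : ℝ => (κ : ℂ) / 2 *
        (m (ℓ + 2) ω * Complex.exp (-Complex.I * ξ * ω) * (g ω : ℂ)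
          - m ℓ ω * Complex.exp (-Complex.I * ξ * ω) * (g ω : ℂ))) :=
      ((hi _).sub (hi _)).const_mul _
    rw [← integral_sub (hi _) (hi _), ← integral_const_mul, ← integral_const_mul, ← integral_add
      ((hi _).const_mul _) hsub]
    congr 1; ext ω
    rw [hrec]; ring
  · have : (fun ω : ℝ => (-Complex.I * ω * m (ℓ + 1) ω) * Complex.exp (-Complex.I * ξ * ω)
      * (g ω : ℂ))
        = fun ω : ℝ => (-Complex.I * ω)
          * (m (ℓ + 1) ω * Complex.exp (-Complex.I * ξ * ω) * (g ω : ℂ)) := by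
      ext ω; ring
    rw [this]
    exact (Continuous.aestronglyMeasurable (by fun_prop)).mul (hi _).aestronglyMeasurable
  · refine ae_of_all _ fun ω ξ' _ => ?_
    rw [norm_mul, norm_mul, norm_exp_freq, mul_one, Complex.norm_real, hrec]
    gcongr
    refine (norm_add_le _ _).trans (add_le_add ?_ ?_)
    · rw [norm_mul, Complex.norm_real]
      exact mul_le_of_le_one_right (norm_nonneg _) (hm.norm_le_one _ _)
    · rw [norm_mul, norm_div, Complex.norm_real, Real.norm_eq_abs, Complex.norm_two]
      gcongr
      exact (norm_sub_le _ _).trans (by linarith [hm.norm_le_one (ℓ + 2) ω, hm.norm_le_one ℓ ω])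
  · refine ae_of_all _ fun ω ξ' _ => ?_
    have h1 : HasDerivAt (fun ξ : ℝ => -Complex.I * (ξ : ℂ) * ω) (-Complex.I * ω) ξ' := by
      have := ((hasDerivAt_id ξ').ofReal_comp.const_mul (-Complex.I)).mul_const (ω : ℂ)
      simpa using this
    have h2 := ((h1.cexp).const_mul (m (ℓ + 1) ω)).mul_const (g ω : ℂ)
    refine h2.congr_deriv ?_
    ring

lemma norm_modeFn_le_of_bound (hg : Integrable g) (hg0 : ∀ ω, 0 ≤ g ω) (hg1 : ∫ ω : ℝ, g ω = 1)
    {ℓ : ℕ} {c : ℝ} (hc : ∀ ω, ‖m ℓ ω‖ ≤ c) (ξ : ℝ) : ‖modeFn m g ℓ ξ‖ ≤ c := by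
  have h : ‖modeFn m g ℓ ξ‖ ≤ ∫ ω, c * g ω := by
    refine norm_integral_le_of_norm_le (hg.const_mul c) (ae_of_all _ fun ω => ?_)
    rw [norm_mul, norm_mul, norm_exp_freq, mul_one, Complex.norm_real, Real.norm_eq_abs,
      abs_of_nonneg (hg0 ω)]
    exact mul_le_mul_of_nonneg_right (hc ω) (hg0 ω)
  rwa [integral_const_mul, hg1, mul_one] at h

lemma tendsto_modeFn_dampedRoot (hκ : 0 ≤ κ) (hg : Integrable g) (ℓ : ℕ) (ξ : ℝ) :
    Tendsto (fun ε => modeFn (fun ℓ ω => dampedRoot κ ε ω ^ ℓ) g ℓ ξ) (𝓝[>] 0)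
      (𝓝 (fHat κ g ℓ ξ)) := by
  rw [fHat_eq]
  refine tendsto_integral_filter_of_dominated_convergence (fun ω => ‖g ω‖) ?_ ?_ hg.norm ?_
  · filter_upwards [self_mem_nhdsWithin] with ε hε
    exact (isMomentSeq_dampedRoot hκ hε).aestronglyMeasurable_integrand hg ℓ ξ
  · filter_upwards [self_mem_nhdsWithin] with ε hε
    exact ae_of_all _ fun ω => norm_integrand_le (isMomentSeq_dampedRoot hκ hε) ℓ ξ ω
  · filter_upwards [ae_abs_ne κ] with ω h
    exact ((tendsto_dampedRoot_pow hκ h ℓ).mul_const _).mul_const _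

end modes

/-! ### The energy inequality -/

lemma add_one_pow_sub_pow_le (n : ℕ) {x : ℝ} (hx : 0 ≤ x) :
    (x + 1) ^ n - x ^ n ≤ n * (x + 1) ^ (n - 1) := by
  induction n with
  | zero => simp
  | succ n ih =>
    have h1 : (x + 1) * ((x + 1) ^ n - x ^ n) ≤ n * (x + 1) ^ n := by
      cases n with
      | zero => simp
      | succ n =>
        calc _ ≤ (x + 1) * (((n + 1 : ℕ) : ℝ) * (x + 1) ^ n) := by gcongr; exact ih
          _ = _ := by ring
    have h2 : x ^ n ≤ (x + 1) ^ n := by gcongr; linarith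
    calc (x + 1) ^ (n + 1) - x ^ (n + 1) = (x + 1) * ((x + 1) ^ n - x ^ n) + x ^ n := by ring
      _ ≤ n * (x + 1) ^ n + (x + 1) ^ n := add_le_add h1 h2
      _ = ((n + 1 : ℕ) : ℝ) * (x + 1) ^ (n + 1 - 1) := by push_cast; ring

/-- The constant in the discrete Leibniz estimate. -/
def stepConst (n : ℕ) : ℝ := n * 2 ^ n

lemma stepConst_nonneg (n : ℕ) : 0 ≤ stepConst n := by unfold stepConst; positivity

/-- The increment of ℓ^n has order ℓ^{n-1}. For n = 0 the exponent n - 1 is truncated to 0,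
harmlessly, since the constant vanishes. -/
lemma weight_step_le (n j : ℕ) :
    ((j + 2 : ℝ)) ^ n - ((j + 1 : ℝ)) ^ n ≤ stepConst n * (j + 1 : ℝ) ^ (n - 1) := by
  have h := add_one_pow_sub_pow_le n (x := (j + 1 : ℝ)) (by positivity)
  have h2 : ((j + 1 : ℝ) + 1) ^ (n - 1) ≤ 2 ^ n * (j + 1 : ℝ) ^ (n - 1) := by
    calc ((j + 1 : ℝ) + 1) ^ (n - 1) ≤ (2 * (j + 1 : ℝ)) ^ (n - 1) :=
        by gcongr; linarith [(Nat.cast_nonneg j : (0 : ℝ) ≤ j)]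
      _ = 2 ^ (n - 1) * (j + 1 : ℝ) ^ (n - 1) := mul_pow _ _ _
      _ ≤ 2 ^ n * (j + 1 : ℝ) ^ (n - 1) := by gcongr <;> [norm_num; omega]
  calc _ = ((j + 1 : ℝ) + 1) ^ n - ((j + 1 : ℝ)) ^ n := by ring
    _ ≤ n * ((j + 1 : ℝ) + 1) ^ (n - 1) := h
    _ ≤ n * (2 ^ n * (j + 1 : ℝ) ^ (n - 1)) := by gcongr
    _ = _ := by unfold stepConst; ring

/-- The flux `∑ ℓ^n Re (conj x_ℓ (x_{ℓ+1} - x_{ℓ-1}))`. -/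
def flux (n N : ℕ) (x : ℕ → ℂ) : ℝ :=
  ∑ j ∈ Finset.range N, (j + 1 : ℝ) ^ n * ((starRingEnd ℂ) (x (j + 1)) * (x (j + 2) - x j)).re

/-- The loss in the discrete Leibniz estimate. -/
def loss (n N : ℕ) (x : ℕ → ℂ) : ℝ :=
  ∑ j ∈ Finset.range N, stepConst n * (j + 1 : ℝ) ^ (n - 1) * (‖x (j + 1)‖ ^ 2 + ‖x (j + 2)‖ ^ 2)

/-- Summation by parts: Re(conj x_ℓ · x_{ℓ+1}) is symmetric in its two entries and appears with
weight ℓ^n from mode ℓ and -(ℓ+1)^n from mode ℓ+1. Only the weight increments survive, besides the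
boundary terms at mode 0 and at the truncation. -/
lemma flux_ge (n N : ℕ) (x : ℕ → ℂ) :
    (N + 1 : ℝ) ^ n * ((starRingEnd ℂ) (x (N + 1)) * x (N + 2)).re - ‖x 1‖ * ‖x 0‖ - loss n N x
      ≤ flux n (N + 1) x := by
  induction N with
  | zero =>
    have h : ((starRingEnd ℂ) (x 1) * x 0).re ≤ ‖x 1‖ * ‖x 0‖ := by
      refine (Complex.re_le_norm _).trans ?_
      rw [norm_mul, RCLike.norm_conj]
    simp only [flux, loss, mul_sub, Complex.sub_re, Nat.cast_zero, zero_add, Finset.range_zero,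
      Finset.sum_empty, Finset.range_one, Finset.sum_singleton, one_pow, one_mul, sub_zero]
    linarith
  | succ N ih =>
    unfold flux loss at ih ⊢
    rw [Finset.sum_range_succ _ (N + 1), Finset.sum_range_succ _ N]
    have hcross : |((starRingEnd ℂ) (x (N + 1)) * x (N + 2)).re|
        ≤ ‖x (N + 1)‖ ^ 2 + ‖x (N + 2)‖ ^ 2 := by
      refine (Complex.abs_re_le_norm _).trans ?_
      rw [norm_mul, RCLike.norm_conj]
      nlinarith [sq_nonneg (‖x (N + 1)‖ - ‖x (N + 2)‖), sq_nonneg (‖x (N + 1)‖),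
        sq_nonneg (‖x (N + 2)‖)]
    have hsymm : ((starRingEnd ℂ) (x (N + 2)) * x (N + 1)).re
        = ((starRingEnd ℂ) (x (N + 1)) * x (N + 2)).re := by
      simp [Complex.mul_re]; ring
    have hw := weight_step_le n N
    have hw0 : 0 ≤ ((N + 2 : ℝ)) ^ n - ((N + 1 : ℝ)) ^ n := by
      rw [sub_nonneg]; gcongr; norm_num
    have hstep : (((N + 2 : ℝ)) ^ n - ((N + 1 : ℝ)) ^ n)
        * ((starRingEnd ℂ) (x (N + 1)) * x (N + 2)).re
        ≤ stepConst n * (N + 1 : ℝ) ^ (n - 1) * (‖x (N + 1)‖ ^ 2 + ‖x (N + 2)‖ ^ 2) := by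
      calc _ ≤ (((N + 2 : ℝ)) ^ n - ((N + 1 : ℝ)) ^ n) * (‖x (N + 1)‖ ^ 2 + ‖x (N + 2)‖ ^ 2) := by
            gcongr; exact (le_abs_self _).trans hcross
        _ ≤ _ := by gcongr
    have e1 : ((N + 1 : ℕ) : ℝ) + 1 = N + 2 := by push_cast; ring
    rw [e1]
    simp only [mul_sub, Complex.sub_re] at ih ⊢
    rw [show N + 1 + 1 = N + 2 by ring, show N + 1 + 2 = N + 3 by ring, hsymm]
    linarith

/-- `∑_{ℓ ≥ 1} ℓ^n |x_ℓ|²`. -/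
def modeEnergy (n : ℕ) (x : ℕ → ℂ) : ℝ≥0∞ :=
  ∑' j : ℕ, ((j + 1 : ℕ) : ℝ≥0∞) ^ n * ‖x (j + 1)‖ₑ ^ 2

/-- The truncated energy `∑_{1 ≤ ℓ ≤ N} ℓ^n |x_ℓ|²`. -/
def partialEnergy (n N : ℕ) (x : ℕ → ℂ) : ℝ :=
  ∑ j ∈ Finset.range N, (j + 1 : ℝ) ^ n * ‖x (j + 1)‖ ^ 2

lemma ofReal_weight_mul_sq (n j : ℕ) (z : ℂ) :
    ENNReal.ofReal ((j + 1 : ℝ) ^ n * ‖z‖ ^ 2) = ((j + 1 : ℕ) : ℝ≥0∞) ^ n * ‖z‖ₑ ^ 2 := by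
  rw [ENNReal.ofReal_mul (by positivity), ENNReal.ofReal_pow (norm_nonneg _), ofReal_norm,
    ENNReal.ofReal_pow (by positivity)]
  congr 2
  rw [← ENNReal.ofReal_natCast]; push_cast; rfl

lemma ofReal_partialEnergy (n N : ℕ) (x : ℕ → ℂ) :
    ENNReal.ofReal (partialEnergy n N x)
      = ∑ j ∈ Finset.range N, ((j + 1 : ℕ) : ℝ≥0∞) ^ n * ‖x (j + 1)‖ₑ ^ 2 := by
  unfold partialEnergy
  rw [ENNReal.ofReal_sum_of_nonneg (fun _ _ => by positivity)]
  exact Finset.sum_congr rfl fun j _ => ofReal_weight_mul_sq n j _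

lemma ofReal_partialEnergy_le (n N : ℕ) (x : ℕ → ℂ) :
    ENNReal.ofReal (partialEnergy n N x) ≤ modeEnergy n x := by
  rw [ofReal_partialEnergy]; exact ENNReal.sum_le_tsum _

lemma modeEnergy_le_of_partialEnergy_le {n : ℕ} {x : ℕ → ℂ} {c : ℝ≥0∞}
    (h : ∀ N, ENNReal.ofReal (partialEnergy n N x) ≤ c) : modeEnergy n x ≤ c :=
  ENNReal.tsum_le_of_sum_range_le fun N => (ofReal_partialEnergy n N x) ▸ h N

lemma ofReal_loss_le (n N : ℕ) (x : ℕ → ℂ) :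
    ENNReal.ofReal (loss n N x) ≤ ENNReal.ofReal (2 * stepConst n) * modeEnergy (n - 1) x := by
  have h0 := stepConst_nonneg n
  have h1 : loss n N x ≤ 2 * stepConst n * partialEnergy (n - 1) (N + 1) x := by
    have ha : ∑ j ∈ Finset.range N, (j + 1 : ℝ) ^ (n - 1) * ‖x (j + 1)‖ ^ 2
        ≤ partialEnergy (n - 1) (N + 1) x :=
      Finset.sum_le_sum_of_subset_of_nonneg (Finset.range_mono (Nat.le_succ N))
        fun _ _ _ => by positivity
    have hb : ∑ j ∈ Finset.range N, (j + 1 : ℝ) ^ (n - 1) * ‖x (j + 2)‖ ^ 2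
        ≤ partialEnergy (n - 1) (N + 1) x := by
      unfold partialEnergy
      rw [Finset.sum_range_succ']
      refine le_add_of_le_of_nonneg (Finset.sum_le_sum fun j _ => ?_) (by positivity)
      push_cast
      gcongr
      linarith
    calc loss n N x = stepConst n * (∑ j ∈ Finset.range N, (j + 1 : ℝ) ^ (n - 1) * ‖x (j + 1)‖ ^ 2)
          + stepConst n * (∑ j ∈ Finset.range N, (j + 1 : ℝ) ^ (n - 1) * ‖x (j + 2)‖ ^ 2) := by
          unfold loss
          rw [Finset.mul_sum, Finset.mul_sum, ← Finset.sum_add_distrib]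
          exact Finset.sum_congr rfl fun j _ => by ring
      _ ≤ stepConst n * partialEnergy (n - 1) (N + 1) x
          + stepConst n * partialEnergy (n - 1) (N + 1) x := by gcongr
      _ = _ := by ring
  refine (ENNReal.ofReal_le_ofReal h1).trans ?_
  rw [ENNReal.ofReal_mul (by positivity)]
  gcongr
  exact ofReal_partialEnergy_le _ _ _

section energy
variable {κ ε q : ℝ} {F : ℕ → ℝ → ℂ}

lemma hasDerivAt_partialEnergy (n N : ℕ)
    (hd : ∀ ℓ ξ, HasDerivAt (F (ℓ + 1))
      (ε * F (ℓ + 1) ξ + (κ : ℂ) / 2 * (F (ℓ + 2) ξ - F ℓ ξ)) ξ) (ξ : ℝ) :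
    HasDerivAt (fun y => partialEnergy n N fun ℓ => F ℓ y)
      (2 * ε * partialEnergy n N (fun ℓ => F ℓ ξ) + κ * flux n N fun ℓ => F ℓ ξ) ξ := by
  unfold partialEnergy flux
  have h : ∀ j ∈ Finset.range N, HasDerivAt (fun y => (j + 1 : ℝ) ^ n * ‖F (j + 1) y‖ ^ 2)
      ((j + 1 : ℝ) ^ n * (2 * ε * ‖F (j + 1) ξ‖ ^ 2
        + κ * ((starRingEnd ℂ) (F (j + 1) ξ) * (F (j + 2) ξ - F j ξ)).re)) ξ := by
    intro j _
    refine HasDerivAt.const_mul _ ?_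
    refine ((hd j ξ).norm_sq).congr_deriv ?_
    rw [Complex.inner, ← Complex.normSq_eq_norm_sq, Complex.normSq_apply]
    simp
    ring
  refine (HasDerivAt.fun_sum h).congr_deriv ?_
  rw [Finset.mul_sum, Finset.mul_sum, ← Finset.sum_add_distrib]
  exact Finset.sum_congr rfl fun j _ => by ring

lemma continuous_loss (n N : ℕ) (hc : ∀ ℓ, Continuous (F ℓ)) :
    Continuous fun y => loss n N fun ℓ => F ℓ y := by
  unfold loss; fun_prop

lemma continuous_flux (n N : ℕ) (hc : ∀ ℓ, Continuous (F ℓ)) :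
    Continuous fun y => flux n N fun ℓ => F ℓ y := by
  unfold flux; fun_prop

lemma loss_nonneg (n N : ℕ) (x : ℕ → ℂ) : 0 ≤ loss n N x := by
  have := stepConst_nonneg n
  unfold loss; positivity

/-- A Grönwall argument run backwards from X. The coefficient +2ε makes the contribution of X decay
exponentially in X - ξ, and the geometric bound on the modes makes the flux through the truncation
of size N^n q^N. -/
lemma partialEnergy_le_of_interval (hκ : 0 ≤ κ) (hε : 0 < ε) (hq0 : 0 ≤ q) (hq1 : q ≤ 1) (n N : ℕ)
    (hc : ∀ ℓ, Continuous (F ℓ))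
    (hd : ∀ ℓ ξ, HasDerivAt (F (ℓ + 1))
      (ε * F (ℓ + 1) ξ + (κ : ℂ) / 2 * (F (ℓ + 2) ξ - F ℓ ξ)) ξ)
    (hb : ∀ ℓ ξ, ‖F ℓ ξ‖ ≤ q ^ ℓ) {ξ X : ℝ} (hX : ξ ≤ X) :
    partialEnergy n (N + 1) (fun ℓ => F ℓ ξ)
      ≤ κ * ((N + 1 : ℝ) ^ n * q ^ N) / (2 * ε)
        + Real.exp (-2 * ε * (X - ξ)) * ∑ j ∈ Finset.range (N + 1), (j + 1 : ℝ) ^ n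
        + ∫ y in ξ..X, κ * (‖F 1 y‖ * ‖F 0 y‖ + loss n N fun ℓ => F ℓ y) := by
  set δ := κ * ((N + 1 : ℝ) ^ n * q ^ N) with hδ
  set H : ℝ → ℝ := fun y => κ * (‖F 1 y‖ * ‖F 0 y‖ + loss n N fun ℓ => F ℓ y) with hH
  set e : ℝ → ℝ := fun y => partialEnergy n (N + 1) fun ℓ => F ℓ y with he
  have hδ0 : 0 ≤ δ := by positivity
  have hHc : Continuous H := by
    have := continuous_loss n N hc
    fun_prop
  have hH0 : ∀ y, 0 ≤ H y := fun y => by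
    have := loss_nonneg n N fun ℓ => F ℓ y
    positivity
  -- Subtracting δ/(2ε) adds exactly δ to the bracket in ψ', which compensates the flux through the
  -- truncation and leaves ψ' bounded below by the source and the loss.
  set ψ : ℝ → ℝ := fun y => Real.exp (-2 * ε * y) * (e y - δ / (2 * ε)) with hψ
  set ψ' : ℝ → ℝ := fun y => Real.exp (-2 * ε * y) * (κ * (flux n (N + 1) fun ℓ => F ℓ y) + δ)
      with hψ'
  have hderiv : ∀ y, HasDerivAt ψ (ψ' y) y := by
    intro y
    have h1 : HasDerivAt (fun y : ℝ => Real.exp (-2 * ε * y))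
        (Real.exp (-2 * ε * y) * (-2 * ε)) y := by
      simpa using ((hasDerivAt_id y).const_mul (-2 * ε)).exp
    refine (h1.mul ((hasDerivAt_partialEnergy n (N + 1) hd y).sub_const _)).congr_deriv ?_
    simp only [hψ']
    field_simp
    ring
  have hψ'c : Continuous ψ' := by
    have := continuous_flux n (N + 1) hc
    fun_prop
  have hInt := intervalIntegral.integral_eq_sub_of_hasDerivAt (fun y _ => hderiv y)
    (hψ'c.intervalIntegrable ξ X)
  have hlower : ∀ y ∈ Icc ξ X, -(Real.exp (-2 * ε * ξ) * H y) ≤ ψ' y := by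
    intro y hy
    have hf := flux_ge n N fun ℓ => F ℓ y
    have hcross : -(q ^ N) ≤ ((starRingEnd ℂ) (F (N + 1) y) * F (N + 2) y).re := by
      refine (abs_le.mp ((Complex.abs_re_le_norm _).trans ?_)).1
      rw [norm_mul, RCLike.norm_conj]
      have h1 : ‖F (N + 1) y‖ ≤ q ^ N := (hb _ _).trans
          (pow_le_pow_of_le_one hq0 hq1 (Nat.le_succ N))
      have h2 : ‖F (N + 2) y‖ ≤ 1 := (hb _ _).trans (pow_le_one₀ hq0 hq1)
      nlinarith [norm_nonneg (F (N + 1) y), norm_nonneg (F (N + 2) y)]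
    have h1 : -H y ≤ κ * (flux n (N + 1) fun ℓ => F ℓ y) + δ := by
      have h2 : -(N + 1 : ℝ) ^ n * q ^ N - ‖F 1 y‖ * ‖F 0 y‖ - (loss n N fun ℓ => F ℓ y)
          ≤ flux n (N + 1) fun ℓ => F ℓ y := by
        refine le_trans ?_ hf
        have : (N + 1 : ℝ) ^ n * -(q ^ N)
            ≤ (N + 1 : ℝ) ^ n * ((starRingEnd ℂ) (F (N + 1) y) * F (N + 2) y).re := by gcongr
        linarith
      have h3 := mul_le_mul_of_nonneg_left h2 hκ
      simp only [hH, hδ]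
      linarith
    have hexp : Real.exp (-2 * ε * y) ≤ Real.exp (-2 * ε * ξ) := by
      rw [Real.exp_le_exp]; nlinarith [hy.1]
    calc -(Real.exp (-2 * ε * ξ) * H y) ≤ -(Real.exp (-2 * ε * y) * H y) := by
          have := mul_le_mul_of_nonneg_right hexp (hH0 y); linarith
      _ = Real.exp (-2 * ε * y) * (-H y) := by ring
      _ ≤ ψ' y := mul_le_mul_of_nonneg_left h1 (Real.exp_pos _).le
  have hmono := intervalIntegral.integral_mono_on hX
    ((hHc.const_mul _).neg.intervalIntegrable (μ := volume) ξ X) (hψ'c.intervalIntegrable ξ X)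
        hlower
  simp only [Pi.neg_apply] at hmono
  rw [hInt, intervalIntegral.integral_neg, intervalIntegral.integral_const_mul] at hmono
  have heX : e X ≤ ∑ j ∈ Finset.range (N + 1), (j + 1 : ℝ) ^ n := by
    refine Finset.sum_le_sum fun j _ => ?_
    refine mul_le_of_le_one_right (by positivity) (pow_le_one₀ (norm_nonneg _) ?_)
    exact (hb _ _).trans (pow_le_one₀ hq0 hq1)
  have hEξ := Real.exp_pos (-2 * ε * ξ)
  have hsplit : Real.exp (-2 * ε * X) = Real.exp (-2 * ε * (X - ξ)) * Real.exp (-2 * ε * ξ) := by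
    rw [← Real.exp_add]; congr 1; ring
  have h5 : ψ X ≤ Real.exp (-2 * ε * X) * ∑ j ∈ Finset.range (N + 1), (j + 1 : ℝ) ^ n := by
    refine mul_le_mul_of_nonneg_left ?_ (Real.exp_pos _).le
    have : 0 ≤ δ / (2 * ε) := by positivity
    linarith
  rw [hsplit] at h5
  have h6 : Real.exp (-2 * ε * ξ) * (e ξ - δ / (2 * ε)) ≤ Real.exp (-2 * ε * ξ) *
      (Real.exp (-2 * ε * (X - ξ)) * ∑ j ∈ Finset.range (N + 1), (j + 1 : ℝ) ^ n
        + ∫ y in ξ..X, H y) := by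
    have : ψ ξ = Real.exp (-2 * ε * ξ) * (e ξ - δ / (2 * ε)) := rfl
    linarith
  have h7 := le_of_mul_le_mul_left h6 hEξ
  linarith

/-- The energy inequality for damped modes. -/
lemma modeEnergy_le_lintegral (hκ : 0 ≤ κ) (hε : 0 < ε) (hq0 : 0 ≤ q) (hq1 : q < 1) (n : ℕ)
    (hc : ∀ ℓ, Continuous (F ℓ))
    (hd : ∀ ℓ ξ, HasDerivAt (F (ℓ + 1))
      (ε * F (ℓ + 1) ξ + (κ : ℂ) / 2 * (F (ℓ + 2) ξ - F ℓ ξ)) ξ)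
    (hb : ∀ ℓ ξ, ‖F ℓ ξ‖ ≤ q ^ ℓ) (ξ : ℝ) :
    modeEnergy n (fun ℓ => F ℓ ξ) ≤ ∫⁻ y in Ioi ξ, ENNReal.ofReal κ *
      (‖F 1 y‖ₑ * ‖F 0 y‖ₑ
          + ENNReal.ofReal (2 * stepConst n) * modeEnergy (n - 1) fun ℓ => F ℓ y) := by
  set R := ∫⁻ y in Ioi ξ, ENNReal.ofReal κ *
      (‖F 1 y‖ₑ * ‖F 0 y‖ₑ + ENNReal.ofReal (2 * stepConst n) * modeEnergy (n - 1) fun ℓ => F ℓ y)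
  have hN : ∀ N : ℕ, ENNReal.ofReal (partialEnergy n (N + 1) fun ℓ => F ℓ ξ)
      ≤ ENNReal.ofReal (κ * ((N + 1 : ℝ) ^ n * q ^ N) / (2 * ε)) + R := by
    intro N
    have hX : ∀ X, ξ ≤ X → ENNReal.ofReal (partialEnergy n (N + 1) fun ℓ => F ℓ ξ)
        ≤ ENNReal.ofReal (κ * ((N + 1 : ℝ) ^ n * q ^ N) / (2 * ε)
          + Real.exp (-2 * ε * (X - ξ)) * ∑ j ∈ Finset.range (N + 1), (j + 1 : ℝ) ^ n) + R := by
      intro X hX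
      have h := partialEnergy_le_of_interval hκ hε hq0 hq1.le n N hc hd hb hX
      refine (ENNReal.ofReal_le_ofReal h).trans (ENNReal.ofReal_add_le.trans ?_)
      gcongr
      have hnn : ∀ y, 0 ≤ κ * (‖F 1 y‖ * ‖F 0 y‖ + loss n N fun ℓ => F ℓ y) := fun y => by
        have := loss_nonneg n N fun ℓ => F ℓ y
        positivity
      have hcont : Continuous fun y => κ * (‖F 1 y‖ * ‖F 0 y‖ + loss n N fun ℓ => F ℓ y) := by
        have := continuous_loss n N hc
        fun_prop
      rw [intervalIntegral.integral_of_le hX, ofReal_integral_eq_lintegral_ofReal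
        hcont.integrableOn_Ioc (ae_of_all _ hnn)]
      refine (lintegral_mono_set Ioc_subset_Ioi_self).trans (lintegral_mono fun y => ?_)
      simp only
      rw [ENNReal.ofReal_mul hκ, ENNReal.ofReal_add (by positivity) (loss_nonneg _ _ _),
        ENNReal.ofReal_mul (norm_nonneg _), ofReal_norm, ofReal_norm]
      gcongr
      exact ofReal_loss_le n N _
    have hlim : Tendsto (fun X : ℝ => ENNReal.ofReal (κ * ((N + 1 : ℝ) ^ n * q ^ N) / (2 * ε)
          + Real.exp (-2 * ε * (X - ξ)) * ∑ j ∈ Finset.range (N + 1), (j + 1 : ℝ) ^ n) + R) atTop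
        (𝓝 (ENNReal.ofReal (κ * ((N + 1 : ℝ) ^ n * q ^ N) / (2 * ε)) + R)) := by
      refine Tendsto.add_const R (ENNReal.tendsto_ofReal ?_)
      have h1 : Tendsto (fun X : ℝ => Real.exp (-2 * ε * (X - ξ))) atTop (𝓝 0) := by
        refine Real.tendsto_exp_atBot.comp ?_
        refine Tendsto.const_mul_atTop_of_neg (by linarith) ?_
        exact tendsto_atTop_add_const_right _ _ tendsto_id
      simpa using (h1.mul_const (∑ j ∈ Finset.range (N + 1), (j + 1 : ℝ) ^ n)).const_add
        (κ * ((N + 1 : ℝ) ^ n * q ^ N) / (2 * ε))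
    -- At fixed N, letting X → ∞ removes the energy at X. Only afterwards does N → ∞ remove the
    -- truncation flux, since N^n q^N → 0 for q < 1.
    refine ge_of_tendsto hlim ?_
    filter_upwards [eventually_ge_atTop ξ] with X h using hX X h
  refine modeEnergy_le_of_partialEnergy_le fun N₀ => ?_
  have hlim : Tendsto (fun N : ℕ => ENNReal.ofReal (κ * ((N + 1 : ℝ) ^ n * q ^ N) / (2 * ε)) + R)
      atTop (𝓝 R) := by
    have h1 : Tendsto (fun N : ℕ => (N + 1 : ℝ) ^ n * q ^ N) atTop (𝓝 0) := by
      have h2 := (tendsto_pow_const_mul_const_pow_of_abs_lt_one n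
        (by rwa [abs_of_nonneg hq0] : |q| < 1)).const_mul ((2 : ℝ) ^ n)
      rw [mul_zero] at h2
      refine squeeze_zero' (Eventually.of_forall fun N => by positivity) ?_ h2
      filter_upwards [eventually_ge_atTop 1] with N hN
      have : (N + 1 : ℝ) ≤ 2 * N := by
        have : (1 : ℝ) ≤ N := by exact_mod_cast hN
        linarith
      calc (N + 1 : ℝ) ^ n * q ^ N ≤ (2 * N : ℝ) ^ n * q ^ N := by gcongr
        _ = _ := by ring
    have h3 := ENNReal.tendsto_ofReal ((h1.const_mul κ).div_const (2 * ε))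
    simpa using h3.add_const R
  refine ge_of_tendsto hlim ?_
  filter_upwards [eventually_ge_atTop N₀] with N hle
  refine le_trans (ENNReal.ofReal_le_ofReal ?_) (hN N)
  exact Finset.sum_le_sum_of_subset_of_nonneg (Finset.range_mono (by omega))
    fun _ _ _ => by positivity

end energy

/-! ### Weighted tail estimates -/

/-- The weight `(1 + ξ)^a` with values in `[0, ∞]`. -/
def wt (a ξ : ℝ) : ℝ≥0∞ := ENNReal.ofReal ((1 + ξ) ^ a)

lemma measurable_wt (a : ℝ) : Measurable (wt a) := by unfold wt; fun_prop

lemma wt_mul {ξ : ℝ} (hξ : 0 < ξ) (a c : ℝ) : wt a ξ * wt c ξ = wt (a + c) ξ := by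
  unfold wt
  rw [← ENNReal.ofReal_mul (by positivity), ← Real.rpow_add (by linarith)]

lemma wt_mono {ξ : ℝ} (hξ : 0 < ξ) {a c : ℝ} (h : a ≤ c) : wt a ξ ≤ wt c ξ :=
  ENNReal.ofReal_le_ofReal (Real.rpow_le_rpow_of_exponent_le (by linarith) h)

lemma lintegral_wt_Ioo_le {a : ℝ} (ha : -1 < a) {y : ℝ} (hy : 0 < y) :
    ∫⁻ ξ in Ioo 0 y, wt a ξ ≤ ENNReal.ofReal (1 / (a + 1)) * wt (a + 1) y := by
  have hpos : 0 < a + 1 := by linarith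
  have hcont : ContinuousOn (fun ξ : ℝ => (1 + ξ) ^ a) (Icc 0 y) := by
    refine ContinuousOn.rpow_const (by fun_prop) fun x hx => Or.inl ?_
    linarith [hx.1]
  unfold wt
  rw [← ofReal_integral_eq_lintegral_ofReal, ← ENNReal.ofReal_mul (by positivity)]
  · refine ENNReal.ofReal_le_ofReal ?_
    rw [← integral_Ioc_eq_integral_Ioo, ← intervalIntegral.integral_of_le hy.le,
      intervalIntegral.integral_comp_add_left (fun x : ℝ => x ^ a),
      integral_rpow (Or.inl ha)]
    rw [div_mul_eq_mul_div, one_mul]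
    gcongr
    have : (0 : ℝ) ≤ (1 + 0) ^ (a + 1) := by positivity
    linarith
  · exact (hcont.integrableOn_Icc).mono_set Ioo_subset_Icc_self
  · filter_upwards [ae_restrict_mem measurableSet_Ioo] with x hx
    have := hx.1
    positivity

lemma lintegral_wt_tail {ξ : ℝ} (hξ : 0 < ξ) :
    ∫⁻ y in Ioi ξ, wt (-3 / 2) y ≤ ENNReal.ofReal 2 * wt (-1 / 2) ξ := by
  have h1 : ∫⁻ y in Ioi ξ, wt (-3 / 2) y
      = ∫⁻ y in Ioi (1 + ξ), ENNReal.ofReal (y ^ (-3 / 2 : ℝ)) := by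
    have := (measurePreserving_add_left volume (1 : ℝ)).setLIntegral_comp_preimage
      (measurableSet_Ioi (a := 1 + ξ))
      (f := fun y : ℝ => ENNReal.ofReal (y ^ (-3 / 2 : ℝ))) (by fun_prop)
    rw [← this]
    simp [wt]
  rw [h1, ← ofReal_integral_eq_lintegral_ofReal]
  · rw [integral_Ioi_rpow_of_lt (by norm_num) (by linarith), wt, ← ENNReal.ofReal_mul (by norm_num)]
    refine ENNReal.ofReal_le_ofReal (le_of_eq ?_)
    norm_num
    ring
  · exact integrableOn_Ioi_rpow_of_lt (by norm_num) (by linarith)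
  · filter_upwards [ae_restrict_mem measurableSet_Ioi] with x hx
    have : (0 : ℝ) < x := by linarith [mem_Ioi.mp hx]
    positivity

/-- The Hardy-type inequality for the tail operator, in its Tonelli form. -/
lemma lintegral_wt_mul_tail_le {a : ℝ} (ha : -1 < a) {H : ℝ → ℝ≥0∞} (hH : Measurable H) :
    ∫⁻ ξ in Ioi 0, wt a ξ * ∫⁻ y in Ioi ξ, H y
      ≤ ENNReal.ofReal (1 / (a + 1)) * ∫⁻ y in Ioi 0, wt (a + 1) y * H y := by
  have hm : Measurable (fun q : ℝ × ℝ => {q : ℝ × ℝ | q.1 < q.2}.indicator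
      (fun q => wt a q.1 * H q.2) q) := by
    refine Measurable.indicator ?_ (measurableSet_lt measurable_fst measurable_snd)
    exact ((measurable_wt a).comp measurable_fst).mul (hH.comp measurable_snd)
  have h1 : ∫⁻ ξ in Ioi 0, wt a ξ * ∫⁻ y in Ioi ξ, H y
      = ∫⁻ ξ in Ioi (0 : ℝ), ∫⁻ y in Ioi 0, {q : ℝ × ℝ | q.1 < q.2}.indicator
      (fun q => wt a q.1 * H q.2) (ξ, y) := by
    refine setLIntegral_congr_fun measurableSet_Ioi fun ξ hξ => ?_
    rw [← lintegral_const_mul _ hH]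
    have : (fun y => {q : ℝ × ℝ | q.1 < q.2}.indicator (fun q => wt a q.1 * H q.2) (ξ, y))
        = (Ioi ξ).indicator fun y => wt a ξ * H y := by
      ext y; simp [indicator]
    rw [this, lintegral_indicator measurableSet_Ioi, Measure.restrict_restrict measurableSet_Ioi,
      inter_eq_self_of_subset_left (Ioi_subset_Ioi (le_of_lt hξ))]
  rw [h1, lintegral_lintegral_swap hm.aemeasurable, ← lintegral_const_mul'
    _ _ ENNReal.ofReal_ne_top]
  refine setLIntegral_mono' measurableSet_Ioi fun y hy => ?_
  have : (fun ξ => {q : ℝ × ℝ | q.1 < q.2}.indicator (fun q => wt a q.1 * H q.2) (ξ, y))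
      = (Iio y).indicator fun ξ => wt a ξ * H y := by
    ext ξ; simp [indicator]
  rw [this, lintegral_indicator measurableSet_Iio, Measure.restrict_restrict measurableSet_Iio,
    Iio_inter_Ioi, lintegral_mul_const _ (measurable_wt a), ← mul_assoc]
  gcongr
  exact lintegral_wt_Ioo_le ha hy

/-- Cauchy–Schwarz with (1+y)^{3/4} split off: the square of its inverse has an integrable tail, of
size 2(1+ξ)^{-1/2}. -/
lemma sq_tail_le {h : ℝ → ℝ≥0∞} (hh : Measurable h) {ξ : ℝ} (hξ : 0 < ξ) :
    (∫⁻ y in Ioi ξ, h y) ^ 2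
      ≤ ENNReal.ofReal 2 * (wt (-1 / 2) ξ * ∫⁻ y in Ioi ξ, wt (3 / 2) y * h y ^ 2) := by
  have hCS := ENNReal.lintegral_mul_le_Lp_mul_Lq (volume.restrict (Ioi ξ))
    Real.HolderConjugate.two_two (f := fun y => wt (3 / 4) y * h y) (g := wt (-3 / 4))
    ((measurable_wt _).mul hh).aemeasurable (measurable_wt _).aemeasurable
  have e0 : ∫⁻ y in Ioi ξ, h y
      = ∫⁻ y in Ioi ξ, ((fun y => wt (3 / 4) y * h y) * wt (-3 / 4)) y := by
    refine setLIntegral_congr_fun measurableSet_Ioi fun y hy => ?_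
    simp only [Pi.mul_apply]
    have h0 : 0 < y := hξ.trans hy
    rw [mul_right_comm, wt_mul h0]
    norm_num [wt]
  have e1 : ∫⁻ y in Ioi ξ, (wt (3 / 4) y * h y) ^ (2 : ℝ)
      = ∫⁻ y in Ioi ξ, wt (3 / 2) y * h y ^ 2 := by
    refine setLIntegral_congr_fun measurableSet_Ioi fun y hy => ?_
    rw [ENNReal.rpow_two, mul_pow, sq (wt _ _), wt_mul (hξ.trans hy)]
    norm_num
  have e2 : ∫⁻ y in Ioi ξ, wt (-3 / 4) y ^ (2 : ℝ) = ∫⁻ y in Ioi ξ, wt (-3 / 2) y := by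
    refine setLIntegral_congr_fun measurableSet_Ioi fun y hy => ?_
    rw [ENNReal.rpow_two, sq (wt _ _), wt_mul (hξ.trans hy)]
    norm_num
  rw [e1, e2, ← e0] at hCS
  have hsq : ∀ x : ℝ≥0∞, (x ^ (1 / 2 : ℝ)) ^ 2 = x := fun x => by
    rw [← ENNReal.rpow_natCast, ← ENNReal.rpow_mul]; norm_num
  calc (∫⁻ y in Ioi ξ, h y) ^ 2 ≤ _ := pow_le_pow_left' hCS 2
    _ = (∫⁻ y in Ioi ξ, wt (3 / 2) y * h y ^ 2) * ∫⁻ y in Ioi ξ, wt (-3 / 2) y := by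
      rw [mul_pow, hsq, hsq]
    _ ≤ (∫⁻ y in Ioi ξ, wt (3 / 2) y * h y ^ 2) * (ENNReal.ofReal 2 * wt (-1 / 2) ξ) := by
      gcongr; exact lintegral_wt_tail hξ
    _ = _ := by ring

/-- After `sq_tail_le` the outer weight is a - 1/2 > -1, so Tonelli applies and the exponents add up
to (a - 1/2) + 1 + 3/2 = a + 2. The constant is 2/(a + 1/2) ≤ 4. -/
lemma hardy_tail {a : ℝ} (ha : 0 ≤ a) {h : ℝ → ℝ≥0∞} (hh : Measurable h) :
    ∫⁻ ξ in Ioi 0, wt a ξ * (∫⁻ y in Ioi ξ, h y) ^ 2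
      ≤ ENNReal.ofReal 4 * ∫⁻ y in Ioi 0, wt (a + 2) y * h y ^ 2 := by
  have hHm : Measurable fun y => wt (3 / 2) y * h y ^ 2 := (measurable_wt _).mul (hh.pow_const 2)
  calc ∫⁻ ξ in Ioi 0, wt a ξ * (∫⁻ y in Ioi ξ, h y) ^ 2
      ≤ ∫⁻ ξ in Ioi 0, ENNReal.ofReal 2 * (wt (a - 1 / 2) ξ
          * ∫⁻ y in Ioi ξ, wt (3 / 2) y * h y ^ 2) := by
        refine setLIntegral_mono' measurableSet_Ioi fun ξ hξ => ?_
        calc wt a ξ * (∫⁻ y in Ioi ξ, h y) ^ 2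
            ≤ wt a ξ * (ENNReal.ofReal 2 * (wt (-1 / 2) ξ
                * ∫⁻ y in Ioi ξ, wt (3 / 2) y * h y ^ 2)) := by
              gcongr; exact sq_tail_le hh hξ
          _ = ENNReal.ofReal 2 * ((wt a ξ * wt (-1 / 2) ξ)
              * ∫⁻ y in Ioi ξ, wt (3 / 2) y * h y ^ 2) := by
              ring
          _ = _ := by rw [wt_mul hξ]; ring_nf
    _ = ENNReal.ofReal 2 * ∫⁻ ξ in Ioi 0, (wt (a - 1 / 2) ξ
          * ∫⁻ y in Ioi ξ, wt (3 / 2) y * h y ^ 2) := lintegral_const_mul' _ _ ENNReal.ofReal_ne_top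
    _ ≤ ENNReal.ofReal 2 * (ENNReal.ofReal (1 / (a - 1 / 2 + 1))
          * ∫⁻ y in Ioi 0, wt (a - 1 / 2 + 1) y * (wt (3 / 2) y * h y ^ 2)) := by
        gcongr
        exact lintegral_wt_mul_tail_le (by linarith) hHm
    _ ≤ ENNReal.ofReal 2 * (ENNReal.ofReal 2 * ∫⁻ y in Ioi 0, wt (a + 2) y * h y ^ 2) := by
        gcongr ENNReal.ofReal 2 * (ENNReal.ofReal ?_ * ?_)
        · rw [div_le_iff₀ (by linarith)]; linarith
        · refine le_of_eq (setLIntegral_congr_fun measurableSet_Ioi fun y hy => ?_)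
          rw [← mul_assoc, wt_mul hy]
          ring_nf
    _ = _ := by rw [← mul_assoc, ← ENNReal.ofReal_mul (by norm_num)]; norm_num

/-- The pointwise majorant of the energies, obtained by iterating the energy inequality. -/
def tailBound (κ : ℝ) (h : ℝ → ℝ≥0∞) : ℕ → ℝ → ℝ≥0∞
  | 0, ξ => (ENNReal.ofReal κ * ∫⁻ y in Ioi ξ, h y) ^ 2
  | n + 1, ξ => (ENNReal.ofReal κ * ∫⁻ y in Ioi ξ, h y) ^ 2
      + ENNReal.ofReal (κ * (2 * stepConst (n + 1))) * ∫⁻ y in Ioi ξ, tailBound κ h n y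

lemma antitone_tail (h : ℝ → ℝ≥0∞) : Antitone fun ξ => ∫⁻ y in Ioi ξ, h y :=
  fun _ _ hab => lintegral_mono_set (Ioi_subset_Ioi hab)

lemma antitone_tailBound (κ : ℝ) (h : ℝ → ℝ≥0∞) (n : ℕ) : Antitone (tailBound κ h n) := by
  intro a c hac
  have h1 := antitone_tail h hac
  cases n with
  | zero => simp only [tailBound]; gcongr
  | succ n => simp only [tailBound]; gcongr

/-- The squared tail costs two powers of the weight and every outer tail integral one more. The
induction is over all a because the inner bound is used with a + 1. -/
lemma exists_lintegral_wt_tailBound_le (κ : ℝ) (n : ℕ) :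
    ∀ a : ℝ, 0 ≤ a → ∃ C : ℝ≥0∞, C ≠ ⊤ ∧ ∀ h : ℝ → ℝ≥0∞, Measurable h →
      ∫⁻ ξ in Ioi 0, wt a ξ * tailBound κ h n ξ
          ≤ C * ∫⁻ y in Ioi 0, wt (a + n + 2) y * h y ^ 2 := by
  have hbase : ∀ a : ℝ, 0 ≤ a → ∀ h : ℝ → ℝ≥0∞, Measurable h →
      ∫⁻ ξ in Ioi 0, wt a ξ * (ENNReal.ofReal κ * ∫⁻ y in Ioi ξ, h y) ^ 2
        ≤ ENNReal.ofReal κ ^ 2 * ENNReal.ofReal 4 * ∫⁻ y in Ioi 0, wt (a + 2) y * h y ^ 2 := by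
    intro a ha h hh
    calc _ = ENNReal.ofReal κ ^ 2 * ∫⁻ ξ in Ioi 0, wt a ξ * (∫⁻ y in Ioi ξ, h y) ^ 2 := by
          rw [← lintegral_const_mul' _ _ (ENNReal.pow_ne_top ENNReal.ofReal_ne_top)]
          congr 1; ext ξ; ring
      _ ≤ _ := by rw [mul_assoc]; gcongr; exact hardy_tail ha hh
  induction n with
  | zero =>
    intro a ha
    refine ⟨ENNReal.ofReal κ ^ 2 * ENNReal.ofReal 4, by finiteness, fun h hh => ?_⟩
    simpa [tailBound] using hbase a ha h hh
  | succ n ih =>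
    intro a ha
    obtain ⟨C, hC, hle⟩ := ih (a + 1) (by linarith)
    refine ⟨ENNReal.ofReal κ ^ 2 * ENNReal.ofReal 4 + ENNReal.ofReal (κ * (2 * stepConst (n + 1)))
      * (ENNReal.ofReal (1 / (a + 1)) * C), by finiteness, fun h hh => ?_⟩
    have hm1 : Measurable fun ξ => wt a ξ * (ENNReal.ofReal κ * ∫⁻ y in Ioi ξ, h y) ^ 2 :=
      (measurable_wt a).mul (((Antitone.measurable (antitone_tail h)).const_mul _).pow_const 2)
    calc ∫⁻ ξ in Ioi 0, wt a ξ * tailBound κ h (n + 1) ξ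
        = ∫⁻ ξ in Ioi 0, (wt a ξ * (ENNReal.ofReal κ * ∫⁻ y in Ioi ξ, h y) ^ 2
          + ENNReal.ofReal (κ * (2 * stepConst (n + 1)))
            * (wt a ξ * ∫⁻ y in Ioi ξ, tailBound κ h n y)) := by
          congr 1; ext ξ; simp only [tailBound]; ring
      _ = (∫⁻ ξ in Ioi 0, wt a ξ * (ENNReal.ofReal κ * ∫⁻ y in Ioi ξ, h y) ^ 2)
          + ENNReal.ofReal (κ * (2 * stepConst (n + 1)))
            * ∫⁻ ξ in Ioi 0, wt a ξ * ∫⁻ y in Ioi ξ, tailBound κ h n y := by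
          rw [lintegral_add_left hm1, lintegral_const_mul' _ _ ENNReal.ofReal_ne_top]
      _ ≤ ENNReal.ofReal κ ^ 2 * ENNReal.ofReal 4
            * (∫⁻ y in Ioi 0, wt (a + (n + 1 : ℕ) + 2) y * h y ^ 2)
          + ENNReal.ofReal (κ * (2 * stepConst (n + 1))) * (ENNReal.ofReal (1 / (a + 1))
            * (C * ∫⁻ y in Ioi 0, wt (a + (n + 1 : ℕ) + 2) y * h y ^ 2)) := by
          gcongr ?_ + _ * ?_
          · refine (hbase a ha h hh).trans ?_
            gcongr _ * ?_
            refine setLIntegral_mono' measurableSet_Ioi fun y hy => ?_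
            gcongr
            refine wt_mono hy ?_
            have : (0 : ℝ) ≤ (n + 1 : ℕ) := Nat.cast_nonneg _
            linarith
          · refine (lintegral_wt_mul_tail_le (by linarith)
              (antitone_tailBound κ h n).measurable).trans ?_
            gcongr
            refine (hle h hh).trans (le_of_eq ?_)
            rw [show a + 1 + (n : ℝ) + 2 = a + (n + 1 : ℕ) + 2 by push_cast; ring]
      _ = _ := by ring

/-! ### Pointwise energy bounds for the stationary state -/

section
variable {κ ε q : ℝ} {F : ℕ → ℝ → ℂ}

/-- At order 0 there is no loss, and the energy inequality bounds F_1 by its own supremum times the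
tail of F_0, hence |F_1(ξ)| ≤ κ ∫_ξ^∞ |F_0|. Inserted into the source, this gives the squared tail;
the loss is handled by induction on n. -/
lemma modeEnergy_le_tailBound_of_damped (hκ : 0 ≤ κ) (hε : 0 < ε) (hq0 : 0 ≤ q) (hq1 : q < 1)
    (hc : ∀ ℓ, Continuous (F ℓ))
    (hd : ∀ ℓ ξ, HasDerivAt (F (ℓ + 1))
      (ε * F (ℓ + 1) ξ + (κ : ℂ) / 2 * (F (ℓ + 2) ξ - F ℓ ξ)) ξ)
    (hb : ∀ ℓ ξ, ‖F ℓ ξ‖ ≤ q ^ ℓ) (n : ℕ) (ξ : ℝ) :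
    modeEnergy n (fun ℓ => F ℓ ξ) ≤ tailBound κ (fun y => ‖F 0 y‖ₑ) n ξ := by
  have hm0 : Measurable fun y => ‖F 0 y‖ₑ := (hc 0).enorm.measurable
  have hm1 : Measurable fun y => ‖F 1 y‖ₑ := (hc 1).enorm.measurable
  set A : ℝ → ℝ≥0∞ := fun ξ => ∫⁻ y in Ioi ξ, ‖F 0 y‖ₑ with hA
  have hF1 : ∀ ξ, ‖F 1 ξ‖ₑ ≤ ENNReal.ofReal κ * A ξ := by
    intro ξ
    -- The supremum over the half line [ξ, ∞) is taken because the energy inequality at y involves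
    -- F_1 at all later points. It is at most 1, so it can be cancelled from M² ≤ M · κA(ξ) unless
    -- it is 0.
    set M : ℝ≥0∞ := ⨆ y : Ici ξ, ‖F 1 y‖ₑ with hM
    have hM1 : M ≤ 1 := iSup_le fun y => by
      rw [← ofReal_norm, ← ENNReal.ofReal_one]
      exact ENNReal.ofReal_le_ofReal ((hb 1 y).trans (pow_le_one₀ hq0 hq1.le))
    have hle : ∀ y, ξ ≤ y → ‖F 1 y‖ₑ ≤ M := fun y hy => le_iSup (fun y : Ici ξ => ‖F 1 y‖ₑ) ⟨y, hy⟩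
    have hsq : ∀ y, ξ ≤ y → ‖F 1 y‖ₑ ^ 2 ≤ M * (ENNReal.ofReal κ * A ξ) := by
      intro y hy
      have h1 : ‖F 1 y‖ₑ ^ 2 ≤ modeEnergy 0 fun ℓ => F ℓ y := by
        have := ENNReal.le_tsum (f := fun j : ℕ => ((j + 1 : ℕ) : ℝ≥0∞) ^ 0 * ‖F (j + 1) y‖ₑ ^ 2) 0
        simpa [modeEnergy] using this
      refine h1.trans ((modeEnergy_le_lintegral hκ hε hq0 hq1 0 hc hd hb y).trans ?_)
      calc _ ≤ ∫⁻ z in Ioi y, (ENNReal.ofReal κ * M) * ‖F 0 z‖ₑ := by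
            refine setLIntegral_mono' measurableSet_Ioi fun z hz => ?_
            have h0 : stepConst 0 = 0 := by simp [stepConst]
            rw [h0, mul_zero, ENNReal.ofReal_zero, zero_mul, add_zero, mul_assoc]
            gcongr
            exact hle z (hy.trans (le_of_lt hz))
        _ = (ENNReal.ofReal κ * M) * A y := lintegral_const_mul _ hm0
        _ ≤ (ENNReal.ofReal κ * M) * A ξ := by gcongr; exact antitone_tail _ hy
        _ = _ := by ring
    have hMM : M * M ≤ M * (ENNReal.ofReal κ * A ξ) := by
      rw [← sq]
      have : M ^ 2 = ⨆ y : Ici ξ, ‖F 1 y‖ₑ ^ 2 := by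
        rw [hM, ENNReal.iSup_pow]
      rw [this]
      exact iSup_le fun y => hsq y y.2
    refine (hle ξ le_rfl).trans ?_
    rcases eq_or_ne M 0 with h0 | h0
    · rw [h0]; exact zero_le
    · exact (ENNReal.mul_le_mul_iff_right h0 (ne_top_of_le_ne_top ENNReal.one_ne_top hM1)).mp hMM
  have hfirst : ∀ ξ, ∫⁻ y in Ioi ξ, ENNReal.ofReal κ * (‖F 1 y‖ₑ * ‖F 0 y‖ₑ)
      ≤ (ENNReal.ofReal κ * A ξ) ^ 2 := by
    intro ξ
    calc _ ≤ ∫⁻ y in Ioi ξ, (ENNReal.ofReal κ * (ENNReal.ofReal κ * A ξ)) * ‖F 0 y‖ₑ := by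
          refine setLIntegral_mono' measurableSet_Ioi fun y hy => ?_
          rw [← mul_assoc]
          gcongr
          refine (hF1 y).trans ?_
          gcongr
          exact antitone_tail _ (le_of_lt hy)
      _ = (ENNReal.ofReal κ * (ENNReal.ofReal κ * A ξ)) * A ξ := lintegral_const_mul _ hm0
      _ = _ := by ring
  have hstep : ∀ n ξ, modeEnergy n (fun ℓ => F ℓ ξ) ≤ (ENNReal.ofReal κ * A ξ) ^ 2
      + ENNReal.ofReal (κ * (2 * stepConst n))
          * ∫⁻ y in Ioi ξ, modeEnergy (n - 1) fun ℓ => F ℓ y := by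
    intro n ξ
    refine (modeEnergy_le_lintegral hκ hε hq0 hq1 n hc hd hb ξ).trans ?_
    simp only [mul_add]
    rw [lintegral_add_left (show Measurable fun y => ENNReal.ofReal κ * (‖F 1 y‖ₑ * ‖F 0 y‖ₑ) from
      (hm1.mul hm0).const_mul _)]
    refine add_le_add (hfirst ξ) (le_of_eq ?_)
    rw [← lintegral_const_mul' _ _ ENNReal.ofReal_ne_top]
    congr 1; ext y
    rw [ENNReal.ofReal_mul hκ]; ring
  induction n generalizing ξ with
  | zero =>
    refine (hstep 0 ξ).trans (le_of_eq ?_)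
    simp [stepConst, tailBound, hA]
  | succ n ih =>
    refine (hstep (n + 1) ξ).trans ?_
    simp only [tailBound]
    gcongr with y
    exact ih y

end

/-- The bound for the damped modes involves only their zeroth mode, which is ĝ for every ε. Each
finite partial sum converges as ε → 0, and the bound on all partial sums carries over to the series.
-/
lemma modeEnergy_fHat_le_tailBound {κ : ℝ} (hκ : 0 ≤ κ) {g : ℝ → ℝ} (hg : Integrable g)
    (hg0 : ∀ ω, 0 ≤ g ω) (hg1 : ∫ ω : ℝ, g ω = 1) (n : ℕ) (ξ : ℝ) :
    modeEnergy n (fun ℓ => fHat κ g ℓ ξ) ≤ tailBound κ (fun y => ‖gHat g y‖ₑ) n ξ := by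
  refine modeEnergy_le_of_partialEnergy_le fun N => ?_
  have hlim : Tendsto (fun ε => ENNReal.ofReal (partialEnergy n N fun ℓ =>
      modeFn (fun ℓ ω => dampedRoot κ ε ω ^ ℓ) g ℓ ξ)) (𝓝[>] 0)
      (𝓝 (ENNReal.ofReal (partialEnergy n N fun ℓ => fHat κ g ℓ ξ))) := by
    refine ENNReal.tendsto_ofReal (tendsto_finsetSum _ fun j _ => ?_)
    exact ((tendsto_modeFn_dampedRoot hκ hg (j + 1) ξ).norm.pow 2).const_mul _
  refine le_of_tendsto hlim ?_
  filter_upwards [self_mem_nhdsWithin] with ε hε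
  have hm := isMomentSeq_dampedRoot hκ hε
  obtain ⟨q, hq0, hq1, hq⟩ := exists_dampedRoot_bound hκ hε
  refine (ofReal_partialEnergy_le _ _ _).trans ?_
  have := modeEnergy_le_tailBound_of_damped hκ hε hq0 hq1 (fun ℓ => hm.continuous_modeFn hg ℓ)
    (fun ℓ ξ => hm.hasDerivAt_modeFn hg ℓ ξ) (fun ℓ ξ => norm_modeFn_le_of_bound hg hg0 hg1
      (fun ω => by rw [norm_pow]; exact pow_le_pow_left₀ (norm_nonneg _) (hq ω) ℓ) ξ) n ξ
  rwa [hm.modeFn_zero] at this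

/-! ### Weak derivatives -/

lemma integrableOn_mul_of_compactSupport {v : ℝ → ℂ} (hv : LocallyIntegrableOn v (Ioi 0))
    {ψ : ℝ → ℝ} (hψ : Continuous ψ) (hc : HasCompactSupport ψ) (hs : tsupport ψ ⊆ Ioi 0) :
    IntegrableOn (fun ξ => v ξ * ((ψ ξ : ℝ) : ℂ)) (Ioi 0) := by
  have h1 : IntegrableOn v (tsupport ψ) := hv.integrableOn_compact_subset hs hc
  have h2 : IntegrableOn (fun ξ => v ξ * ((ψ ξ : ℝ) : ℂ)) (tsupport ψ) :=
    h1.mul_continuousOn (Continuous.continuousOn (by fun_prop)) hc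
  refine (h2.integrable_of_forall_notMem_eq_zero fun ξ hξ => ?_).integrableOn
  rw [image_eq_zero_of_notMem_tsupport hξ]; simp

lemma IsTest.continuous {φ : ℝ → ℝ} (hφ : IsTest φ) : Continuous φ := hφ.1.continuous

lemma IsTest.deriv {φ : ℝ → ℝ} (hφ : IsTest φ) : IsTest (deriv φ) := by
  refine ⟨?_, hφ.2.1.deriv, tsupport_deriv_subset.trans hφ.2.2⟩
  exact ContDiff.iterate_deriv 1 hφ.1

lemma IsTest.differentiable {φ : ℝ → ℝ} (hφ : IsTest φ) : Differentiable ℝ φ :=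
  hφ.1.differentiable (by simp)

lemma IsTest.integrableOn_mul {v : ℝ → ℂ} (hv : LocallyIntegrableOn v (Ioi 0)) {φ : ℝ → ℝ}
    (hφ : IsTest φ) : IntegrableOn (fun ξ => v ξ * ((φ ξ : ℝ) : ℂ)) (Ioi 0) :=
  integrableOn_mul_of_compactSupport hv hφ.continuous hφ.2.1 hφ.2.2

lemma isWeakDeriv_of_hasDerivAt {v w : ℝ → ℂ} (hd : ∀ ξ, HasDerivAt v (w ξ) ξ)
    (hw : Continuous w) : IsWeakDeriv v w := by
  have hv : Continuous v := continuous_iff_continuousAt.mpr fun ξ => (hd ξ).continuousAt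
  have hvl : LocallyIntegrableOn v (Ioi 0) := hv.locallyIntegrable.locallyIntegrableOn _
  have hwl : LocallyIntegrableOn w (Ioi 0) := hw.locallyIntegrable.locallyIntegrableOn _
  refine ⟨hvl, hwl, fun φ hφ => ?_⟩
  have hout : ∀ {u : ℝ → ℂ} {ψ : ℝ → ℝ}, IsTest ψ →
      ∫ ξ in Ioi (0 : ℝ), u ξ * ((ψ ξ : ℝ) : ℂ) = ∫ ξ, u ξ * ((ψ ξ : ℝ) : ℂ) := by
    intro u ψ hψ
    refine setIntegral_eq_integral_of_forall_compl_eq_zero fun ξ hξ => ?_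
    rw [image_eq_zero_of_notMem_tsupport fun h => hξ (hψ.2.2 h)]; simp
  have hInt : ∀ {u : ℝ → ℂ} {ψ : ℝ → ℝ}, Continuous u → IsTest ψ →
      Integrable fun ξ => u ξ * ((ψ ξ : ℝ) : ℂ) := by
    intro u ψ hu hψ
    have := hψ.continuous
    refine Continuous.integrable_of_hasCompactSupport (by fun_prop) ?_
    refine HasCompactSupport.mul_left ?_
    exact hψ.2.1.comp_left (g := fun x : ℝ => (x : ℂ)) Complex.ofReal_zero
  rw [hout hφ.deriv, hout hφ]
  exact integral_mul_deriv_eq_deriv_mul_of_integrable (u := v) (v := fun ξ => ((φ ξ : ℝ) : ℂ))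
    (u' := w) (v' := fun ξ => ((deriv φ ξ : ℝ) : ℂ)) (fun ξ _ => hd ξ)
    (fun ξ _ => (hφ.differentiable ξ).hasDerivAt.ofReal_comp)
    (hInt hv hφ.deriv) (hInt hw hφ) (hInt hv hφ)

lemma IsWeakDeriv.const_mul {v w : ℝ → ℂ} (h : IsWeakDeriv v w) (c : ℂ) :
    IsWeakDeriv (fun ξ => c * v ξ) (fun ξ => c * w ξ) := by
  refine ⟨h.1.smul c, h.2.1.smul c, fun φ hφ => ?_⟩
  simp only [mul_assoc]
  rw [integral_const_mul, integral_const_mul, h.2.2 φ hφ, mul_neg]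

lemma IsWeakDeriv.add {v w v' w' : ℝ → ℂ} (h : IsWeakDeriv v w) (h' : IsWeakDeriv v' w') :
    IsWeakDeriv (fun ξ => v ξ + v' ξ) (fun ξ => w ξ + w' ξ) := by
  refine ⟨h.1.add h'.1, h.2.1.add h'.2.1, fun φ hφ => ?_⟩
  simp only [add_mul]
  rw [integral_add (hφ.deriv.integrableOn_mul h.1) (hφ.deriv.integrableOn_mul h'.1),
    integral_add (hφ.integrableOn_mul h.2.1) (hφ.integrableOn_mul h'.2.1), h.2.2 φ hφ,
    h'.2.2 φ hφ, neg_add]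

/-! ### Norms as weighted energy integrals -/

lemma ofReal_sobolev_integrand {ξ : ℝ} (hξ : 0 < ξ) (b : ℝ) (x y : ℂ) :
    ENNReal.ofReal ((‖x‖ ^ 2 + ‖y‖ ^ 2) * p b ξ ^ 2) = wt (2 * b) ξ * (‖x‖ₑ ^ 2 + ‖y‖ₑ ^ 2) := by
  rw [mul_comm, ENNReal.ofReal_mul (by positivity), ENNReal.ofReal_add (by positivity)
    (by positivity), ENNReal.ofReal_pow (norm_nonneg _), ENNReal.ofReal_pow (norm_nonneg _),
    ofReal_norm, ofReal_norm, p, wt, ← Real.rpow_natCast, ← Real.rpow_mul (by linarith)]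
  congr 3
  push_cast; ring

/-- The weighted `H¹` square norm for a given weak derivative. -/
def sobolevInt (b : ℝ) (v w : ℝ → ℂ) : ℝ≥0∞ :=
  ∫⁻ ξ in Ioi (0 : ℝ), wt (2 * b) ξ * (‖v ξ‖ₑ ^ 2 + ‖w ξ‖ₑ ^ 2)

lemma sobolevSq_eq (b : ℝ) (v : ℝ → ℂ) :
    sobolevSq (p b) v = ⨅ (w : ℝ → ℂ) (_ : IsWeakDeriv v w), sobolevInt b v w := by
  unfold sobolevSq sobolevInt
  congr 1; ext w; congr 1; ext _
  exact setLIntegral_congr_fun measurableSet_Ioi fun ξ hξ => ofReal_sobolev_integrand hξ b _ _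

lemma lintegral_sq_le_sobolevSq (b : ℝ) (v : ℝ → ℂ) :
    ∫⁻ ξ in Ioi (0 : ℝ), wt (2 * b) ξ * ‖v ξ‖ₑ ^ 2 ≤ sobolevSq (p b) v := by
  rw [sobolevSq_eq]
  refine le_iInf₂ fun w _ => lintegral_mono fun ξ => ?_
  gcongr
  exact le_self_add

/-- The infimum over weak derivatives is pulled through the square root and the constant. Since c ≠
0, the right side is ∞ when no weak derivative exists, so no existence has to be assumed. -/
lemma le_const_mul_profileNorm {b : ℝ} {v : ℝ → ℂ} {X c : ℝ≥0∞} (hc0 : c ≠ 0) (hc : c ≠ ⊤)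
    (h : ∀ w, IsWeakDeriv v w → X ≤ c * sobolevInt b v w ^ (1 / 2 : ℝ)) :
    X ≤ c * profileNorm (p b) v := by
  have hsq : ∀ x y : ℝ≥0∞, x ≤ y ^ (1 / 2 : ℝ) ↔ x ^ (2 : ℝ) ≤ y := fun x y => by
    rw [one_div, ENNReal.le_rpow_inv_iff (by norm_num)]
  have key : ∀ y, X ≤ c * y ^ (1 / 2 : ℝ) ↔ (X / c) ^ (2 : ℝ) ≤ y := fun y => by
    rw [← hsq, ENNReal.div_le_iff hc0 hc, mul_comm]
  unfold profileNorm
  rw [key, sobolevSq_eq]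
  exact le_iInf₂ fun w hw => (key _).mp (h w hw)

lemma modeNorm_le {b : ℝ} {n : ℕ} {u Du : ℕ → ℝ → ℂ}
    (h : ∀ ℓ, IsWeakDeriv (u (ℓ + 1)) (Du (ℓ + 1))) :
    modeNorm (p b) ((n : ℝ) / 2) u ≤ (∫⁻ ξ in Ioi (0 : ℝ), wt (2 * b) ξ
      * (modeEnergy n (fun ℓ => u ℓ ξ) + modeEnergy n fun ℓ => Du ℓ ξ)) ^ (1 / 2 : ℝ) := by
  unfold modeNorm
  refine ENNReal.rpow_le_rpow ?_ (by norm_num)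
  have hmeas : ∀ {v : ℝ → ℂ}, LocallyIntegrableOn v (Ioi 0) →
      AEMeasurable (fun ξ => ‖v ξ‖ₑ) (volume.restrict (Ioi 0)) := fun hv =>
    hv.aestronglyMeasurable.enorm
  calc _ ≤ ∑' ℓ : ℕ, ∫⁻ ξ in Ioi (0 : ℝ), wt (2 * b) ξ * (((ℓ + 1 : ℕ) : ℝ≥0∞) ^ n
        * (‖u (ℓ + 1) ξ‖ₑ ^ 2 + ‖Du (ℓ + 1) ξ‖ₑ ^ 2)) := by
        refine ENNReal.tsum_le_tsum fun ℓ => ?_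
        have e : ENNReal.ofReal (((ℓ + 1 : ℕ) : ℝ) ^ (2 * ((n : ℝ) / 2)))
            = ((ℓ + 1 : ℕ) : ℝ≥0∞) ^ n := by
          rw [mul_div_cancel₀ _ (by norm_num), Real.rpow_natCast,
              ENNReal.ofReal_pow (by positivity),
            ENNReal.ofReal_natCast]
        rw [e, sobolevSq_eq]
        calc _ ≤ ((ℓ + 1 : ℕ) : ℝ≥0∞) ^ n * sobolevInt b (u (ℓ + 1)) (Du (ℓ + 1)) := by
              gcongr; exact iInf₂_le _ (h ℓ)
          _ = _ := by
              unfold sobolevInt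
              rw [← lintegral_const_mul' _ _ (by finiteness)]
              congr 1; ext ξ; ring
    _ = ∫⁻ ξ in Ioi (0 : ℝ), ∑' ℓ : ℕ, wt (2 * b) ξ * (((ℓ + 1 : ℕ) : ℝ≥0∞) ^ n
        * (‖u (ℓ + 1) ξ‖ₑ ^ 2 + ‖Du (ℓ + 1) ξ‖ₑ ^ 2)) := by
        rw [lintegral_tsum]
        intro ℓ
        exact (measurable_wt _).aemeasurable.mul (aemeasurable_const.mul
          (((hmeas (h ℓ).1).pow_const 2).add ((hmeas (h ℓ).2.1).pow_const 2)))
    _ = _ := by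
        congr 1; ext ξ
        rw [ENNReal.tsum_mul_left]
        unfold modeEnergy
        simp only [mul_add]
        rw [ENNReal.tsum_add, mul_add]

/-! ### Operations on mode sequences -/

lemma modeEnergy_succ_le (n : ℕ) (x : ℕ → ℂ) :
    modeEnergy n (fun ℓ => x (ℓ + 1)) ≤ modeEnergy n x := by
  unfold modeEnergy
  calc _ ≤ ∑' j : ℕ, ((j + 1 + 1 : ℕ) : ℝ≥0∞) ^ n * ‖x (j + 1 + 1)‖ₑ ^ 2 := by
        gcongr with j
        omega
    _ ≤ ∑' j : ℕ, ((j + 1 : ℕ) : ℝ≥0∞) ^ n * ‖x (j + 1)‖ₑ ^ 2 :=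
        ENNReal.tsum_comp_le_tsum_of_injective (add_left_injective 1)
          fun j : ℕ => ((j + 1 : ℕ) : ℝ≥0∞) ^ n * ‖x (j + 1)‖ₑ ^ 2

/-- The shift brings in the zeroth mode, which the energy does not contain; the remaining weights
are compared by j + 2 ≤ 2(j + 1). -/
lemma modeEnergy_pred_le (n : ℕ) (x : ℕ → ℂ) :
    modeEnergy n (fun ℓ => x (ℓ - 1)) ≤ ‖x 0‖ₑ ^ 2 + 2 ^ n * modeEnergy n x := by
  unfold modeEnergy
  rw [tsum_eq_zero_add' ENNReal.summable, ← ENNReal.tsum_mul_left]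
  refine add_le_add (by simp) (ENNReal.tsum_le_tsum fun j => ?_)
  rw [← mul_assoc, ← mul_pow]
  refine mul_le_mul' (pow_le_pow_left' ?_ n) le_rfl
  norm_cast
  omega

lemma enorm_mul_add_sq_le (c x y : ℂ) : ‖c * (x + y)‖ₑ ^ 2
    ≤ 2 * ‖c‖ₑ ^ 2 * (‖x‖ₑ ^ 2 + ‖y‖ₑ ^ 2) := by
  rw [enorm_mul, mul_pow]
  calc ‖c‖ₑ ^ 2 * ‖x + y‖ₑ ^ 2 ≤ ‖c‖ₑ ^ 2 * (2 * (‖x‖ₑ ^ 2 + ‖y‖ₑ ^ 2)) := by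
        gcongr
        calc ‖x + y‖ₑ ^ 2 ≤ (‖x‖ₑ + ‖y‖ₑ) ^ 2 := by gcongr; exact enorm_add_le _ _
          _ ≤ 2 * (‖x‖ₑ ^ 2 + ‖y‖ₑ ^ 2) := by
            have := ENNReal.rpow_add_le_mul_rpow_add_rpow ‖x‖ₑ ‖y‖ₑ (one_le_two (α := ℝ))
            norm_num at this
            exact this
    _ = _ := by ring

/-- Energy of `c ℓ^m (x_{ℓ-1} + s x_{ℓ+1})` with `|s| = 1`. -/
lemma modeEnergy_neighbours_le (n m : ℕ) (c s : ℂ) (hs : ‖s‖ = 1) (x y : ℕ → ℂ)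
    (hy : ∀ ℓ : ℕ, y (ℓ + 1) = c * ((ℓ + 1 : ℕ) : ℂ) ^ m * (x ℓ + s * x (ℓ + 2))) :
    modeEnergy n y ≤ 2 * ‖c‖ₑ ^ 2
      * (‖x 0‖ₑ ^ 2 + (2 ^ (n + 2 * m) + 1) * modeEnergy (n + 2 * m) x) := by
  have hs' : ‖s‖ₑ = 1 := by rw [← ofReal_norm, hs, ENNReal.ofReal_one]
  have h1 : modeEnergy n y ≤ 2 * ‖c‖ₑ ^ 2 * (modeEnergy (n + 2 * m) (fun ℓ => x (ℓ - 1))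
      + modeEnergy (n + 2 * m) fun ℓ => x (ℓ + 1)) := by
    unfold modeEnergy
    rw [← ENNReal.tsum_add, ← ENNReal.tsum_mul_left]
    refine ENNReal.tsum_le_tsum fun j => ?_
    rw [hy]
    refine (mul_le_mul_right (enorm_mul_add_sq_le _ _ _) _).trans (le_of_eq ?_)
    rw [enorm_mul, enorm_mul, hs', one_mul, enorm_pow]
    have : ‖((j + 1 : ℕ) : ℂ)‖ₑ = ((j + 1 : ℕ) : ℝ≥0∞) := by
      rw [← ofReal_norm, Complex.norm_natCast, ENNReal.ofReal_natCast]
    rw [this, pow_add, pow_mul']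
    simp only [Nat.add_sub_cancel]
    ring
  refine h1.trans (mul_le_mul_right ?_ _)
  refine (add_le_add (modeEnergy_pred_le _ x) (modeEnergy_succ_le _ x)).trans (le_of_eq ?_)
  ring

lemma modeEnergy_weighted (n m : ℕ) (c : ℂ) (x y : ℕ → ℂ)
    (hy : ∀ ℓ : ℕ, y (ℓ + 1) = c * ((ℓ + 1 : ℕ) : ℂ) ^ m * x (ℓ + 1)) :
    modeEnergy n y = ‖c‖ₑ ^ 2 * modeEnergy (n + 2 * m) x := by
  unfold modeEnergy
  rw [← ENNReal.tsum_mul_left]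
  congr 1; ext j
  have : ‖((j + 1 : ℕ) : ℂ)‖ₑ = ((j + 1 : ℕ) : ℝ≥0∞) := by
    rw [← ofReal_norm, Complex.norm_natCast, ENNReal.ofReal_natCast]
  rw [hy, enorm_mul, enorm_mul, enorm_pow, this, pow_add, pow_mul']
  ring

/-! ### Norm bounds for the stationary state -/

/-- The derivatives of the modes, given a weak derivative `w` of the zeroth one. -/
def modeDeriv (κ : ℝ) (g : ℝ → ℝ) (w : ℝ → ℂ) : ℕ → ℝ → ℂ
  | 0 => w
  | ℓ + 1 => fun ξ => (κ : ℂ) / 2 * (fHat κ g (ℓ + 2) ξ - fHat κ g ℓ ξ)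

section
variable {κ : ℝ} {g : ℝ → ℝ}

lemma continuous_fHat (hκ : 0 ≤ κ) (hg : Integrable g) (ℓ : ℕ) : Continuous (fHat κ g ℓ) := by
  rw [fHat_eq_modeFn]; exact (isMomentSeq_moment hκ).continuous_modeFn hg ℓ

lemma fHat_zero (hκ : 0 ≤ κ) : fHat κ g 0 = gHat g := by
  rw [fHat_eq_modeFn]; exact (isMomentSeq_moment hκ).modeFn_zero

lemma hasDerivAt_fHat (hκ : 0 ≤ κ) (hg : Integrable g) (ℓ : ℕ) (ξ : ℝ) :
    HasDerivAt (fHat κ g (ℓ + 1)) ((κ : ℂ) / 2 * (fHat κ g (ℓ + 2) ξ - fHat κ g ℓ ξ)) ξ := by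
  rw [fHat_eq_modeFn]
  simpa using (isMomentSeq_moment hκ).hasDerivAt_modeFn hg ℓ ξ

lemma isWeakDeriv_fHat_succ (hκ : 0 ≤ κ) (hg : Integrable g) (w : ℝ → ℂ) (ℓ : ℕ) :
    IsWeakDeriv (fHat κ g (ℓ + 1)) (modeDeriv κ g w (ℓ + 1)) := by
  refine isWeakDeriv_of_hasDerivAt (fun ξ => hasDerivAt_fHat hκ hg ℓ ξ) ?_
  have := continuous_fHat hκ hg ℓ
  have := continuous_fHat hκ hg (ℓ + 2)
  simp only [modeDeriv]
  fun_prop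

lemma isWeakDeriv_fHat (hκ : 0 ≤ κ) (hg : Integrable g) {w : ℝ → ℂ} (hw : IsWeakDeriv (gHat g) w)
    (ℓ : ℕ) : IsWeakDeriv (fHat κ g ℓ) (modeDeriv κ g w ℓ) := by
  cases ℓ with
  | zero => rw [fHat_zero hκ]; exact hw
  | succ ℓ => exact isWeakDeriv_fHat_succ hκ hg w ℓ

end

/-- The derivatives for ℓ ≥ 1 are differences of neighbouring modes, so their energy is controlled
by that of f̂ at the same order plus |ĝ|². This is why w, the derivative of mode 0, does not enter
the bound. -/
lemma exists_energy_bound {κ : ℝ} (hκ : 0 ≤ κ) (n : ℕ) {a : ℝ} (ha : 0 ≤ a) :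
    ∃ C : ℝ≥0∞, C ≠ ⊤ ∧ ∀ g : ℝ → ℝ, Integrable g → (∀ ω, 0 ≤ g ω) → ∫ ω : ℝ, g ω = 1 →
      ∀ w : ℝ → ℂ, ∫⁻ ξ in Ioi 0, wt a ξ * (modeEnergy n (fun ℓ => fHat κ g ℓ ξ)
          + modeEnergy n (fun ℓ => modeDeriv κ g w ℓ ξ))
        ≤ C * ∫⁻ ξ in Ioi 0, wt (a + n + 2) ξ * ‖gHat g ξ‖ₑ ^ 2 := by
  obtain ⟨C, hC, hle⟩ := exists_lintegral_wt_tailBound_le κ n a ha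
  set A : ℝ≥0∞ := 2 * ‖-(κ : ℂ) / 2‖ₑ ^ 2 with hA
  have hAt : A ≠ ⊤ := by rw [hA]; finiteness
  refine ⟨A + (1 + A * (2 ^ n + 1)) * C, by finiteness, fun g hg hg0 hg1 w => ?_⟩
  have hm : Measurable fun ξ => ‖gHat g ξ‖ₑ := by
    have := continuous_fHat hκ hg 0
    rw [fHat_zero hκ] at this
    exact this.enorm.measurable
  have hpt : ∀ ξ, modeEnergy n (fun ℓ => fHat κ g ℓ ξ) + modeEnergy n (fun ℓ => modeDeriv κ g w ℓ ξ)
      ≤ A * ‖gHat g ξ‖ₑ ^ 2 + (1 + A * (2 ^ n + 1)) * tailBound κ (fun y => ‖gHat g y‖ₑ) n ξ := by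
    intro ξ
    have h1 := modeEnergy_neighbours_le n 0 (-(κ : ℂ) / 2) (-1) (by simp) (fun ℓ => fHat κ g ℓ ξ)
      (fun ℓ => modeDeriv κ g w ℓ ξ) (fun ℓ => by simp only [modeDeriv]; ring)
    have h2 := modeEnergy_fHat_le_tailBound hκ hg hg0 hg1 n ξ
    simp only [mul_zero, add_zero, fHat_zero hκ] at h1
    calc _ ≤ modeEnergy n (fun ℓ => fHat κ g ℓ ξ)
          + A * (‖gHat g ξ‖ₑ ^ 2 + (2 ^ n + 1) * modeEnergy n fun ℓ => fHat κ g ℓ ξ) := by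
          gcongr
      _ = A * ‖gHat g ξ‖ₑ ^ 2 + (1 + A * (2 ^ n + 1))
          * modeEnergy n fun ℓ => fHat κ g ℓ ξ := by ring
      _ ≤ _ := by gcongr
  calc _ ≤ ∫⁻ ξ in Ioi 0, (A * (wt a ξ * ‖gHat g ξ‖ₑ ^ 2)
        + (1 + A * (2 ^ n + 1)) * (wt a ξ * tailBound κ (fun y => ‖gHat g y‖ₑ) n ξ)) := by
        refine lintegral_mono fun ξ => ?_
        calc _ ≤ wt a ξ * _ := mul_le_mul_right (hpt ξ) _
          _ = _ := by ring
    _ = A * (∫⁻ ξ in Ioi 0, wt a ξ * ‖gHat g ξ‖ₑ ^ 2) + (1 + A * (2 ^ n + 1))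
          * ∫⁻ ξ in Ioi 0, wt a ξ * tailBound κ (fun y => ‖gHat g y‖ₑ) n ξ := by
        have hm' : Measurable fun ξ => wt a ξ * ‖gHat g ξ‖ₑ ^ 2 :=
          (measurable_wt a).mul (hm.pow_const 2)
        rw [lintegral_add_left (hm'.const_mul A), lintegral_const_mul' _ _ hAt,
          lintegral_const_mul' _ _ (by finiteness)]
    _ ≤ A * (∫⁻ ξ in Ioi 0, wt (a + n + 2) ξ * ‖gHat g ξ‖ₑ ^ 2) + (1 + A * (2 ^ n + 1))
          * (C * ∫⁻ ξ in Ioi 0, wt (a + n + 2) ξ * ‖gHat g ξ‖ₑ ^ 2) := by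
        gcongr A * ?_ + _ * ?_
        · refine setLIntegral_mono' measurableSet_Ioi fun ξ hξ => ?_
          gcongr
          refine wt_mono hξ ?_
          have : (0 : ℝ) ≤ n := Nat.cast_nonneg n
          linarith
        · exact hle _ hm
    _ = _ := by ring

lemma lintegral_le_sobolevInt (b : ℝ) (v w : ℝ → ℂ) :
    ∫⁻ ξ in Ioi 0, wt (2 * b) ξ * ‖v ξ‖ₑ ^ 2 ≤ sobolevInt b v w := by
  refine lintegral_mono fun ξ => ?_
  gcongr
  exact le_self_add

lemma sobolevInt_mono {b c : ℝ} (h : b ≤ c) (v w : ℝ → ℂ) :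
    sobolevInt b v w ≤ sobolevInt c v w := by
  refine setLIntegral_mono' measurableSet_Ioi fun ξ hξ => ?_
  gcongr
  exact wt_mono hξ (by linarith)

lemma rpow_half_sq (x : ℝ≥0∞) : (x ^ 2) ^ (1 / 2 : ℝ) = x := by
  rw [← ENNReal.rpow_natCast, ← ENNReal.rpow_mul]; norm_num

lemma exists_modeNorm_fHat_bound {κ : ℝ} (hκ : 0 ≤ κ) (n : ℕ) {b : ℝ} (hb : 0 ≤ b) :
    ∃ C : ℝ≥0∞, C ≠ ⊤ ∧ ∀ g : ℝ → ℝ, Integrable g → (∀ ω, 0 ≤ g ω) → ∫ ω : ℝ, g ω = 1 →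
      ∀ w : ℝ → ℂ, modeNorm (p b) ((n : ℝ) / 2) (fHat κ g)
        ≤ C * sobolevInt (b + (n : ℝ) / 2 + 1) (gHat g) w ^ (1 / 2 : ℝ) := by
  obtain ⟨C, hC, hle⟩ := exists_energy_bound hκ n (a := 2 * b) (by linarith)
  refine ⟨C ^ (1 / 2 : ℝ), by finiteness, fun g hg hg0 hg1 w => ?_⟩
  refine (modeNorm_le (Du := modeDeriv κ g w)
    fun ℓ => isWeakDeriv_fHat_succ hκ hg w ℓ).trans ?_
  rw [← ENNReal.mul_rpow_of_nonneg _ _ (by norm_num)]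
  refine ENNReal.rpow_le_rpow ((hle g hg hg0 hg1 w).trans ?_) (by norm_num)
  refine mul_le_mul_right (le_trans (le_of_eq ?_) (lintegral_le_sobolevInt _ _ w)) _
  rw [show 2 * (b + (n : ℝ) / 2 + 1) = 2 * b + n + 2 by ring]

/-- This covers r_r (s = -1) and r_i (s = 1). The factor ℓ raises the order of the energy by 2. The
component ℓ = 1 contains f̂_0 = ĝ, hence the weak derivative of ĝ is needed here. -/
lemma exists_modeNorm_neighbours_bound {κ : ℝ} (hκ : 0 ≤ κ) (n : ℕ) {b : ℝ} (hb : 0 ≤ b) :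
    ∃ C : ℝ≥0∞, C ≠ ⊤ ∧ ∀ g : ℝ → ℝ, Integrable g → (∀ ω, 0 ≤ g ω) → ∫ ω : ℝ, g ω = 1 →
      ∀ w : ℝ → ℂ, IsWeakDeriv (gHat g) w → ∀ (c s : ℂ) (u : ℕ → ℝ → ℂ), ‖s‖ = 1 →
        (∀ (ℓ : ℕ) (ξ : ℝ), u (ℓ + 1) ξ
          = c * ((ℓ + 1 : ℕ) : ℂ) ^ 1 * (fHat κ g ℓ ξ + s * fHat κ g (ℓ + 2) ξ)) →
        modeNorm (p b) ((n : ℝ) / 2) u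
          ≤ ‖c‖ₑ * C * sobolevInt (b + (n : ℝ) / 2 + 2) (gHat g) w ^ (1 / 2 : ℝ) := by
  obtain ⟨C, hC, hle⟩ := exists_energy_bound hκ (n + 2) (a := 2 * b) (by linarith)
  set B : ℝ≥0∞ := 2 ^ (n + 2) + 1 with hB
  have hBt : B ≠ ⊤ := by rw [hB]; finiteness
  refine ⟨(2 * (1 + B * C)) ^ (1 / 2 : ℝ), by finiteness, fun g hg hg0 hg1 w hw c s u hs hu => ?_⟩
  set Du : ℕ → ℝ → ℂ := fun ℓ ξ => c * (ℓ : ℂ) ^ 1 *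
    (modeDeriv κ g w (ℓ - 1) ξ + s * modeDeriv κ g w (ℓ + 1) ξ) with hDu
  have hweak : ∀ ℓ, IsWeakDeriv (u (ℓ + 1)) (Du (ℓ + 1)) := by
    intro ℓ
    have h1 := ((isWeakDeriv_fHat hκ hg hw ℓ).add
      ((isWeakDeriv_fHat hκ hg hw (ℓ + 2)).const_mul s)).const_mul (c * ((ℓ + 1 : ℕ) : ℂ) ^ 1)
    have h2 : u (ℓ + 1) = fun ξ => c * ((ℓ + 1 : ℕ) : ℂ) ^ 1
        * (fHat κ g ℓ ξ + s * fHat κ g (ℓ + 2) ξ) := funext fun ξ => hu ℓ ξ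
    rw [h2]
    exact h1
  refine (modeNorm_le hweak).trans ?_
  have hpt : ∀ ξ, modeEnergy n (fun ℓ => u ℓ ξ) + modeEnergy n (fun ℓ => Du ℓ ξ)
      ≤ 2 * ‖c‖ₑ ^ 2 * ((‖gHat g ξ‖ₑ ^ 2 + ‖w ξ‖ₑ ^ 2)
        + B * (modeEnergy (n + 2) (fun ℓ => fHat κ g ℓ ξ)
          + modeEnergy (n + 2) fun ℓ => modeDeriv κ g w ℓ ξ)) := by
    intro ξ
    have h1 := modeEnergy_neighbours_le n 1 c s hs (fun ℓ => fHat κ g ℓ ξ) (fun ℓ => u ℓ ξ)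
      fun ℓ => hu ℓ ξ
    have h2 := modeEnergy_neighbours_le n 1 c s hs (fun ℓ => modeDeriv κ g w ℓ ξ)
      (fun ℓ => Du ℓ ξ) fun ℓ => rfl
    simp only [mul_one, fHat_zero hκ] at h1 h2
    refine (add_le_add h1 h2).trans (le_of_eq ?_)
    simp only [modeDeriv]
    ring
  have hmw : AEMeasurable (fun ξ => wt (2 * b) ξ * (‖gHat g ξ‖ₑ ^ 2 + ‖w ξ‖ₑ ^ 2))
      (volume.restrict (Ioi 0)) :=
    (measurable_wt _).aemeasurable.mul ((hw.1.aestronglyMeasurable.enorm.pow_const 2).add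
      (hw.2.1.aestronglyMeasurable.enorm.pow_const 2))
  have hfinal : ∫⁻ ξ in Ioi 0, wt (2 * b) ξ
        * (modeEnergy n (fun ℓ => u ℓ ξ) + modeEnergy n (fun ℓ => Du ℓ ξ))
      ≤ ‖c‖ₑ ^ 2 * (2 * (1 + B * C)) * sobolevInt (b + (n : ℝ) / 2 + 2) (gHat g) w := by
    calc _ ≤ ∫⁻ ξ in Ioi 0, (2 * ‖c‖ₑ ^ 2) * (wt (2 * b) ξ * (‖gHat g ξ‖ₑ ^ 2 + ‖w ξ‖ₑ ^ 2)
          + B * (wt (2 * b) ξ * (modeEnergy (n + 2) (fun ℓ => fHat κ g ℓ ξ)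
          + modeEnergy (n + 2) fun ℓ => modeDeriv κ g w ℓ ξ))) := by
          refine lintegral_mono fun ξ => ?_
          calc _ ≤ wt (2 * b) ξ * _ := mul_le_mul_right (hpt ξ) _
            _ = _ := by ring
      _ = (2 * ‖c‖ₑ ^ 2) * (sobolevInt b (gHat g) w
          + B * ∫⁻ ξ in Ioi 0, wt (2 * b) ξ * (modeEnergy (n + 2) (fun ℓ => fHat κ g ℓ ξ)
          + modeEnergy (n + 2) fun ℓ => modeDeriv κ g w ℓ ξ)) := by
          rw [lintegral_const_mul' _ _ (by finiteness), lintegral_add_left' hmw,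
            lintegral_const_mul' _ _ hBt, sobolevInt]
      _ ≤ (2 * ‖c‖ₑ ^ 2) * (sobolevInt (b + (n : ℝ) / 2 + 2) (gHat g) w
          + B * (C * sobolevInt (b + (n : ℝ) / 2 + 2) (gHat g) w)) := by
          gcongr _ * (?_ + _ * ?_)
          · refine sobolevInt_mono ?_ _ _
            have : (0 : ℝ) ≤ n := Nat.cast_nonneg n
            linarith
          · refine (hle g hg hg0 hg1 w).trans ?_
            refine mul_le_mul_right (le_trans (le_of_eq ?_) (lintegral_le_sobolevInt _ _ w)) _
            rw [show 2 * (b + (n : ℝ) / 2 + 2) = 2 * b + (n + 2 : ℕ) + 2 by push_cast; ring]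
      _ = _ := by ring
  refine (ENNReal.rpow_le_rpow hfinal (by norm_num)).trans (le_of_eq ?_)
  rw [ENNReal.mul_rpow_of_nonneg _ _ (by norm_num), ENNReal.mul_rpow_of_nonneg _ _ (by norm_num),
    rpow_half_sq]

/-- Without a shift of index the zeroth mode never appears, and w may be arbitrary. -/
lemma exists_modeNorm_rotation_bound {κ : ℝ} (hκ : 0 ≤ κ) (n : ℕ) {b : ℝ} (hb : 0 ≤ b) :
    ∃ C : ℝ≥0∞, C ≠ ⊤ ∧ ∀ g : ℝ → ℝ, Integrable g → (∀ ω, 0 ≤ g ω) → ∫ ω : ℝ, g ω = 1 →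
      ∀ (w : ℝ → ℂ) (c : ℂ) (u : ℕ → ℝ → ℂ),
        (∀ (ℓ : ℕ) (ξ : ℝ), u (ℓ + 1) ξ = c * ((ℓ + 1 : ℕ) : ℂ) ^ 1 * fHat κ g (ℓ + 1) ξ) →
        modeNorm (p b) ((n : ℝ) / 2) u
          ≤ ‖c‖ₑ * C * sobolevInt (b + (n : ℝ) / 2 + 2) (gHat g) w ^ (1 / 2 : ℝ) := by
  obtain ⟨C, hC, hle⟩ := exists_energy_bound hκ (n + 2) (a := 2 * b) (by linarith)
  refine ⟨C ^ (1 / 2 : ℝ), by finiteness, fun g hg hg0 hg1 w c u hu => ?_⟩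
  set Du : ℕ → ℝ → ℂ := fun ℓ ξ => c * (ℓ : ℂ) ^ 1 * modeDeriv κ g w ℓ ξ with hDu
  have hweak : ∀ ℓ, IsWeakDeriv (u (ℓ + 1)) (Du (ℓ + 1)) := by
    intro ℓ
    have h2 : u (ℓ + 1) = fun ξ => c * ((ℓ + 1 : ℕ) : ℂ) ^ 1 * fHat κ g (ℓ + 1) ξ :=
      funext fun ξ => hu ℓ ξ
    rw [h2]
    exact (isWeakDeriv_fHat_succ hκ hg w ℓ).const_mul (c * ((ℓ + 1 : ℕ) : ℂ) ^ 1)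
  refine (modeNorm_le hweak).trans ?_
  have hpt : ∀ ξ, modeEnergy n (fun ℓ => u ℓ ξ) + modeEnergy n (fun ℓ => Du ℓ ξ)
      = ‖c‖ₑ ^ 2 * (modeEnergy (n + 2) (fun ℓ => fHat κ g ℓ ξ)
          + modeEnergy (n + 2) fun ℓ => modeDeriv κ g w ℓ ξ) := by
    intro ξ
    rw [modeEnergy_weighted n 1 c (fun ℓ => fHat κ g ℓ ξ) (fun ℓ => u ℓ ξ) fun ℓ => hu ℓ ξ,
      modeEnergy_weighted n 1 c (fun ℓ => modeDeriv κ g w ℓ ξ) (fun ℓ => Du ℓ ξ) fun ℓ => rfl,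
      mul_one, ← mul_add]
  have hfinal : ∫⁻ ξ in Ioi 0, wt (2 * b) ξ
        * (modeEnergy n (fun ℓ => u ℓ ξ) + modeEnergy n (fun ℓ => Du ℓ ξ))
      ≤ ‖c‖ₑ ^ 2 * C * sobolevInt (b + (n : ℝ) / 2 + 2) (gHat g) w := by
    simp only [hpt, mul_left_comm (wt (2 * b) _)]
    rw [lintegral_const_mul' _ _ (by finiteness), mul_assoc]
    refine mul_le_mul_right ((hle g hg hg0 hg1 w).trans ?_) _
    refine mul_le_mul_right (le_trans (le_of_eq ?_) (lintegral_le_sobolevInt _ _ w)) _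
    rw [show 2 * (b + (n : ℝ) / 2 + 2) = 2 * b + (n + 2 : ℕ) + 2 by push_cast; ring]
  refine (ENNReal.rpow_le_rpow hfinal (by norm_num)).trans (le_of_eq ?_)
  rw [ENNReal.mul_rpow_of_nonneg _ _ (by norm_num), ENNReal.mul_rpow_of_nonneg _ _ (by norm_num),
    rpow_half_sq]

/-- Serves the case K = 0, where the right-hand side `K * C` times the profile norm is 0 even if
that norm is infinite. -/
lemma modeNorm_eq_zero {b k : ℝ} {u : ℕ → ℝ → ℂ} (hu : ∀ ℓ, u (ℓ + 1) = fun _ => 0) :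
    modeNorm (p b) k u = 0 := by
  have h0 : sobolevSq (p b) (fun _ => 0) = 0 := by
    rw [sobolevSq_eq]
    have hw : IsWeakDeriv (fun _ => 0) (fun _ => 0) :=
      isWeakDeriv_of_hasDerivAt (fun ξ => hasDerivAt_const ξ 0) continuous_const
    refine le_antisymm ((iInf₂_le _ hw).trans (le_of_eq ?_)) zero_le
    simp [sobolevInt]
  unfold modeNorm
  simp [hu, h0]

/-! ### Uniqueness for the transport hierarchy -/

/-- Iterated bound for the mild hierarchy. -/
lemma hierarchy_iterate {κ τ T M : ℝ} (hκ : 0 ≤ κ) (hτ : 0 ≤ τ) (hM : 0 ≤ M)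
    {G : ℕ → ℝ → ℝ → ℂ} (hc : ∀ ℓ, Continuous (Function.uncurry (G ℓ)))
    (h0 : ∀ t a, G 0 t a = 0)
    (hmild : ∀ (ℓ : ℕ) (t a : ℝ), 0 ≤ t → 0 ≤ a → G (ℓ + 1) t a
      = ∫ s in (0 : ℝ)..t, (κ : ℂ) * ((ℓ + 1 : ℕ) : ℂ) / 2
        * (G ℓ s (a + (ℓ + 1 : ℕ) * (t - s)) - G (ℓ + 2) s (a + (ℓ + 1 : ℕ) * (t - s))))
    (hb : ∀ (ℓ : ℕ) (t a : ℝ), 0 ≤ t → t ≤ T → 0 ≤ a → ‖G ℓ t a‖ ≤ M * ℓ)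
    (hz : ∀ (ℓ : ℕ) (t a : ℝ), 0 ≤ t → t ≤ τ → 0 ≤ a → G ℓ t a = 0) (n : ℕ) :
    ∀ (ℓ : ℕ) (t a : ℝ), τ ≤ t → t ≤ T → 0 ≤ a →
      ‖G ℓ t a‖ ≤ M * ℓ * (κ * (t - τ)) ^ n * ((ℓ + n).choose n : ℝ) := by
  induction n with
  | zero =>
    intro ℓ t a ht hT ha
    simpa using hb ℓ t a (hτ.trans ht) hT ha
  | succ n ih =>
    intro ℓ t a ht hT ha
    cases ℓ with
    | zero => simp [h0]
    | succ ℓ =>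
      have ht0 : 0 ≤ t := hτ.trans ht
      set f : ℝ → ℂ := fun s => (κ : ℂ) * ((ℓ + 1 : ℕ) : ℂ) / 2
        * (G ℓ s (a + (ℓ + 1 : ℕ) * (t - s)) - G (ℓ + 2) s (a + (ℓ + 1 : ℕ) * (t - s))) with hf
      have hcomp : ∀ j, Continuous fun s => G j s (a + (ℓ + 1 : ℕ) * (t - s)) := fun j =>
        (hc j).comp (continuous_id.prodMk (by fun_prop))
      have hfc : Continuous f := continuous_const.mul ((hcomp ℓ).sub (hcomp (ℓ + 2)))
      have harg : ∀ s ≤ t, 0 ≤ a + (ℓ + 1 : ℕ) * (t - s) := fun s hs => by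
        have : (0 : ℝ) ≤ (ℓ + 1 : ℕ) := Nat.cast_nonneg _
        have := mul_nonneg this (sub_nonneg.mpr hs)
        linarith
      rw [hmild ℓ t a ht0 ha, ← intervalIntegral.integral_add_adjacent_intervals
        (hfc.intervalIntegrable 0 τ) (hfc.intervalIntegrable τ t)]
      have hfirst : ∫ s in (0 : ℝ)..τ, f s = 0 := by
        refine intervalIntegral.integral_zero_ae (ae_of_all _ fun s hs => ?_)
        rw [uIoc_of_le hτ] at hs
        have hs' := harg s (hs.2.trans ht)
        simp only [hf]
        rw [hz ℓ s _ hs.1.le hs.2 hs', hz (ℓ + 2) s _ hs.1.le hs.2 hs']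
        simp
      rw [hfirst, zero_add]
      set B : ℝ := M * (ℓ + 2 : ℕ) * ((ℓ + 2 + n).choose n : ℝ) with hB
      have hpt : ∀ s ∈ Ioc τ t, ‖f s‖ ≤ κ * (ℓ + 1 : ℕ) * B * (κ * (s - τ)) ^ n := by
        intro s hs
        have hs' := harg s hs.2
        have hpow : 0 ≤ (κ * (s - τ)) ^ n := pow_nonneg (mul_nonneg hκ (by linarith [hs.1])) n
        have h1 := ih ℓ s _ hs.1.le (hs.2.trans hT) hs'
        have h2 := ih (ℓ + 2) s _ hs.1.le (hs.2.trans hT) hs'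
        have h3 : M * ℓ * (κ * (s - τ)) ^ n * ((ℓ + n).choose n : ℝ) ≤ B * (κ * (s - τ)) ^ n := by
          have hch : ((ℓ + n).choose n : ℝ) ≤ ((ℓ + 2 + n).choose n : ℝ) := by
            exact_mod_cast Nat.choose_le_choose n (by omega)
          have hl : (ℓ : ℝ) ≤ (ℓ + 2 : ℕ) := by exact_mod_cast (by omega)
          calc M * ℓ * (κ * (s - τ)) ^ n * ((ℓ + n).choose n : ℝ)
              = M * ℓ * ((ℓ + n).choose n : ℝ) * (κ * (s - τ)) ^ n := by ring
            _ ≤ _ := by rw [hB]; gcongr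
        have h4 : M * (ℓ + 2 : ℕ) * (κ * (s - τ)) ^ n * ((ℓ + 2 + n).choose n : ℝ)
            = B * (κ * (s - τ)) ^ n := by rw [hB]; ring
        rw [h4] at h2
        simp only [hf]
        rw [norm_mul, norm_div, norm_mul, Complex.norm_real, Complex.norm_natCast,
          Complex.norm_two, Real.norm_eq_abs, abs_of_nonneg hκ]
        calc κ * (ℓ + 1 : ℕ) / 2 * _
            ≤ κ * (ℓ + 1 : ℕ) / 2 * (B * (κ * (s - τ)) ^ n + B * (κ * (s - τ)) ^ n) := by
              gcongr
              exact (norm_sub_le _ _).trans (add_le_add (h1.trans h3) h2)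
          _ = _ := by ring
      have hInt : ∫ s in τ..t, κ * (ℓ + 1 : ℕ) * B * (κ * (s - τ)) ^ n
          = κ * (ℓ + 1 : ℕ) * B * (κ ^ n * ((t - τ) ^ (n + 1) / (n + 1))) := by
        rw [intervalIntegral.integral_const_mul]
        simp only [mul_pow]
        rw [intervalIntegral.integral_const_mul,
          intervalIntegral.integral_comp_sub_right (fun x : ℝ => x ^ n), integral_pow]
        simp
      refine (intervalIntegral.norm_integral_le_of_norm_le ht
        (ae_of_all _ hpt) (Continuous.intervalIntegrable (by fun_prop) _ _)).trans (le_of_eq ?_)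
      rw [hInt, hB]
      -- One Duhamel step multiplies by κ(ℓ+1), replaces the growth factor by ℓ+2 and gains 1/(n+1)
      -- from the time integral; this is exactly the passage to the next binomial coefficient.
      have hid : ((ℓ + 1 + (n + 1)).choose (n + 1) : ℝ) * (n + 1)
          = ((ℓ + 2 + n).choose n : ℝ) * (ℓ + 2) := by
        have := Nat.choose_succ_right_eq (ℓ + 2 + n) n
        rw [show ℓ + 2 + n - n = ℓ + 2 by omega] at this
        rw [show ℓ + 1 + (n + 1) = ℓ + 2 + n by ring]
        exact_mod_cast this
      have hn : ((n : ℝ) + 1) ≠ 0 := by positivity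
      rw [eq_div_of_mul_eq hn hid, mul_pow]
      push_cast
      ring

/-- The coupling grows like ℓ, so a plain Grönwall estimate does not close. The n-th iterate is of
size x^n times the binomial coefficient of ℓ+n over n, polynomial in n for fixed ℓ, and tends to 0
once x < 1. The admissible time step 1/(κ+1) depends on κ alone, so finitely many steps reach any
time. -/
lemma hierarchy_eq_zero {κ : ℝ} (hκ : 0 ≤ κ)
    {G : ℕ → ℝ → ℝ → ℂ} (hc : ∀ ℓ, Continuous (Function.uncurry (G ℓ)))
    (h0 : ∀ t a, G 0 t a = 0)
    (hmild : ∀ (ℓ : ℕ) (t a : ℝ), 0 ≤ t → 0 ≤ a → G (ℓ + 1) t a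
      = ∫ s in (0 : ℝ)..t, (κ : ℂ) * ((ℓ + 1 : ℕ) : ℂ) / 2
        * (G ℓ s (a + (ℓ + 1 : ℕ) * (t - s)) - G (ℓ + 2) s (a + (ℓ + 1 : ℕ) * (t - s))))
    (hb : ∀ T : ℝ, ∃ M : ℝ, 0 ≤ M ∧ ∀ (ℓ : ℕ) (t a : ℝ), 0 ≤ t → t ≤ T → 0 ≤ a →
      ‖G ℓ t a‖ ≤ M * ℓ) :
    ∀ (ℓ : ℕ) (t a : ℝ), 0 ≤ t → 0 ≤ a → G ℓ t a = 0 := by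
  have hδ : 0 < 1 / (κ + 1) := by positivity
  have hstep : ∀ N : ℕ, ∀ (ℓ : ℕ) (t a : ℝ), 0 ≤ t → t ≤ N * (1 / (κ + 1)) → 0 ≤ a →
      G ℓ t a = 0 := by
    intro N
    induction N with
    | zero =>
      intro ℓ t a ht htN ha
      have ht' : t = 0 := le_antisymm (by simpa using htN) ht
      subst ht'
      cases ℓ with
      | zero => exact h0 _ _
      | succ ℓ => rw [hmild ℓ 0 a le_rfl ha]; simp
    | succ N ih =>
      intro ℓ t a ht htN ha
      rcases le_total t (N * (1 / (κ + 1))) with h | h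
      · exact ih ℓ t a ht h ha
      · obtain ⟨M, hM, hbM⟩ := hb ((N + 1 : ℕ) * (1 / (κ + 1)))
        have hτ : (0 : ℝ) ≤ N * (1 / (κ + 1)) := by positivity
        have hit := fun n => hierarchy_iterate hκ hτ hM hc h0 hmild hbM ih n ℓ t a h htN ha
        set x := κ * (t - N * (1 / (κ + 1))) with hx
        have hx0 : 0 ≤ x := mul_nonneg hκ (by linarith)
        have hx1 : x < 1 := by
          have h1 : t - N * (1 / (κ + 1)) ≤ 1 / (κ + 1) := by push_cast at htN; linarith
          calc x ≤ κ * (1 / (κ + 1)) := by rw [hx]; gcongr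
            _ < 1 := by rw [mul_one_div, div_lt_one (by linarith)]; linarith
        have hlim : Tendsto (fun n : ℕ => M * ℓ * x ^ n * ((ℓ + n).choose n : ℝ)) atTop (𝓝 0) := by
          have h1 := (summable_choose_mul_geometric_of_norm_lt_one ℓ
            (r := x) (by rwa [Real.norm_eq_abs, abs_of_nonneg hx0])).tendsto_atTop_zero.const_mul
                (M * ℓ)
          rw [mul_zero] at h1
          refine h1.congr fun n => ?_
          rw [show (ℓ + n).choose n = (n + ℓ).choose ℓ by
            rw [add_comm]; exact Nat.choose_symm_add]
          ring
        have := ge_of_tendsto' hlim hit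
        exact norm_le_zero_iff.mp this
  intro ℓ t a ht ha
  obtain ⟨N, hN⟩ := exists_nat_ge (t / (1 / (κ + 1)))
  exact hstep N ℓ t a ht ((div_le_iff₀ hδ).mp hN) ha

/-! ### Test function pairings -/

lemma IsTest.translate {φ : ℝ → ℝ} (hφ : IsTest φ) {a : ℝ} (ha : 0 ≤ a) :
    IsTest fun ξ => φ (ξ - a) := by
  refine ⟨hφ.1.comp (contDiff_id.sub contDiff_const),
    hφ.2.1.comp_homeomorph (Homeomorph.subRight a), fun ξ hξ => ?_⟩
  have h1 : tsupport (fun ξ => φ (ξ - a)) = (Homeomorph.subRight a) ⁻¹' tsupport φ :=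
    tsupport_comp_eq_preimage φ (Homeomorph.subRight a)
  rw [h1] at hξ
  have := hφ.2.2 hξ
  simp at this
  simp; linarith

/-- The pairing `∫ v φ`. -/
def pair (v : ℝ → ℂ) (φ : ℝ → ℝ) : ℂ := ∫ ξ, v ξ * ((φ ξ : ℝ) : ℂ)

lemma IsTest.setIntegral_eq_pair {φ : ℝ → ℝ} (hφ : IsTest φ) (v : ℝ → ℂ) :
    ∫ ξ in Ioi (0 : ℝ), v ξ * ((φ ξ : ℝ) : ℂ) = pair v φ := by
  refine setIntegral_eq_integral_of_forall_compl_eq_zero fun ξ hξ => ?_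
  rw [image_eq_zero_of_notMem_tsupport fun h => hξ (hφ.2.2 h)]; simp

lemma IsTest.integrable_mul {φ : ℝ → ℝ} (hφ : IsTest φ) {v : ℝ → ℂ} (hv : Continuous v) :
    Integrable fun ξ => v ξ * ((φ ξ : ℝ) : ℂ) := by
  have := hφ.continuous
  refine Continuous.integrable_of_hasCompactSupport (by fun_prop) (HasCompactSupport.mul_left ?_)
  exact hφ.2.1.comp_left (g := fun x : ℝ => (x : ℂ)) Complex.ofReal_zero

lemma pair_translate (v : ℝ → ℂ) (φ : ℝ → ℝ) (a : ℝ) :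
    pair v (fun ξ => φ (ξ - a)) = ∫ η, v (η + a) * ((φ η : ℝ) : ℂ) := by
  rw [pair, ← integral_add_right_eq_self _ a]
  simp

/-- Joint continuity of translated pairings. -/
lemma IsTest.continuous_pair {φ : ℝ → ℝ} (hφ : IsTest φ) {W : ℝ → ℝ → ℂ}
    (hW : Continuous (Function.uncurry W)) :
    Continuous (Function.uncurry fun t a => pair (W t) fun ξ => φ (ξ - a)) := by
  have h1 : (Function.uncurry fun t a => pair (W t) fun ξ => φ (ξ - a))
      = fun q : ℝ × ℝ => ∫ η in tsupport φ, W q.1 (η + q.2) * ((φ η : ℝ) : ℂ) := by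
    ext ⟨t, a⟩
    simp only [Function.uncurry_apply_pair]
    rw [pair_translate]
    refine (setIntegral_eq_integral_of_forall_compl_eq_zero fun η hη => ?_).symm
    rw [image_eq_zero_of_notMem_tsupport hη]; simp
  rw [h1]
  have hφc := hφ.continuous
  refine continuous_parametric_integral_of_continuous
    (f := fun (q : ℝ × ℝ) η => W q.1 (η + q.2) * ((φ η : ℝ) : ℂ)) ?_ hφ.2.1
  refine Continuous.mul ?_ (by fun_prop)
  exact hW.comp ((continuous_fst.comp continuous_fst).prodMk
    (continuous_snd.add (continuous_snd.comp continuous_fst)))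

/-- The pairing is the convolution of v with the reflected test function, so the derivative falls on
the test function and v need only be continuous. -/
lemma IsTest.hasDerivAt_pair {φ : ℝ → ℝ} (hφ : IsTest φ) {v : ℝ → ℂ} (hv : Continuous v) (a : ℝ) :
    HasDerivAt (fun a => pair v fun ξ => φ (ξ - a))
        (-pair v fun ξ => _root_.deriv φ (ξ - a)) a := by
  set ψ : ℝ → ℝ := fun x => φ (-x) with hψ
  have hψs : HasCompactSupport ψ := hφ.2.1.comp_homeomorph (Homeomorph.neg ℝ)
  have hψc : ContDiff ℝ 1 ψ := (hφ.1.comp contDiff_neg).of_le (by exact_mod_cast le_top)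
  have hψd : _root_.deriv ψ = fun x => -_root_.deriv φ (-x) := by
    ext x; rw [hψ, deriv_comp_neg]
  have h := HasCompactSupport.hasDerivAt_convolution_right (ContinuousLinearMap.lsmul ℝ ℝ).flip
    (hv.locallyIntegrable (μ := volume)) hψs hψc a
  have e1 : (fun a => pair v fun ξ => φ (ξ - a))
      = MeasureTheory.convolution v ψ (ContinuousLinearMap.lsmul ℝ ℝ).flip volume := by
    ext a
    rw [pair, MeasureTheory.convolution]
    congr 1; ext ξ
    simp [hψ, mul_comm]
  rw [e1]
  refine h.congr_deriv ?_
  rw [pair, MeasureTheory.convolution, hψd, ← integral_neg]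
  congr 1; ext ξ
  simp [mul_comm]

/-- The tested right-hand side of the hierarchy at mode `ℓ + 1`. -/
def testedRhs (κ : ℝ) (W : ℕ → ℝ → ℝ → ℂ) (ℓ : ℕ) (φ : ℝ → ℝ) (s : ℝ) : ℂ :=
  -((ℓ + 1 : ℕ) : ℂ) * pair (W (ℓ + 1) s) (deriv φ)
    + (κ : ℂ) * ((ℓ + 1 : ℕ) : ℂ) / 2 * (pair (W ℓ s) φ - pair (W (ℓ + 2) s) φ)

lemma IsTest.continuous_pair_time {φ : ℝ → ℝ} (hφ : IsTest φ) {W : ℝ → ℝ → ℂ}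
    (hW : Continuous (Function.uncurry W)) : Continuous fun t => pair (W t) φ := by
  have := (hφ.continuous_pair hW).comp (continuous_id.prodMk (continuous_const (y := (0 : ℝ))))
  simpa [Function.comp_def] using this

lemma continuous_testedRhs {κ : ℝ} {W : ℕ → ℝ → ℝ → ℂ}
    (hc : ∀ ℓ, Continuous (Function.uncurry (W ℓ))) (ℓ : ℕ) {φ : ℝ → ℝ} (hφ : IsTest φ) :
    Continuous (testedRhs κ W ℓ φ) := by
  unfold testedRhs
  have h1 := hφ.deriv.continuous_pair_time (hc (ℓ + 1))
  have h2 := hφ.continuous_pair_time (hc ℓ)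
  have h3 := hφ.continuous_pair_time (hc (ℓ + 2))
  fun_prop

lemma hasDerivAt_along_characteristic {G Gt Ga : ℝ → ℝ → ℂ} {s a c : ℝ}
    (ht : ∀ᶠ q : ℝ × ℝ in 𝓝 (s, a), HasDerivAt (fun t => G t q.2) (Gt q.1 q.2) q.1)
    (ha : ∀ᶠ q : ℝ × ℝ in 𝓝 (s, a), HasDerivAt (fun x => G q.1 x) (Ga q.1 q.2) q.2)
    (hGt : Continuous (Function.uncurry Gt)) (hGa : Continuous (Function.uncurry Ga))
    {γ : ℝ → ℝ} (hγ : HasDerivAt γ c s) (hγs : γ s = a) :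
    HasDerivAt (fun t => G t (γ t)) (Gt s a + c * Ga s a) s := by
  have hcl : Continuous fun z : ℂ => ContinuousLinearMap.toSpanSingleton ℝ z :=
    (ContinuousLinearMap.toSpanSingletonLIE ℝ ℂ).continuous
  have h := hasStrictFDerivAt_uncurry_coprod (𝕜 := ℝ) (u := (s, a)) (f := G)
    (f₁ := fun t x => ContinuousLinearMap.toSpanSingleton ℝ (Gt t x))
    (f₂ := fun t x => ContinuousLinearMap.toSpanSingleton ℝ (Ga t x))
    (ht.mono fun q hq => hq.hasFDerivAt) (ha.mono fun q hq => hq.hasFDerivAt)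
    (hcl.comp hGt).continuousAt (hcl.comp hGa).continuousAt
  have h2 : HasDerivAt (fun t => (t, γ t)) ((1 : ℝ), c) s := (hasDerivAt_id s).prodMk hγ
  have h3 := HasFDerivAt.comp_hasDerivAt_of_eq s h.hasFDerivAt h2 (by rw [hγs])
  refine h3.congr_deriv ?_
  simp [Function.HasUncurry.uncurry]

/-- Testing with the translates φ(· - a) turns the weak equation into a classical one for G_ℓ(t, a),
namely ∂_t G_ℓ = ℓ ∂_a G_ℓ plus the coupling. Integration along characteristics gives the mild form,
to which `hierarchy_eq_zero` applies. -/
lemma pair_eq_zero_of_weak {κ : ℝ} (hκ : 0 ≤ κ) {W : ℕ → ℝ → ℝ → ℂ}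
    (hc : ∀ ℓ, Continuous (Function.uncurry (W ℓ))) (h0 : ∀ t ξ, W 0 t ξ = 0)
    (hweak : ∀ (ℓ : ℕ) (φ : ℝ → ℝ), IsTest φ → ∀ t, 0 ≤ t →
      pair (W (ℓ + 1) t) φ = ∫ s in (0 : ℝ)..t, testedRhs κ W ℓ φ s)
    (hb : ∀ φ : ℝ → ℝ, IsTest φ → ∀ T : ℝ, ∃ M : ℝ, 0 ≤ M ∧ ∀ (ℓ : ℕ) (t a : ℝ),
      0 ≤ t → t ≤ T → 0 ≤ a → ‖pair (W ℓ t) fun ξ => φ (ξ - a)‖ ≤ M * ℓ)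
    {φ : ℝ → ℝ} (hφ : IsTest φ) (ℓ : ℕ) {t : ℝ} (ht : 0 ≤ t) : pair (W ℓ t) φ = 0 := by
  set G : ℕ → ℝ → ℝ → ℂ := fun ℓ t a => pair (W ℓ t) fun ξ => φ (ξ - a) with hG
  have hGc : ∀ ℓ, Continuous (Function.uncurry (G ℓ)) := fun ℓ => hφ.continuous_pair (hc ℓ)
  set G' : ℕ → ℝ → ℝ → ℂ := fun ℓ t a => pair (W ℓ t) fun ξ => deriv φ (ξ - a) with hG'
  have hG'c : ∀ ℓ, Continuous (Function.uncurry (G' ℓ)) := fun ℓ => hφ.deriv.continuous_pair (hc ℓ)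
  have hrhs : ∀ (ℓ : ℕ) (a s : ℝ), testedRhs κ W ℓ (fun ξ => φ (ξ - a)) s
      = -((ℓ + 1 : ℕ) : ℂ) * G' (ℓ + 1) s a
        + (κ : ℂ) * ((ℓ + 1 : ℕ) : ℂ) / 2 * (G ℓ s a - G (ℓ + 2) s a) := by
    intro ℓ a s
    unfold testedRhs
    have : deriv (fun ξ => φ (ξ - a)) = fun ξ => deriv φ (ξ - a) := by
      ext ξ; exact deriv_comp_sub_const φ a ξ
    rw [this]
  have hmild : ∀ (ℓ : ℕ) (t a : ℝ), 0 ≤ t → 0 ≤ a → G (ℓ + 1) t a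
      = ∫ s in (0 : ℝ)..t, (κ : ℂ) * ((ℓ + 1 : ℕ) : ℂ) / 2
        * (G ℓ s (a + (ℓ + 1 : ℕ) * (t - s)) - G (ℓ + 2) s (a + (ℓ + 1 : ℕ) * (t - s))) := by
    intro ℓ t a ht ha
    set Gt : ℝ → ℝ → ℂ := fun s x => -((ℓ + 1 : ℕ) : ℂ) * G' (ℓ + 1) s x
        + (κ : ℂ) * ((ℓ + 1 : ℕ) : ℂ) / 2 * (G ℓ s x - G (ℓ + 2) s x) with hGt
    have hGtc : Continuous (Function.uncurry Gt) := by
      have e : Function.uncurry Gt = fun q => -((ℓ + 1 : ℕ) : ℂ) * Function.uncurry (G' (ℓ + 1)) q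
        + (κ : ℂ) * ((ℓ + 1 : ℕ) : ℂ) / 2
          * (Function.uncurry (G ℓ) q - Function.uncurry (G (ℓ + 2)) q) := rfl
      rw [e]
      exact (continuous_const.mul (hG'c _)).add (continuous_const.mul ((hGc _).sub (hGc _)))
    -- Backwards in time the characteristic moves to larger shifts, so it stays in a ≥ 0 and no
    -- boundary condition at ξ = 0 is needed.
    set γ : ℝ → ℝ := fun s => a + (ℓ + 1 : ℕ) * (t - s) with hγ
    have hγc : Continuous γ := by fun_prop
    have hγd : ∀ s, HasDerivAt γ (-(ℓ + 1 : ℕ) : ℝ) s := by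
      intro s
      have := (((hasDerivAt_id s).const_sub t).const_mul ((ℓ + 1 : ℕ) : ℝ)).const_add a
      simpa [hγ] using this
    have hcompG : ∀ j, Continuous fun s => G j s (γ s) := fun j =>
      (hGc j).comp (continuous_id.prodMk hγc)
    have hderiv : ∀ s ∈ Ioo 0 t, HasDerivAt (fun s => G (ℓ + 1) s (γ s))
        ((κ : ℂ) * ((ℓ + 1 : ℕ) : ℂ) / 2 * (G ℓ s (γ s) - G (ℓ + 2) s (γ s))) s := by
      intro s hs
      have hγpos : 0 < γ s := by
        have : (0 : ℝ) < (ℓ + 1 : ℕ) := by positivity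
        have := mul_pos this (sub_pos.mpr hs.2)
        simp only [hγ]; linarith
      have hpt : ∀ᶠ q : ℝ × ℝ in 𝓝 (s, γ s),
          HasDerivAt (fun t => G (ℓ + 1) t q.2) (Gt q.1 q.2) q.1 := by
        -- The weak equation is available only for t ≥ 0 and right translates; near an interior
        -- point of the characteristic both conditions hold in a neighbourhood.
        have h1 : ∀ᶠ q : ℝ × ℝ in 𝓝 (s, γ s), 0 < q.1 ∧ 0 < q.2 :=
          (continuous_fst.continuousAt.eventually (lt_mem_nhds hs.1)).and
            (continuous_snd.continuousAt.eventually (lt_mem_nhds hγpos))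
        filter_upwards [h1] with q hq
        have hcont := continuous_testedRhs (κ := κ) hc ℓ (hφ.translate hq.2.le)
        have h2 := (hcont.integral_hasStrictDerivAt 0 q.1).hasDerivAt
        rw [hrhs] at h2
        refine h2.congr_of_eventuallyEq ?_
        filter_upwards [lt_mem_nhds hq.1] with t' ht'
        exact hweak ℓ _ (hφ.translate hq.2.le) t' ht'.le
      have hpa : ∀ᶠ q : ℝ × ℝ in 𝓝 (s, γ s),
          HasDerivAt (fun x => G (ℓ + 1) q.1 x) (-G' (ℓ + 1) q.1 q.2) q.2 := by
        refine Eventually.of_forall fun q => hφ.hasDerivAt_pair ?_ q.2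
        exact (hc (ℓ + 1)).comp (continuous_const.prodMk continuous_id)
      refine (hasDerivAt_along_characteristic (Ga := fun t x => -G' (ℓ + 1) t x) hpt hpa hGtc
        (hG'c (ℓ + 1)).neg (hγd s) rfl).congr_deriv ?_
      simp only [hGt]
      push_cast
      ring
    have hFTC := intervalIntegral.integral_eq_sub_of_hasDerivAt_of_le ht
      (hcompG (ℓ + 1)).continuousOn hderiv
      (Continuous.intervalIntegrable (continuous_const.mul ((hcompG ℓ).sub (hcompG (ℓ + 2)))) _ _)
    have hγt : γ t = a := by simp [hγ]
    have hγ0 : 0 ≤ γ 0 := by simp only [hγ]; positivity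
    have hinit : G (ℓ + 1) 0 (γ 0) = 0 := by
      have := hweak ℓ _ (hφ.translate hγ0) 0 le_rfl
      rw [intervalIntegral.integral_same] at this
      exact this
    rw [hFTC, hinit, hγt, sub_zero]
  have hzero := hierarchy_eq_zero hκ hGc (fun t a => by simp [hG, pair, h0]) hmild (hb φ hφ) ℓ t 0
    ht le_rfl
  simpa [hG] using hzero

/-! ### Evolutions as continuous fields on the plane -/

/-- Constant extension of the modes to the plane, with vanishing zeroth mode. -/
def extend (w : ℝ → ℕ → ℝ → ℂ) (ℓ : ℕ) (t ξ : ℝ) : ℂ :=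
  if ℓ = 0 then 0 else w (max t 0) ℓ (max ξ 0)

lemma extend_zero (w : ℝ → ℕ → ℝ → ℂ) (t ξ : ℝ) : extend w 0 t ξ = 0 := rfl

lemma extend_succ (w : ℝ → ℕ → ℝ → ℂ) (ℓ : ℕ) {t ξ : ℝ} (ht : 0 ≤ t) (hξ : 0 ≤ ξ) :
    extend w (ℓ + 1) t ξ = w t (ℓ + 1) ξ := by
  simp [extend, max_eq_left ht, max_eq_left hξ]

lemma pair_congr {v v' : ℝ → ℂ} {φ : ℝ → ℝ} (hφ : IsTest φ) (h : ∀ ξ, 0 < ξ → v ξ = v' ξ) :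
    pair v φ = pair v' φ := by
  rw [← hφ.setIntegral_eq_pair, ← hφ.setIntegral_eq_pair]
  exact setIntegral_congr_fun measurableSet_Ioi fun ξ hξ => by simp only [h ξ hξ]

section evolution
variable {κ : ℝ} {v : ℕ → ℝ → ℂ} {w : ℝ → ℕ → ℝ → ℂ}

lemma IsEvolution.continuous_extend (hw : IsEvolution κ v w) (ℓ : ℕ) :
    Continuous (Function.uncurry (extend w ℓ)) := by
  cases ℓ with
  | zero => exact continuous_const
  | succ ℓ =>
    have h := hw.continuous_modes (ℓ + 1) (by omega)
    have h2 : Continuous fun q : ℝ × ℝ => (max q.1 0, max q.2 0) := by fun_prop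
    refine (h.comp_continuous h2 fun q =>
      ⟨mem_Ici.mpr (le_max_right _ _), mem_Ici.mpr (le_max_right _ _)⟩).congr fun q => ?_
    simp [extend, Function.uncurry]

lemma IsEvolution.pair_extend (hw : IsEvolution κ v w) (ℓ : ℕ) {φ : ℝ → ℝ} (hφ : IsTest φ) {t : ℝ}
    (ht : 0 ≤ t) : pair (extend w (ℓ + 1) t) φ = pair (extend w (ℓ + 1) 0) φ
      + ∫ s in (0 : ℝ)..t, testedRhs κ (extend w) ℓ φ s := by
  have hcs : ∀ j s, Continuous (extend w j s) := fun j s =>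
    (hw.continuous_extend j).comp (continuous_const.prodMk continuous_id)
  have h := hw.weak_eq (ℓ + 1) (by omega) φ hφ t ht
  rw [hφ.setIntegral_eq_pair, hφ.setIntegral_eq_pair] at h
  rw [pair_congr hφ fun ξ hξ => extend_succ w ℓ ht hξ.le, h,
    pair_congr hφ fun ξ hξ => (extend_succ w ℓ le_rfl hξ.le).trans
      (hw.initial (ℓ + 1) (by omega) ξ hξ.le)]
  congr 1
  refine intervalIntegral.integral_congr fun s hs => ?_
  rw [uIcc_of_le ht] at hs
  simp only [testedRhs]
  rw [← hφ.setIntegral_eq_pair, ← hφ.setIntegral_eq_pair, ← hφ.deriv.setIntegral_eq_pair]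
  have i1 := (hφ.deriv.integrable_mul (hcs (ℓ + 1) s)).integrableOn (s := Ioi 0)
  have i2 := (hφ.integrable_mul (hcs ℓ s)).integrableOn (s := Ioi 0)
  have i3 := (hφ.integrable_mul (hcs (ℓ + 2) s)).integrableOn (s := Ioi 0)
  have i4 : IntegrableOn (fun ξ => (κ : ℂ) * ((ℓ + 1 : ℕ) : ℂ) / 2
      * (extend w ℓ s ξ * ((φ ξ : ℝ) : ℂ) - extend w (ℓ + 2) s ξ * ((φ ξ : ℝ) : ℂ))) (Ioi 0) :=
    (i2.sub i3).const_mul _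
  rw [← integral_sub i2 i3, ← integral_const_mul, ← integral_const_mul,
    ← integral_add (i1.const_mul _) i4]
  refine setIntegral_congr_fun measurableSet_Ioi fun ξ hξ => ?_
  have hξ0 : (0 : ℝ) ≤ ξ := le_of_lt hξ
  have hlow : lower (w s) (ℓ + 1) ξ = extend w ℓ s ξ := by
    cases ℓ with
    | zero => simp [lower, extend]
    | succ ℓ =>
      rw [extend_succ w ℓ hs.1 hξ0]
      simp [lower]
  rw [hlow, extend_succ w ℓ hs.1 hξ0, extend_succ w (ℓ + 1) hs.1 hξ0]
  ring

lemma mul_le_sq_add_sq (x y : ℝ≥0∞) : x * y ≤ x ^ 2 + y ^ 2 := by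
  rcases le_total x y with h | h
  · calc x * y ≤ y * y := by gcongr
      _ = y ^ 2 := (sq y).symm
      _ ≤ _ := le_add_self
  · calc x * y ≤ x * x := by gcongr
      _ = x ^ 2 := (sq x).symm
      _ ≤ _ := le_self_add

/-- The norm with k = -1/2 gives ‖w_ℓ‖² ≤ ℓ M² in L², and translation does not enlarge the L² norm
of φ. The resulting linear growth in ℓ is what the uniqueness argument admits. -/
lemma IsEvolution.pair_bound (hw : IsEvolution κ v w) {φ : ℝ → ℝ} (hφ : IsTest φ) (T : ℝ) :
    ∃ M : ℝ, 0 ≤ M ∧ ∀ (ℓ : ℕ) (t a : ℝ), 0 ≤ t → t ≤ T → 0 ≤ a →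
      ‖pair (extend w ℓ t) fun ξ => φ (ξ - a)‖ ≤ M * ℓ := by
  obtain ⟨M, hM⟩ := hw.bounded T
  set S : ℝ≥0∞ := ∫⁻ ξ, ‖((φ ξ : ℝ) : ℂ)‖ₑ ^ 2 with hS
  have hSt : S ≠ ⊤ := by
    have hc := hφ.continuous
    have : Integrable fun ξ => ‖((φ ξ : ℝ) : ℂ)‖ ^ 2 := by
      refine Continuous.integrable_of_hasCompactSupport (by fun_prop) ?_
      exact hφ.2.1.comp_left (g := fun x : ℝ => ‖(x : ℂ)‖ ^ 2) (by simp)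
    have h2 := this.lintegral_lt_top
    refine ne_of_lt (lt_of_le_of_lt (le_of_eq ?_) h2)
    rw [hS]
    congr 1; ext ξ
    rw [ENNReal.ofReal_pow (norm_nonneg _), ofReal_norm]
  set B : ℝ≥0∞ := ENNReal.ofReal M ^ 2 + S with hB
  have hBt : B ≠ ⊤ := by rw [hB]; finiteness
  refine ⟨B.toReal, ENNReal.toReal_nonneg, fun ℓ t a ht hT ha => ?_⟩
  cases ℓ with
  | zero => simp [pair, extend_zero]
  | succ ℓ =>
    have hL2 : ∫⁻ ξ in Ioi (0 : ℝ), ‖extend w (ℓ + 1) t ξ‖ₑ ^ 2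
        ≤ ((ℓ + 1 : ℕ) : ℝ≥0∞) * ENNReal.ofReal M ^ 2 := by
      have h1 : ∫⁻ ξ in Ioi (0 : ℝ), ‖extend w (ℓ + 1) t ξ‖ₑ ^ 2
          ≤ sobolevSq (p 0) (w t (ℓ + 1)) := by
        refine le_trans (le_of_eq ?_) (lintegral_sq_le_sobolevSq 0 _)
        refine setLIntegral_congr_fun measurableSet_Ioi fun ξ hξ => ?_
        simp only [extend_succ w ℓ ht (le_of_lt hξ)]
        simp [wt]
      have h2 := hM t ⟨ht, hT⟩
      unfold modeNorm at h2
      rw [one_div, ENNReal.rpow_inv_le_iff (by norm_num), ENNReal.rpow_two] at h2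
      have h3 := (ENNReal.le_tsum (f := fun ℓ : ℕ => ENNReal.ofReal (((ℓ + 1 : ℕ) : ℝ)
        ^ (2 * (-1 / 2 : ℝ))) * sobolevSq (p 0) (w t (ℓ + 1))) ℓ).trans h2
      have e : ENNReal.ofReal (((ℓ + 1 : ℕ) : ℝ) ^ (2 * (-1 / 2 : ℝ)))
          = ((ℓ + 1 : ℕ) : ℝ≥0∞)⁻¹ := by
        rw [show (2 * (-1 / 2) : ℝ) = -1 by norm_num, Real.rpow_neg_one,
          ENNReal.ofReal_inv_of_pos (by positivity), ENNReal.ofReal_natCast]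
      simp only [e] at h3
      refine h1.trans ?_
      rwa [ENNReal.inv_mul_le_iff (by simp) (by finiteness)] at h3
    have hpair : ‖pair (extend w (ℓ + 1) t) fun ξ => φ (ξ - a)‖ₑ
        ≤ ((ℓ + 1 : ℕ) : ℝ≥0∞) * B := by
      rw [← (hφ.translate ha).setIntegral_eq_pair]
      have hsh : ∫⁻ ξ in Ioi (0 : ℝ), ‖((φ (ξ - a) : ℝ) : ℂ)‖ₑ ^ 2 ≤ S := by
        refine (setLIntegral_le_lintegral _ _).trans (le_of_eq ?_)
        exact lintegral_sub_right_eq_self (fun ξ => ‖((φ ξ : ℝ) : ℂ)‖ₑ ^ 2) a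
      have hmeas : Measurable fun ξ => ‖extend w (ℓ + 1) t ξ‖ₑ ^ 2 :=
        ((((hw.continuous_extend (ℓ + 1)).comp
          (continuous_const.prodMk continuous_id)).enorm.measurable).pow_const 2)
      calc _ ≤ ∫⁻ ξ in Ioi (0 : ℝ), ‖extend w (ℓ + 1) t ξ * ((φ (ξ - a) : ℝ) : ℂ)‖ₑ :=
            enorm_integral_le_lintegral_enorm _
        _ ≤ ∫⁻ ξ in Ioi (0 : ℝ), (‖extend w (ℓ + 1) t ξ‖ₑ ^ 2 + ‖((φ (ξ - a) : ℝ) : ℂ)‖ₑ ^ 2) := by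
            refine lintegral_mono fun ξ => ?_
            rw [enorm_mul]
            exact mul_le_sq_add_sq _ _
        _ = (∫⁻ ξ in Ioi (0 : ℝ), ‖extend w (ℓ + 1) t ξ‖ₑ ^ 2)
            + ∫⁻ ξ in Ioi (0 : ℝ), ‖((φ (ξ - a) : ℝ) : ℂ)‖ₑ ^ 2 := lintegral_add_left hmeas _
        _ ≤ ((ℓ + 1 : ℕ) : ℝ≥0∞) * ENNReal.ofReal M ^ 2 + ((ℓ + 1 : ℕ) : ℝ≥0∞) * S := by
            refine add_le_add hL2 (hsh.trans ?_)
            refine le_mul_of_one_le_left' ?_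
            exact_mod_cast (by omega : 1 ≤ ℓ + 1)
        _ = _ := by rw [hB, mul_add]
    have := ENNReal.toReal_mono (by finiteness) hpair
    rw [toReal_enorm, ENNReal.toReal_mul, ENNReal.toReal_natCast] at this
    linarith

end evolution

lemma pair_intervalIntegral {Y : ℝ → ℝ → ℂ} (hY : Continuous (Function.uncurry Y)) {φ : ℝ → ℝ}
    (hφ : IsTest φ) {t : ℝ} (ht : 0 ≤ t) :
    pair (fun ξ => ∫ s in (0 : ℝ)..t, Y s ξ) φ = ∫ s in (0 : ℝ)..t, pair (Y s) φ := by
  unfold pair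
  have hφc := hφ.continuous
  have hcont : Continuous (Function.uncurry fun (s ξ : ℝ) => Y s ξ * ((φ ξ : ℝ) : ℂ)) :=
    hY.mul (by fun_prop)
  rw [intervalIntegral_integral_swap]
  · congr 1; ext ξ
    rw [intervalIntegral.integral_mul_const]
  · rw [uIoc_of_le ht]
    have hK : IsCompact (Icc 0 t ×ˢ tsupport φ) := isCompact_Icc.prod hφ.2.1
    have h1 : IntegrableOn (Function.uncurry fun (s ξ : ℝ) => Y s ξ * ((φ ξ : ℝ) : ℂ))
        (Icc 0 t ×ˢ tsupport φ) (volume.prod volume) := hcont.continuousOn.integrableOn_compact hK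
    have h2 : IntegrableOn (Function.uncurry fun (s ξ : ℝ) => Y s ξ * ((φ ξ : ℝ) : ℂ))
        (Icc 0 t ×ˢ univ) (volume.prod volume) := by
      refine h1.of_forall_sdiff_eq_zero (measurableSet_Icc.prod MeasurableSet.univ) ?_
      rintro ⟨s, ξ⟩ ⟨hs, hns⟩
      have : ξ ∉ tsupport φ := fun h => hns ⟨hs.1, h⟩
      simp [Function.uncurry, image_eq_zero_of_notMem_tsupport this]
    have h3 := h2.mono_set (prod_mono_left (Ioc_subset_Icc_self (a := (0 : ℝ)) (b := t)))
    rwa [IntegrableOn, ← Measure.prod_restrict, Measure.restrict_univ] at h3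

lemma eq_zero_of_pair_eq_zero {v : ℝ → ℂ} (hv : Continuous v)
    (h : ∀ φ, IsTest φ → pair v φ = 0) {ξ : ℝ} (hξ : 0 ≤ ξ) : v ξ = 0 := by
  have h1 := isOpen_Ioi.ae_eq_zero_of_integral_contDiff_smul_eq_zero (U := Ioi (0 : ℝ))
    (hv.locallyIntegrable.locallyIntegrableOn _ (μ := volume)) fun φ h1 h2 h3 => by
      have := h φ ⟨h1, h2, h3⟩
      rw [pair] at this
      rw [← this]
      congr 1; ext x
      rw [Complex.real_smul, mul_comm]
  have h2 : v =ᵐ[volume.restrict (Ici (0 : ℝ))] fun _ => 0 := by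
    rw [Measure.restrict_congr_set Ioi_ae_eq_Ici.symm]
    exact (ae_restrict_iff' measurableSet_Ioi).mpr h1
  exact Measure.eqOn_of_ae_eq h2 hv.continuousOn continuousOn_const (by simp) hξ

/-! ### The evolution of the rotation mode -/

lemma pair_const_mul (c : ℂ) (v : ℝ → ℂ) (φ : ℝ → ℝ) :
    pair (fun ξ => c * v ξ) φ = c * pair v φ := by
  unfold pair
  rw [← integral_const_mul]
  congr 1; ext ξ; ring

lemma IsTest.pair_add {φ : ℝ → ℝ} (hφ : IsTest φ) {u v : ℝ → ℂ} (hu : Continuous u)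
    (hv : Continuous v) : pair (fun ξ => u ξ + v ξ) φ = pair u φ + pair v φ := by
  unfold pair
  rw [← integral_add (hφ.integrable_mul hu) (hφ.integrable_mul hv)]
  congr 1; ext ξ; ring

lemma IsTest.pair_sub {φ : ℝ → ℝ} (hφ : IsTest φ) {u v : ℝ → ℂ} (hu : Continuous u)
    (hv : Continuous v) : pair (fun ξ => u ξ - v ξ) φ = pair u φ - pair v φ := by
  unfold pair
  rw [← integral_sub (hφ.integrable_mul hu) (hφ.integrable_mul hv)]
  congr 1; ext ξ; ring

section rotation
variable {K r : ℝ} {g : ℝ → ℝ}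

lemma pair_fHat_deriv {κ : ℝ} (hκ : 0 ≤ κ) (hg : Integrable g) (ℓ : ℕ) {φ : ℝ → ℝ}
    (hφ : IsTest φ) : pair (fHat κ g (ℓ + 1)) (deriv φ)
      = -((κ : ℂ) / 2 * (pair (fHat κ g (ℓ + 2)) φ - pair (fHat κ g ℓ) φ)) := by
  have hc := continuous_fHat hκ hg
  have h := (isWeakDeriv_of_hasDerivAt (hasDerivAt_fHat hκ hg ℓ)
    (continuous_const.mul ((hc (ℓ + 2)).sub (hc ℓ)))).2.2 φ hφ
  rw [hφ.deriv.setIntegral_eq_pair, hφ.setIntegral_eq_pair] at h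
  rw [h, pair_const_mul, hφ.pair_sub (hc _) (hc _)]

/-- `L₁ (D R̂ f̂) = -r · r_i`, tested against `φ`. -/
lemma testedRhs_rotMode (hs : IsStationaryState K r g) {w wi : ℝ → ℕ → ℝ → ℂ}
    (hw : IsEvolution (K * r) (rotMode (K * r) g) w) (hwi : IsEvolution (K * r) (rI K r g) wi)
    (ℓ : ℕ) {φ : ℝ → ℝ} (hφ : IsTest φ) :
    testedRhs (K * r) (extend w) ℓ φ 0 = -(r : ℂ) * pair (extend wi (ℓ + 1) 0) φ := by
  have hκ : 0 ≤ K * r := mul_nonneg hs.K_nonneg hs.r_nonneg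
  have hc := continuous_fHat hκ hs.g_integrable
  have hX : ∀ (j : ℕ) {ψ : ℝ → ℝ}, IsTest ψ →
      pair (extend w j 0) ψ = Complex.I * j * pair (fHat (K * r) g j) ψ := by
    intro j ψ hψ
    rw [← pair_const_mul]
    refine pair_congr hψ fun ξ hξ => ?_
    cases j with
    | zero => simp [extend_zero]
    | succ j => rw [extend_succ w j le_rfl hξ.le, hw.initial (j + 1) (by omega) ξ hξ.le, rotMode]
  have hY : pair (extend wi (ℓ + 1) 0) φ = (K : ℂ) * ((ℓ + 1 : ℕ) : ℂ) * Complex.I / 2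
      * (pair (fHat (K * r) g ℓ) φ + pair (fHat (K * r) g (ℓ + 2)) φ) := by
    rw [← hφ.pair_add (hc _) (hc _), ← pair_const_mul]
    refine pair_congr hφ fun ξ hξ => ?_
    rw [extend_succ wi ℓ le_rfl hξ.le, hwi.initial (ℓ + 1) (by omega) ξ hξ.le, rI]
    simp
  rw [testedRhs, hX _ hφ.deriv, hX _ hφ, hX _ hφ, hY, pair_fHat_deriv hκ hs.g_integrable ℓ hφ]
  push_cast
  ring

/-- Duhamel: D = w(t) - w(0) + r ∫₀^t wi has zero initial data. As L₁ w(0) = -r r_i and L₁ ∫₀^t wi =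
wi(t) - r_i, the inhomogeneous terms cancel and D solves the homogeneous weak hierarchy, so it
vanishes. -/
lemma evolution_rotMode (hs : IsStationaryState K r g) {w wi : ℝ → ℕ → ℝ → ℂ}
    (hw : IsEvolution (K * r) (rotMode (K * r) g) w) (hwi : IsEvolution (K * r) (rI K r g) wi)
    (ℓ : ℕ) {t ξ : ℝ} (ht : 0 ≤ t) (hξ : 0 ≤ ξ) :
    extend w ℓ t ξ = extend w ℓ 0 ξ - r * ∫ s in (0 : ℝ)..t, extend wi ℓ s ξ := by
  have hκ : 0 ≤ K * r := mul_nonneg hs.K_nonneg hs.r_nonneg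
  have hXc := hw.continuous_extend
  have hYc := hwi.continuous_extend
  have hXs : ∀ j s, Continuous (extend w j s) := fun j s =>
    (hXc j).comp (continuous_const.prodMk continuous_id)
  set Z : ℕ → ℝ → ℝ → ℂ := fun ℓ t ξ => ∫ s in (0 : ℝ)..t, extend wi ℓ s ξ with hZ
  have hZc : ∀ j, Continuous (Function.uncurry (Z j)) := by
    intro j
    have h1 : Continuous (Function.uncurry fun (q : ℝ × ℝ) (s : ℝ) => extend wi j s q.2) :=
      (hYc j).comp (continuous_snd.prodMk (continuous_snd.comp continuous_fst))
    exact intervalIntegral.continuous_parametric_intervalIntegral_of_continuous h1 continuous_fst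
  have hZs : ∀ j s, Continuous (Z j s) := fun j s =>
    (hZc j).comp (continuous_const.prodMk continuous_id)
  set D : ℕ → ℝ → ℝ → ℂ := fun ℓ t ξ => extend w ℓ t ξ - extend w ℓ 0 ξ + r * Z ℓ t ξ with hD
  have hDc : ∀ j, Continuous (Function.uncurry (D j)) := fun j =>
    ((hXc j).sub ((hXs j 0).comp continuous_snd)).add (continuous_const.mul (hZc j))
  have hpair : ∀ (j : ℕ) {ψ : ℝ → ℝ}, IsTest ψ → ∀ {s : ℝ}, 0 ≤ s → pair (D j s) ψ
      = pair (extend w j s) ψ - pair (extend w j 0) ψ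
        + r * ∫ τ in (0 : ℝ)..s, pair (extend wi j τ) ψ := by
    intro j ψ hψ s hs'
    rw [← pair_intervalIntegral (hYc j) hψ hs', ← hψ.pair_sub (hXs j s) (hXs j 0),
      ← pair_const_mul]
    exact hψ.pair_add ((hXs j s).sub (hXs j 0)) (continuous_const.mul (hZs j s))
  have hYi : ∀ (j : ℕ) {ψ : ℝ → ℝ}, IsTest ψ → ∀ a b : ℝ,
      IntervalIntegrable (fun τ => pair (extend wi j τ) ψ) volume a b := fun j ψ hψ a b =>
    (hψ.continuous_pair_time (hYc j)).intervalIntegrable a b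
  -- The extra term on the right is the time derivative of r ∫₀^s wi, paired with ψ; the initial
  -- values cancel by `testedRhs_rotMode`.
  have hrhs : ∀ (j : ℕ) {ψ : ℝ → ℝ}, IsTest ψ → ∀ {s : ℝ}, 0 ≤ s → testedRhs (K * r) D j ψ s
      = testedRhs (K * r) (extend w) j ψ s + r * pair (extend wi (j + 1) s) ψ := by
    intro j ψ hψ s hs'
    have h1 := testedRhs_rotMode hs hw hwi j hψ
    have h2 := hwi.pair_extend j hψ hs'
    have h3 : ∫ τ in (0 : ℝ)..s, testedRhs (K * r) (extend wi) j ψ τ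
        = -((j + 1 : ℕ) : ℂ) * (∫ τ in (0 : ℝ)..s, pair (extend wi (j + 1) τ) (deriv ψ))
          + ((K * r : ℝ) : ℂ) * ((j + 1 : ℕ) : ℂ) / 2
            * ((∫ τ in (0 : ℝ)..s, pair (extend wi j τ) ψ)
              - ∫ τ in (0 : ℝ)..s, pair (extend wi (j + 2) τ) ψ) := by
      rw [← intervalIntegral.integral_sub (hYi _ hψ _ _) (hYi _ hψ _ _),
        ← intervalIntegral.integral_const_mul, ← intervalIntegral.integral_const_mul,
        ← intervalIntegral.integral_add ((hYi _ hψ.deriv _ _).const_mul _)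
          (((hYi _ hψ _ _).sub (hYi _ hψ _ _)).const_mul _)]
      rfl
    rw [h2, h3]
    simp only [testedRhs] at h1 ⊢
    rw [hpair _ hψ.deriv hs', hpair _ hψ hs', hpair _ hψ hs']
    linear_combination -h1
  have hweak : ∀ (j : ℕ) (ψ : ℝ → ℝ), IsTest ψ → ∀ s, 0 ≤ s →
      pair (D (j + 1) s) ψ = ∫ τ in (0 : ℝ)..s, testedRhs (K * r) D j ψ τ := by
    intro j ψ hψ s hs'
    have h1 : ∫ τ in (0 : ℝ)..s, testedRhs (K * r) D j ψ τ = ∫ τ in (0 : ℝ)..s,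
        (testedRhs (K * r) (extend w) j ψ τ + r * pair (extend wi (j + 1) τ) ψ) :=
      intervalIntegral.integral_congr fun τ hτ => by
        rw [uIcc_of_le hs'] at hτ
        exact hrhs j hψ hτ.1
    rw [h1, intervalIntegral.integral_add
      ((continuous_testedRhs hXc j hψ).intervalIntegrable _ _) ((hYi _ hψ _ _).const_mul _),
      intervalIntegral.integral_const_mul, hpair _ hψ hs', hw.pair_extend j hψ hs']
    ring
  have hb : ∀ ψ : ℝ → ℝ, IsTest ψ → ∀ T : ℝ, ∃ M : ℝ, 0 ≤ M ∧ ∀ (j : ℕ) (s a : ℝ),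
      0 ≤ s → s ≤ T → 0 ≤ a → ‖pair (D j s) fun ξ => ψ (ξ - a)‖ ≤ M * j := by
    intro ψ hψ T
    obtain ⟨M, hM, h1⟩ := hw.pair_bound hψ T
    obtain ⟨N, hN, h2⟩ := hwi.pair_bound hψ T
    have hr := hs.r_nonneg
    refine ⟨M + M + r * (N * |T|), by positivity, fun j s a hs' hsT ha => ?_⟩
    have hT : 0 ≤ T := hs'.trans hsT
    rw [hpair j (hψ.translate ha) hs']
    have h3 : ‖∫ τ in (0 : ℝ)..s, pair (extend wi j τ) fun ξ => ψ (ξ - a)‖ ≤ N * j * |s - 0| :=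
      intervalIntegral.norm_integral_le_of_norm_le_const fun τ hτ => by
        rw [uIoc_of_le hs'] at hτ
        exact h2 j τ a hτ.1.le (hτ.2.trans hsT) ha
    have h4 : ‖∫ τ in (0 : ℝ)..s, pair (extend wi j τ) fun ξ => ψ (ξ - a)‖ ≤ N * j * |T| := by
      refine h3.trans ?_
      rw [sub_zero, abs_of_nonneg hs', abs_of_nonneg hT]
      gcongr
    calc _ ≤ ‖pair (extend w j s) fun ξ => ψ (ξ - a)‖ + ‖pair (extend w j 0) fun ξ => ψ (ξ - a)‖
          + ‖(r : ℂ) * ∫ τ in (0 : ℝ)..s, pair (extend wi j τ) fun ξ => ψ (ξ - a)‖ :=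
          (norm_add_le _ _).trans (add_le_add_left (norm_sub_le _ _) _)
      _ ≤ M * j + M * j + r * (N * j * |T|) := by
          rw [norm_mul, Complex.norm_real, Real.norm_of_nonneg hr]
          gcongr
          · exact h1 j s a hs' hsT ha
          · exact h1 j 0 a le_rfl hT ha
      _ = _ := by ring
  have hD0 : ∀ s ξ, D 0 s ξ = 0 := by
    intro s ξ
    simp [hD, hZ, extend_zero]
  have h := eq_zero_of_pair_eq_zero ((hDc ℓ).comp (continuous_const.prodMk continuous_id))
    (fun φ hφ => pair_eq_zero_of_weak hκ hDc hD0 hweak hb hφ ℓ ht) hξ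
  simp only [hD, Function.comp, Function.uncurry, id] at h
  linear_combination h

/-- Complex conjugate of the self-consistency equation, r being real. -/
lemma fHat_one_zero (hs : IsStationaryState K r g) : fHat (K * r) g 1 0 = r := by
  have h := congrArg (starRingEnd ℂ) hs.self_consistent
  rw [Complex.conj_ofReal, ← integral_conj] at h
  rw [h, fHat]
  congr 1; ext ω
  rw [map_mul, Complex.conj_ofReal, ← integral_conj]
  congr 2; ext θ
  rw [← Complex.exp_conj]
  simp

/-- The first mode of the evolved rotation mode, observed at `ξ = 0`. -/
lemma evolution_rotMode_one (hs : IsStationaryState K r g) {w wi : ℝ → ℕ → ℝ → ℂ}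
    (hw : IsEvolution (K * r) (rotMode (K * r) g) w) (hwi : IsEvolution (K * r) (rI K r g) wi)
    {t : ℝ} (ht : 0 ≤ t) :
    w t 1 0 = Complex.I * r - r * ∫ s in (0 : ℝ)..t, wi s 1 0 := by
  have h := evolution_rotMode hs hw hwi 1 ht (le_refl (0 : ℝ))
  have e : ∫ s in (0 : ℝ)..t, extend wi 1 s 0 = ∫ s in (0 : ℝ)..t, wi s 1 0 :=
    intervalIntegral.integral_congr fun s hs' => by
      rw [uIcc_of_le ht] at hs'
      exact extend_succ wi 0 hs'.1 le_rfl
  rw [e, extend_succ w 0 ht le_rfl, extend_succ w 0 le_rfl le_rfl, hw.initial 1 le_rfl 0 le_rfl,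
    rotMode, fHat_one_zero hs] at h
  simpa using h

end rotation

/-! ### The functional `α` on the rotation mode -/

/-- Fubini on the triangle 0 < s ≤ t ≤ T, realised by an indicator on the square. -/
lemma integral_convolution {R h : ℝ → ℝ} {T : ℝ} (hT : 0 ≤ T) (hR : IntegrableOn R (Ioc 0 T))
    (hh : Continuous h) :
    IntervalIntegrable (fun t => ∫ s in (0 : ℝ)..t, R (t - s) * h s) volume 0 T ∧
      ∫ t in (0 : ℝ)..T, ∫ s in (0 : ℝ)..t, R (t - s) * h s
        = ∫ s in (0 : ℝ)..T, R s * ∫ u in (0 : ℝ)..(T - s), h u := by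
  set F : ℝ → ℝ → ℝ := fun t s => R s * (Ici s).indicator (fun t => h (t - s)) t with hF
  have hleft : ∀ t ∈ Ioc 0 T, ∫ s in (0 : ℝ)..t, R (t - s) * h s = ∫ s in Ioc 0 T, F t s := by
    intro t ht
    have h1 := intervalIntegral.integral_comp_sub_left (a := 0) (b := t)
      (fun s => R s * h (t - s)) t
    simp only [sub_sub_cancel, sub_self, sub_zero] at h1
    rw [h1, ← intervalIntegral.integral_indicator (a₂ := t) (a₃ := T) ⟨ht.1.le, ht.2⟩,
      intervalIntegral.integral_of_le hT]
    congr 1; ext s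
    simp only [hF, indicator, mem_ofPred_eq, mem_Ici]
    split_ifs <;> simp
  have hright : ∀ s ∈ Ioc 0 T, ∫ t in Ioc 0 T, F t s = R s * ∫ u in (0 : ℝ)..(T - s), h u := by
    intro s hs
    have hset : Ioc 0 T ∩ Ici s = Icc s T := by
      ext t
      simp only [mem_inter_iff, mem_Ioc, mem_Ici, mem_Icc]
      exact ⟨fun h => ⟨h.2, h.1.2⟩, fun h => ⟨⟨hs.1.trans_le h.1, h.2⟩, h.1⟩⟩
    rw [integral_const_mul, setIntegral_indicator measurableSet_Ici, hset,
      integral_Icc_eq_integral_Ioc, ← intervalIntegral.integral_of_le hs.2,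
      intervalIntegral.integral_comp_sub_right h s, sub_self]
  obtain ⟨B, hB⟩ := isCompact_Icc.exists_bound_of_continuousOn (s := Icc 0 T) hh.continuousOn
  have hB0 : 0 ≤ B := (norm_nonneg _).trans (hB 0 ⟨le_rfl, hT⟩)
  have hInt : Integrable (Function.uncurry F)
      ((volume.restrict (Ioc 0 T)).prod (volume.restrict (Ioc 0 T))) := by
    have h1 : Integrable (fun q : ℝ × ℝ => R q.2)
        ((volume.restrict (Ioc 0 T)).prod (volume.restrict (Ioc 0 T))) :=
      Integrable.comp_snd (μ := volume.restrict (Ioc 0 T)) hR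
    have hm : Measurable fun q : ℝ × ℝ => (Ici q.2).indicator (fun t => h (t - q.2)) q.1 := by
      have e : (fun q : ℝ × ℝ => (Ici q.2).indicator (fun t => h (t - q.2)) q.1)
          = {q : ℝ × ℝ | q.2 ≤ q.1}.indicator fun q => h (q.1 - q.2) := by
        ext q; simp [indicator]
      rw [e]
      exact (hh.measurable.comp (measurable_fst.sub measurable_snd)).indicator
        (measurableSet_le measurable_snd measurable_fst)
    refine h1.mul_bdd (c := B) hm.aestronglyMeasurable ?_
    rw [Measure.prod_restrict]
    refine (ae_restrict_iff' (measurableSet_Ioc.prod measurableSet_Ioc)).mpr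
      (ae_of_all _ fun q hq => ?_)
    by_cases hle : q.2 ≤ q.1
    · rw [indicator_of_mem (mem_Ici.mpr hle)]
      exact hB _ ⟨sub_nonneg.mpr hle, by linarith [hq.1.2, hq.2.1]⟩
    · rw [indicator_of_notMem (by simpa using hle)]
      simpa using hB0
  refine ⟨(intervalIntegrable_iff_integrableOn_Ioc_of_le hT).mpr
    (IntegrableOn.congr_fun hInt.integral_prod_left (fun t ht => (hleft t ht).symm)
      measurableSet_Ioc), ?_⟩
  rw [intervalIntegral.integral_of_le hT, intervalIntegral.integral_of_le hT,
    setIntegral_congr_fun measurableSet_Ioc hleft, integral_integral_swap hInt,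
    setIntegral_congr_fun measurableSet_Ioc hright]

/-- If `S ⋆ z` and `q` are integrable and `∫₀ᵀ y + S ⋆ z = q - r`, then the integral of `y` over
the half line is `-r`. -/
lemma integral_eq_neg_of_forall_add_eq {y q S₀ S₁ z₀ z₁ : ℝ → ℝ} {r : ℝ}
    (hy : IntegrableOn y (Ioi 0)) (hq : IntegrableOn q (Ioi 0))
    (hS₀ : IntegrableOn S₀ (Ioi 0)) (hS₁ : IntegrableOn S₁ (Ioi 0))
    (hz₀ : IntegrableOn z₀ (Ioi 0)) (hz₁ : IntegrableOn z₁ (Ioi 0))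
    (h : ∀ T, 0 < T → (∫ s in (0 : ℝ)..T, y s) + ((∫ s in (0 : ℝ)..T, S₀ s * z₀ (T - s))
      + ∫ s in (0 : ℝ)..T, S₁ s * z₁ (T - s)) = q T - r) :
    ∫ t in Ioi (0 : ℝ), y t = -r := by
  have hc₀ := integrable_posConvolution (μ := volume) hS₀ hz₀ (ContinuousLinearMap.mul ℝ ℝ)
  have hc₁ := integrable_posConvolution (μ := volume) hS₁ hz₁ (ContinuousLinearMap.mul ℝ ℝ)
  -- By hypothesis this function equals q minus two convolutions of integrable functions, hence is
  -- integrable on the half line. It also converges at infinity, so its limit can only be 0.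
  have hInt : IntegrableOn (fun T => (∫ s in (0 : ℝ)..T, y s) + r) (Ioi 0) := by
    refine ((hq.sub hc₀.integrableOn).sub hc₁.integrableOn).congr_fun (fun T hT => ?_)
      measurableSet_Ioi
    have := h T hT
    simp only [Pi.sub_apply, posConvolution, indicator_of_mem hT, ContinuousLinearMap.mul_apply']
    linarith
  have hlim : Tendsto (fun T => (∫ s in (0 : ℝ)..T, y s) + r) atTop
      (𝓝 ((∫ t in Ioi (0 : ℝ), y t) + r)) :=
    (intervalIntegral_tendsto_integral_Ioi 0 hy tendsto_id).add_const r
  have := IntegrableAtFilter.eq_zero_of_tendsto (μ := volume) ⟨_, Ioi_mem_atTop 0, hInt⟩ (by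
    intro s hs
    obtain ⟨b, hb⟩ := mem_atTop_sets.mp hs
    refine top_unique ?_
    rw [← Real.volume_Ici (a := b)]
    exact measure_mono fun x hx => hb x hx) hlim
  linarith

/-- `α(D R̂ f̂) = -r`. -/
theorem alpha_rotMode {K r : ℝ} {g : ℝ → ℝ} (hs : IsStationaryState K r g) {cr ci a : ℝ}
    (hc : IsRotationCoeff K r g cr ci) (ha : IsAlpha (K * r) cr ci (rotMode (K * r) g) a) :
    a = -r := by
  obtain ⟨wr, wi, -, hwi, R, ⟨hRloc, hR⟩, hS⟩ := hc
  obtain ⟨w, hw, hInt, rfl⟩ := ha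
  set z : ℝ → ℂ := fun t => w t 1 0 with hz
  have hre : IntegrableOn (fun t => (z t).re) (Ioi 0) := hInt.re
  have him : IntegrableOn (fun t => (z t).im) (Ioi 0) := hInt.im
  -- Real and imaginary part of h form the second column of k_{Lc}; the extension makes h continuous
  -- on the whole line.
  set h : ℝ → ℂ := fun t => -extend wi 1 t 0 with hh
  have hhc : Continuous h :=
    ((hwi.continuous_extend 1).comp (continuous_id.prodMk continuous_const)).neg
  have hhre : Continuous fun t => (h t).re := Complex.continuous_re.comp hhc
  have hhim : Continuous fun t => (h t).im := Complex.continuous_im.comp hhc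
  have hheq : ∀ t, 0 ≤ t → h t = -wi t 1 0 := fun t ht => by
    simp only [hh]; rw [extend_succ wi 0 ht le_rfl]
  have hzeq : ∀ t, 0 ≤ t → z t = Complex.I * r + r * ∫ s in (0 : ℝ)..t, h s := by
    intro t ht
    have e : ∫ s in (0 : ℝ)..t, h s = -∫ s in (0 : ℝ)..t, wi s 1 0 := by
      rw [← intervalIntegral.integral_neg]
      refine intervalIntegral.integral_congr fun s hs' => ?_
      rw [uIcc_of_le ht] at hs'
      exact hheq s hs'.1
    simp only [hz]
    rw [evolution_rotMode_one hs hw hwi ht, e]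
    ring
  have hzre : ∀ t, 0 ≤ t → (z t).re = r * ∫ s in (0 : ℝ)..t, (h s).re := by
    intro t ht
    have := Complex.reCLM.intervalIntegral_comp_comm (hhc.intervalIntegrable (μ := volume) 0 t)
    simp only [Complex.reCLM_apply] at this
    rw [hzeq t ht, this]
    simp
  have hzim : ∀ t, 0 ≤ t → (z t).im = r + r * ∫ s in (0 : ℝ)..t, (h s).im := by
    intro t ht
    have := Complex.imCLM.intervalIntegral_comp_comm (hhc.intervalIntegrable (μ := volume) 0 t)
    simp only [Complex.imCLM_apply] at this
    rw [hzeq t ht, this]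
    simp
  have hRint : ∀ i j, ∀ T, IntegrableOn (fun t => R t i j) (Ioc 0 T) := fun i j T =>
    ((hRloc i j).integrableOn_compact_subset Icc_subset_Ici_self isCompact_Icc).mono_set
      Ioc_subset_Icc_self
  -- Lower right entry of R + R ⋆ k_{Lc} = k_{Lc}: it pairs the second row of R, which carries c_r
  -- and c_i, with the column coming from r_i.
  have hrow : ∀ᵐ t ∂(volume.restrict (Ioi (0 : ℝ))), R t 1 1
      + ((∫ s in (0 : ℝ)..t, R (t - s) 1 0 * (h s).re)
        + ∫ s in (0 : ℝ)..t, R (t - s) 1 1 * (h s).im) = (h t).im := by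
    filter_upwards [hR, ae_restrict_mem measurableSet_Ioi] with t ht ht0
    have ht0' : (0 : ℝ) ≤ t := le_of_lt ht0
    have h1 := congrFun (congrFun ht.2 1) 1
    have hI : ∀ (j : Fin 2) {f : ℝ → ℝ}, Continuous f →
        IntervalIntegrable (fun s => R (t - s) 1 j * f s) volume 0 t := by
      intro j f hf
      have h2 : IntervalIntegrable (fun s => R s 1 j) volume 0 t :=
        (intervalIntegrable_iff_integrableOn_Ioc_of_le ht0').mpr (hRint 1 j t)
      have h3 := (h2.comp_sub_left t).symm
      simp only [sub_zero, sub_self] at h3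
      exact h3.mul_continuousOn hf.continuousOn
    rw [← intervalIntegral.integral_add (hI 0 hhre) (hI 1 hhim)]
    rw [Matrix.add_apply, conv] at h1
    have e1 : kLc wr wi t 1 1 = (h t).im := by
      rw [hheq t ht0']; simp [kLc]
    rw [e1] at h1
    rw [← h1]
    congr 1
    refine intervalIntegral.integral_congr fun s hs' => ?_
    rw [uIcc_of_le ht0'] at hs'
    simp only [Matrix.mul_apply, Fin.sum_univ_two, hheq s hs'.1]
    simp [kLc]
  -- The row equation is integrated over (0, T) and multiplied by r. Since z = ir + r ∫ h, the
  -- primitives of h become z, and the term ∫ R₁₁ is absorbed by the constant ir.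
  have hkey : ∀ T, 0 < T → (∫ s in (0 : ℝ)..T, R s 1 0 * (z (T - s)).re)
      + ∫ s in (0 : ℝ)..T, R s 1 1 * (z (T - s)).im = (z T).im - r := by
    intro T hT
    have hRi : ∀ j, IntervalIntegrable (fun s => R s 1 j) volume 0 T := fun j =>
      (intervalIntegrable_iff_integrableOn_Ioc_of_le hT.le).mpr (hRint 1 j T)
    obtain ⟨i₀, e₀⟩ := integral_convolution hT.le (hRint 1 0 T) hhre
    obtain ⟨i₁, e₁⟩ := integral_convolution hT.le (hRint 1 1 T) hhim
    have h1 : ∫ t in (0 : ℝ)..T, (R t 1 1 + ((∫ s in (0 : ℝ)..t, R (t - s) 1 0 * (h s).re)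
        + ∫ s in (0 : ℝ)..t, R (t - s) 1 1 * (h s).im)) = ∫ t in (0 : ℝ)..T, (h t).im := by
      rw [intervalIntegral.integral_of_le hT.le, intervalIntegral.integral_of_le hT.le]
      exact integral_congr_ae (ae_restrict_of_ae_restrict_of_subset Ioc_subset_Ioi_self hrow)
    rw [intervalIntegral.integral_add (hRi 1) (i₀.add i₁), intervalIntegral.integral_add i₀ i₁,
      e₀, e₁] at h1
    have h2 : ∫ s in (0 : ℝ)..T, R s 1 0 * (z (T - s)).re
        = r * ∫ s in (0 : ℝ)..T, R s 1 0 * ∫ u in (0 : ℝ)..(T - s), (h u).re := by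
      rw [← intervalIntegral.integral_const_mul]
      refine intervalIntegral.integral_congr fun s hs' => ?_
      rw [uIcc_of_le hT.le] at hs'
      simp only [hzre _ (sub_nonneg.mpr hs'.2)]
      ring
    have hprim : Continuous fun s => ∫ u in (0 : ℝ)..(T - s), (h u).im :=
      (intervalIntegral.continuous_primitive (fun _ _ => hhim.intervalIntegrable _ _) 0).comp
        (continuous_const.sub continuous_id)
    have h3 : ∫ s in (0 : ℝ)..T, R s 1 1 * (z (T - s)).im = r * (∫ s in (0 : ℝ)..T, R s 1 1)
        + r * ∫ s in (0 : ℝ)..T, R s 1 1 * ∫ u in (0 : ℝ)..(T - s), (h u).im := by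
      rw [← intervalIntegral.integral_const_mul, ← intervalIntegral.integral_const_mul,
        ← intervalIntegral.integral_add ((hRi 1).const_mul r)
          (((hRi 1).mul_continuousOn hprim.continuousOn).const_mul r)]
      refine intervalIntegral.integral_congr fun s hs' => ?_
      rw [uIcc_of_le hT.le] at hs'
      simp only [hzim _ (sub_nonneg.mpr hs'.2)]
      ring
    rw [h2, h3, hzim T hT.le, ← h1]
    ring
  refine integral_eq_neg_of_forall_add_eq ((hre.const_mul cr).add (him.const_mul ci)) him
    (hS 1 0) (hS 1 1) hre him fun T hT => ?_
  have hzcre : ContinuousOn (fun t => (z t).re) (Icc 0 T) := by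
    have : Continuous fun t => r * ∫ s in (0 : ℝ)..t, (h s).re := continuous_const.mul
      (intervalIntegral.continuous_primitive (fun _ _ => hhre.intervalIntegrable _ _) 0)
    exact this.continuousOn.congr fun t ht => hzre t ht.1
  have hzcim : ContinuousOn (fun t => (z t).im) (Icc 0 T) := by
    have : Continuous fun t => r + r * ∫ s in (0 : ℝ)..t, (h s).im :=
      continuous_const.add (continuous_const.mul
        (intervalIntegral.continuous_primitive (fun _ _ => hhim.intervalIntegrable _ _) 0))
    exact this.continuousOn.congr fun t ht => hzim t ht.1
  have hreflect : MapsTo (fun s => T - s) (uIcc 0 T) (Icc 0 T) := fun s hs' => by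
    rw [uIcc_of_le hT.le] at hs'
    exact ⟨sub_nonneg.mpr hs'.2, sub_le_self _ hs'.1⟩
  have hr₀ : ContinuousOn (fun s => (z (T - s)).re) (uIcc 0 T) :=
    hzcre.comp (continuous_const.sub continuous_id).continuousOn hreflect
  have hr₁ : ContinuousOn (fun s => (z (T - s)).im) (uIcc 0 T) :=
    hzcim.comp (continuous_const.sub continuous_id).continuousOn hreflect
  have hSi : ∀ j, IntervalIntegrable (fun s => R s 1 j - KTheta cr ci 1 j) volume 0 T := fun j =>
    (intervalIntegrable_iff_integrableOn_Ioc_of_le hT.le).mpr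
      ((hS 1 j).mono_set Ioc_subset_Ioi_self)
  have hy : ∫ s in (0 : ℝ)..T, (cr * (z s).re + ci * (z s).im)
      = (∫ s in (0 : ℝ)..T, cr * (z (T - s)).re) + ∫ s in (0 : ℝ)..T, ci * (z (T - s)).im := by
    have := intervalIntegral.integral_comp_sub_left (a := 0) (b := T)
      (fun s => cr * (z s).re + ci * (z s).im) T
    rw [sub_self, sub_zero] at this
    rw [← this, intervalIntegral.integral_add (hr₀.intervalIntegrable.const_mul cr)
      (hr₁.intervalIntegrable.const_mul ci)]
  -- The constant part of R convolves with z to the plain integral ∫₀^T (c_r Re z + c_i Im z); the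
  -- remainder is the integrable part of the resolvent.
  have hsplit : ∀ (j : Fin 2) {c : ℝ} {f : ℝ → ℝ}, KTheta cr ci 1 j = c →
      ContinuousOn f (uIcc 0 T) → ∫ s in (0 : ℝ)..T, R s 1 j * f s
        = (∫ s in (0 : ℝ)..T, c * f s)
          + ∫ s in (0 : ℝ)..T, (R s 1 j - KTheta cr ci 1 j) * f s := by
    rintro j c f rfl hf
    rw [← intervalIntegral.integral_add (hf.intervalIntegrable.const_mul _)
      ((hSi j).mul_continuousOn hf)]
    congr 1; ext s; ring
  have e := hkey T hT
  rw [hsplit 0 (c := cr) (by simp [KTheta]) hr₀, hsplit 1 (c := ci) (by simp [KTheta]) hr₁] at e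
  simp only [hz] at hy e ⊢
  rw [hy]
  linarith

/-! ### The bounds of the stationary state -/

/-- A bound by every Sobolev integral of `v`, with a factor `‖c‖ₑ ≤ x` and a constant below `C`,
is a bound by the profile norm. -/
lemma le_ofReal_mul_profileNorm {b C x : ℝ} {v : ℝ → ℂ} {X B : ℝ≥0∞} {c : ℂ} (hx : 0 < x)
    (hC : 0 < C) (hB : B ≤ ENNReal.ofReal C) (hc : ‖c‖ ≤ x)
    (h : ∀ w, IsWeakDeriv v w → X ≤ ‖c‖ₑ * B * sobolevInt b v w ^ (1 / 2 : ℝ)) :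
    X ≤ ENNReal.ofReal (x * C) * profileNorm (p b) v := by
  refine le_const_mul_profileNorm (ENNReal.ofReal_pos.mpr (mul_pos hx hC)).ne'
    ENNReal.ofReal_ne_top fun w hw => (h w hw).trans ?_
  rw [ENNReal.ofReal_mul hx.le]
  gcongr
  rw [← ofReal_norm]
  exact ENNReal.ofReal_le_ofReal hc

end Kuramoto

end

theorem mainTheorem4 (b : ℝ) (hb : 0 ≤ b) (n : ℕ) (k : ℝ) (hk : k = (n : ℝ) / 2)
    (κ : ℝ) (hκ : 0 ≤ κ) :
    ∃ C : ℝ, 0 < C ∧ ∀ (K r : ℝ) (g : ℝ → ℝ), K * r = κ → Kuramoto.IsStationaryState K r g →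
      Kuramoto.modeNorm (Kuramoto.p b) k (Kuramoto.fHat (K * r) g)
          ≤ ENNReal.ofReal C
            * Kuramoto.profileNorm (Kuramoto.p (b + k + 1)) (Kuramoto.gHat g) ∧
      Kuramoto.modeNorm (Kuramoto.p b) k (Kuramoto.rR K r g)
          ≤ ENNReal.ofReal (K * C)
            * Kuramoto.profileNorm (Kuramoto.p (b + k + 2)) (Kuramoto.gHat g) ∧
      Kuramoto.modeNorm (Kuramoto.p b) k (Kuramoto.rI K r g)
          ≤ ENNReal.ofReal (K * C)
            * Kuramoto.profileNorm (Kuramoto.p (b + k + 2)) (Kuramoto.gHat g) ∧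
      (0 < r → ∀ cr ci a : ℝ, Kuramoto.IsRotationCoeff K r g cr ci →
        Kuramoto.IsAlpha (K * r) cr ci (Kuramoto.rotMode (K * r) g) a →
        a ≠ 0 ∧
        Kuramoto.modeNorm (Kuramoto.p b) k (Kuramoto.rTheta (K * r) g a)
          ≤ ENNReal.ofReal (C / r)
            * Kuramoto.profileNorm (Kuramoto.p (b + k + 2)) (Kuramoto.gHat g)) := by
  open Kuramoto in
  subst hk
  obtain ⟨C₁, hC₁, h₁⟩ := exists_modeNorm_fHat_bound hκ n hb
  obtain ⟨C₂, hC₂, h₂⟩ := exists_modeNorm_neighbours_bound hκ n hb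
  obtain ⟨C₃, hC₃, h₃⟩ := exists_modeNorm_rotation_bound hκ n hb
  -- The added 1 keeps the constant positive even if all three bounds vanish.
  set C : ℝ := (C₁ + C₂ + C₃).toReal + 1 with hC
  have hC0 : 0 < C := by positivity
  have hle : C₁ + C₂ + C₃ ≤ ENNReal.ofReal C := by
    rw [ENNReal.le_ofReal_iff_toReal_le (by finiteness) hC0.le]
    linarith
  have hle₁ : C₁ ≤ ENNReal.ofReal C := (le_self_add.trans le_self_add).trans hle
  have hle₂ : C₂ ≤ ENNReal.ofReal C := (le_add_self.trans le_self_add).trans hle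
  have hle₃ : C₃ ≤ ENNReal.ofReal C := le_add_self.trans hle
  refine ⟨C, hC0, ?_⟩
  rintro K r g rfl hs
  have hg := hs.g_integrable
  refine ⟨?_, ?_, ?_, ?_⟩
  · have := le_ofReal_mul_profileNorm (c := 1) one_pos hC0 hle₁ (by simp) fun w _ => by
      simpa using h₁ g hg hs.g_nonneg hs.g_mass w
    simpa using this
  · rcases hs.K_nonneg.eq_or_lt with rfl | hK
    · rw [modeNorm_eq_zero fun ℓ => by ext ξ; simp [rR]]
      exact zero_le
    · refine le_ofReal_mul_profileNorm (c := (K : ℂ) / 2) hK hC0 hle₂ ?_ fun w hw =>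
        h₂ g hg hs.g_nonneg hs.g_mass w hw _ (-1) _ (by simp) fun ℓ ξ => ?_
      · rw [norm_div, Complex.norm_real, Real.norm_of_nonneg hK.le]
        norm_num
        linarith
      · simp only [rR, Nat.add_sub_cancel]
        ring
  · rcases hs.K_nonneg.eq_or_lt with rfl | hK
    · rw [modeNorm_eq_zero fun ℓ => by ext ξ; simp [rI]]
      exact zero_le
    · refine le_ofReal_mul_profileNorm (c := (K : ℂ) * Complex.I / 2) hK hC0 hle₂ ?_ fun w hw =>
        h₂ g hg hs.g_nonneg hs.g_mass w hw _ 1 _ (by simp) fun ℓ ξ => ?_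
      · rw [norm_div, norm_mul, Complex.norm_real, Real.norm_of_nonneg hK.le]
        norm_num
        linarith
      · simp only [rI, Nat.add_sub_cancel]
        ring
  · intro hr cr ci a hc ha
    obtain rfl : a = -r := alpha_rotMode hs hc ha
    refine ⟨neg_ne_zero.mpr hr.ne', ?_⟩
    rw [div_eq_inv_mul C r]
    -- Because α(D R̂ f̂) = -r, the normalised mode is the rotation mode scaled by a factor of
    -- modulus 1/r.
    refine le_ofReal_mul_profileNorm (c := Complex.I / ((-r : ℝ) : ℂ)) (inv_pos.mpr hr) hC0 hle₃ ?_
      fun w _ => h₃ g hg hs.g_nonneg hs.g_mass w _ _ fun ℓ ξ => ?_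
    · rw [norm_div, Complex.norm_real, norm_neg, Real.norm_of_nonneg hr.le]
      simp
    · simp only [rTheta, rotMode]
      ring
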